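/- **Setting.** Let $(\mathcal V,\otimes,\mathbf 1,[-,-])$ be a symmetric monoidal closed category with all small limits, $X$ a (small) set, $S(X)$ the free symmetric monoidal category on $X$, and $P$ an $X$-coloured symmetric operad in $\mathcal V$, with components $P(\bar x;y)$ for $\bar x\in S(X)$, $y\in X$. For $C\in\mathcal V^X$ and $\bar x=x_1\cdots x_n$ put $C^{\otimes\bar x}=C_{x_1}\otimes\dots\otimes C_{x_n}$. A $P$-coalgebra is a $C\in\mathcal V^X$ with maps $P(\bar x;y)\otimes C_y\to C^{\otimes\bar x}$ that are natural in $\bar x\in S(X)$ and compatible with the units and compositions of $P$. **Hypothesis on $\mathcal V$.** Call a tower $\cdots\to A_{k+1}\to A_k\to\cdots\to A_0$ of monomorphisms a countable intersection. Assume that either (a) or (b) holds. (a) The functor $\otimes$ preserves countable intersections in each variable (it sends monomorphisms to monomorphisms and preserves the limits of such towers), and moreover one of the following holds: (a1) for all small families $(A_j,A'_j)_{j\in J}$, $(B_k,B'_k)_{k\in K}$ of pairs of objects the canonical map $\prod_j[A_j,A'_j]\otimes\prod_k[B_k,B'_k]\to\prod_{j,k}[A_j\otimes B_k,A'_j\otimes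 B'_k]$ is a monomorphism; or (a2) for all objects the canonical map $[A,A']\otimes[B,B']\to[A\otimes B,A'\otimes B']$ is a monomorphism, and $\mathcal V$ has small coproducts, whose coprojections are monomorphisms. (b) $\otimes$ is the cartesian product of $\mathcal V$ and $\mathbf 1$ is terminal. **The functor $Q_\infty=P^\vee$.** Let $P^\wedge,P^\wedge_2:\mathcal V^X\to\mathcal V^X$ be $$P^\wedge(C)_y=\int_{\bar x}[P(\bar x;y),C^{\otimes\bar x}],\qquad P^\wedge_2(C)_y=\int_{(x_1,\bar z_1)\cdots(x_n,\bar z_n)}\Big[P(x_1\cdots x_n;y)\otimes\bigotimes_iP(\bar z_i;x_i),\,C^{\otimes\bar z_1\cdots\bar z_n}\Big],$$ the second end being over the free symmetric monoidal category on the pairs $(x,\bar z)\in X\times S(X)$. The composition of $P$ gives $\Delta:P^\wedge\to P^\wedge_2$, the canonical maps $\bigotimes_i[A_i,B_i]\to[\bigotimes_iA_i,\bigotimes_iB_i]$ give $\alpha:P^\wedge P^\wedge\to P^\wedge_2$, and the units of $P$ give $\epsilon:P^\wedge\to\mathrm{id}$. Put $Q_0=P^\wedge$; let $Q_1$ be the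 pullback of $\Delta$ and $\alpha$, with projections $\chi_1:Q_1\to Q_0$ and $\delta_1:Q_1\to Q_0Q_0$; and for $k\ge1$ let $Q_{k+1}$ be the limit of $$Q_k\xrightarrow{\ \delta_k\ }Q_{k-1}Q_{k-1}\xleftarrow{\ \chi_k\chi_k\ }Q_kQ_k\rightrightarrows Q_{k-1}Q_{k-1}Q_{k-1},$$ the parallel maps being $\delta_k\chi_k$ and $\chi_k\delta_k$, with projections $\chi_{k+1}:Q_{k+1}\to Q_k$ and $\delta_{k+1}:Q_{k+1}\to Q_kQ_k$. Let $Q_\infty=P^\vee=\lim_kQ_k$ along the $\chi_k$, with projections $\pi_k:Q_\infty\to Q_k$. **Theorem.** Under the hypothesis on $\mathcal V$: 1. There is exactly one comonad structure $(\epsilon_\infty,\delta_\infty)$ on $Q_\infty$ with $\epsilon_\infty=\epsilon\circ\pi_0$ and $(\pi_k\pi_k)\circ\delta_\infty=\delta_{k+1}\circ\pi_{k+1}$ for all $k\ge0$. 2. $P$-coalgebras are the same as coalgebras over the comonad $Q_\infty$: sending a $Q_\infty$-coalgebra $(C,a)$ to $C$ with the maps $P(\bar x;y)\otimes C_y\to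 C^{\otimes\bar x}$ adjoint to $\pi_0\circ a:C\to P^\wedge(C)$ is an isomorphism of categories over $\mathcal V^X$ from $Q_\infty$-coalgebras to $P$-coalgebras. 3. For every $C\in\mathcal V^X$, $P^\vee(C)=Q_\infty(C)$, with the $P$-coalgebra structure adjoint to $\pi_0\circ\delta_\infty:Q_\infty(C)\to P^\wedge(Q_\infty(C))$, is the cofree $P$-coalgebra on $C$: for every $P$-coalgebra $D$ and every map $f:D\to C$ in $\mathcal V^X$ there is a unique map of $P$-coalgebras $g:D\to Q_\infty(C)$ with $\epsilon_\infty\circ g=f$. 4. The forgetful functor from $P$-coalgebras to $\mathcal V^X$ is comonadic. -/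

import Mathlib

open CategoryTheory MonoidalCategory Limits Opposite

universe v u v₁ u₁

namespace CofreeCoalg

/-! ### The free symmetric monoidal category -/

/-- Objects of the free symmetric monoidal category on `E`: formal (bracketed) tensor words. -/
inductive FreeSym (E : Type u₁) : Type u₁
  | of : E → FreeSym E
  | unit : FreeSym E
  | mul : FreeSym E → FreeSym E → FreeSym E

namespace FreeSym

/-- Formal composites and tensor products of morphisms of `E`, identities, associators, unitors
and symmetries. -/
inductive Word {E : Type u₁} [Category.{v₁} E] : FreeSym E → FreeSym E → Type (max u₁ v₁)
  | map {a b : E} (f : a ⟶ b) : Word (of a) (of b)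
  | id (a : FreeSym E) : Word a a
  | comp {a b c : FreeSym E} (f : Word a b) (g : Word b c) : Word a c
  | tens {a b c d : FreeSym E} (f : Word a b) (g : Word c d) : Word (a.mul c) (b.mul d)
  | assocHom (a b c : FreeSym E) : Word ((a.mul b).mul c) (a.mul (b.mul c))
  | assocInv (a b c : FreeSym E) : Word (a.mul (b.mul c)) ((a.mul b).mul c)
  | leftHom (a : FreeSym E) : Word (unit.mul a) a
  | leftInv (a : FreeSym E) : Word a (unit.mul a)
  | rightHom (a : FreeSym E) : Word (a.mul unit) a
  | rightInv (a : FreeSym E) : Word a (a.mul unit)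
  | braid (a b : FreeSym E) : Word (a.mul b) (b.mul a)

/-- The congruence generated by functoriality of `E → FreeSym E` and the axioms of a symmetric
monoidal category. -/
inductive Rel {E : Type u₁} [Category.{v₁} E] : ∀ {a b : FreeSym E}, Word a b → Word a b → Prop
  | refl {a b} (f : Word a b) : Rel f f
  | symm {a b} {f g : Word a b} : Rel f g → Rel g f
  | trans {a b} {f g h : Word a b} : Rel f g → Rel g h → Rel f h
  | comp_congr {a b c} {f f' : Word a b} {g g' : Word b c} :
      Rel f f' → Rel g g' → Rel (f.comp g) (f'.comp g')
  | tens_congr {a b c d} {f f' : Word a b} {g g' : Word c d} :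
      Rel f f' → Rel g g' → Rel (f.tens g) (f'.tens g')
  | map_id (a : E) : Rel (Word.map (𝟙 a)) (Word.id (of a))
  | map_comp {a b c : E} (f : a ⟶ b) (g : b ⟶ c) :
      Rel (Word.map (f ≫ g)) ((Word.map f).comp (Word.map g))
  | id_comp {a b} (f : Word a b) : Rel ((Word.id a).comp f) f
  | comp_id {a b} (f : Word a b) : Rel (f.comp (Word.id b)) f
  | assoc {a b c d} (f : Word a b) (g : Word b c) (h : Word c d) :
      Rel ((f.comp g).comp h) (f.comp (g.comp h))
  | tens_id (a b : FreeSym E) : Rel ((Word.id a).tens (Word.id b)) (Word.id (a.mul b))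
  | tens_comp {a b c a' b' c'} (f : Word a b) (g : Word b c) (f' : Word a' b') (g' : Word b' c') :
      Rel ((f.tens f').comp (g.tens g')) ((f.comp g).tens (f'.comp g'))
  | assoc_hom_inv (a b c : FreeSym E) :
      Rel ((Word.assocHom a b c).comp (Word.assocInv a b c)) (Word.id _)
  | assoc_inv_hom (a b c : FreeSym E) :
      Rel ((Word.assocInv a b c).comp (Word.assocHom a b c)) (Word.id _)
  | left_hom_inv (a : FreeSym E) : Rel ((Word.leftHom a).comp (Word.leftInv a)) (Word.id _)
  | left_inv_hom (a : FreeSym E) : Rel ((Word.leftInv a).comp (Word.leftHom a)) (Word.id _)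
  | right_hom_inv (a : FreeSym E) : Rel ((Word.rightHom a).comp (Word.rightInv a)) (Word.id _)
  | right_inv_hom (a : FreeSym E) : Rel ((Word.rightInv a).comp (Word.rightHom a)) (Word.id _)
  | assoc_nat {a b c a' b' c'} (f : Word a a') (g : Word b b') (h : Word c c') :
      Rel (((f.tens g).tens h).comp (Word.assocHom a' b' c'))
        ((Word.assocHom a b c).comp (f.tens (g.tens h)))
  | left_nat {a b} (f : Word a b) :
      Rel (((Word.id unit).tens f).comp (Word.leftHom b)) ((Word.leftHom a).comp f)
  | right_nat {a b} (f : Word a b) :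
      Rel ((f.tens (Word.id unit)).comp (Word.rightHom b)) ((Word.rightHom a).comp f)
  | braid_nat {a b c d} (f : Word a b) (g : Word c d) :
      Rel ((f.tens g).comp (Word.braid b d)) ((Word.braid a c).comp (g.tens f))
  | pentagon (a b c d : FreeSym E) :
      Rel (((Word.assocHom a b c).tens (Word.id d)).comp
          ((Word.assocHom a (b.mul c) d).comp ((Word.id a).tens (Word.assocHom b c d))))
        ((Word.assocHom (a.mul b) c d).comp (Word.assocHom a b (c.mul d)))
  | triangle (a b : FreeSym E) :
      Rel ((Word.assocHom a unit b).comp ((Word.id a).tens (Word.leftHom b)))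
        ((Word.rightHom a).tens (Word.id b))
  | hexagon_forward (a b c : FreeSym E) :
      Rel ((Word.assocHom a b c).comp ((Word.braid a (b.mul c)).comp (Word.assocHom b c a)))
        (((Word.braid a b).tens (Word.id c)).comp
          ((Word.assocHom b a c).comp ((Word.id b).tens (Word.braid a c))))
  | hexagon_reverse (a b c : FreeSym E) :
      Rel ((Word.assocInv a b c).comp ((Word.braid (a.mul b) c).comp (Word.assocInv c a b)))
        (((Word.id a).tens (Word.braid b c)).comp
          ((Word.assocInv a c b).comp ((Word.braid a c).tens (Word.id b))))
  | braid_braid (a b : FreeSym E) : Rel ((Word.braid a b).comp (Word.braid b a)) (Word.id _)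

section Cat

variable {E : Type u₁} [Category.{v₁} E]

instance homSetoid (a b : FreeSym E) : Setoid (Word a b) :=
  ⟨Rel, ⟨Rel.refl, Rel.symm, Rel.trans⟩⟩

instance : Category.{max u₁ v₁} (FreeSym E) where
  Hom a b := Quotient (homSetoid a b)
  id a := ⟦Word.id a⟧
  comp := Quotient.map₂ Word.comp (fun _ _ hf _ _ hg => Rel.comp_congr hf hg)
  id_comp := by
    rintro a b ⟨f⟩
    exact Quotient.sound (Rel.id_comp f)
  comp_id := by
    rintro a b ⟨f⟩
    exact Quotient.sound (Rel.comp_id f)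
  assoc := by
    rintro a b c d ⟨f⟩ ⟨g⟩ ⟨h⟩
    exact Quotient.sound (Rel.assoc f g h)

instance : MonoidalCategoryStruct (FreeSym E) where
  tensorObj a b := mul a b
  tensorHom := Quotient.map₂ Word.tens (fun _ _ hf _ _ hg => Rel.tens_congr hf hg)
  whiskerLeft a _ _ f := Quotient.map₂ Word.tens
    (fun _ _ hf _ _ hg => Rel.tens_congr hf hg) ⟦Word.id a⟧ f
  whiskerRight f a := Quotient.map₂ Word.tens
    (fun _ _ hf _ _ hg => Rel.tens_congr hf hg) f ⟦Word.id a⟧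
  tensorUnit := unit
  associator a b c := ⟨⟦Word.assocHom a b c⟧, ⟦Word.assocInv a b c⟧,
    Quotient.sound (Rel.assoc_hom_inv a b c), Quotient.sound (Rel.assoc_inv_hom a b c)⟩
  leftUnitor a := ⟨⟦Word.leftHom a⟧, ⟦Word.leftInv a⟧,
    Quotient.sound (Rel.left_hom_inv a), Quotient.sound (Rel.left_inv_hom a)⟩
  rightUnitor a := ⟨⟦Word.rightHom a⟧, ⟦Word.rightInv a⟧,
    Quotient.sound (Rel.right_hom_inv a), Quotient.sound (Rel.right_inv_hom a)⟩

instance : MonoidalCategory (FreeSym E) :=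
  MonoidalCategory.ofTensorHom
    (id_tensorHom_id := fun a b => Quotient.sound (Rel.tens_id a b))
    (id_tensorHom := fun _ _ _ _ => rfl)
    (tensorHom_id := fun _ _ => rfl)
    (tensorHom_comp_tensorHom := by
      rintro _ _ _ _ _ _ ⟨f⟩ ⟨f'⟩ ⟨g⟩ ⟨g'⟩
      exact Quotient.sound (Rel.tens_comp f g f' g'))
    (associator_naturality := by
      rintro _ _ _ _ _ _ ⟨f⟩ ⟨g⟩ ⟨h⟩
      exact Quotient.sound (Rel.assoc_nat f g h))
    (leftUnitor_naturality := by
      rintro _ _ ⟨f⟩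
      exact Quotient.sound (Rel.left_nat f))
    (rightUnitor_naturality := by
      rintro _ _ ⟨f⟩
      exact Quotient.sound (Rel.right_nat f))
    (pentagon := fun a b c d => Quotient.sound (Rel.pentagon a b c d))
    (triangle := fun a b => Quotient.sound (Rel.triangle a b))

instance : SymmetricCategory (FreeSym E) where
  braiding a b := ⟨⟦Word.braid a b⟧, ⟦Word.braid b a⟧,
    Quotient.sound (Rel.braid_braid a b), Quotient.sound (Rel.braid_braid b a)⟩
  braiding_naturality_right := by
    rintro a b c ⟨f⟩
    exact Quotient.sound (Rel.braid_nat (Word.id a) f)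
  braiding_naturality_left := by
    rintro a b ⟨f⟩ c
    exact Quotient.sound (Rel.braid_nat f (Word.id c))
  hexagon_forward a b c := Quotient.sound (Rel.hexagon_forward a b c)
  hexagon_reverse a b c := Quotient.sound (Rel.hexagon_reverse a b c)
  symmetry a b := Quotient.sound (Rel.braid_braid a b)

/-- The insertion of generators. -/
def inc : E ⥤ FreeSym E where
  obj a := of a
  map f := ⟦Word.map f⟧
  map_id a := Quotient.sound (Rel.map_id a)
  map_comp f g := Quotient.sound (Rel.map_comp f g)

/-- Induction on the morphisms of the free symmetric monoidal category. -/
theorem hom_induction {M : ∀ {a b : FreeSym E}, (a ⟶ b) → Prop}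
    (map : ∀ {a b : E} (f : a ⟶ b), M (inc.map f))
    (id : ∀ a : FreeSym E, M (𝟙 a))
    (comp : ∀ {a b c : FreeSym E} (f : a ⟶ b) (g : b ⟶ c), M f → M g → M (f ≫ g))
    (tens : ∀ {a b c d : FreeSym E} (f : a ⟶ b) (g : c ⟶ d), M f → M g → M (f ⊗ₘ g))
    (assocHom : ∀ a b c : FreeSym E, M (α_ a b c).hom)
    (assocInv : ∀ a b c : FreeSym E, M (α_ a b c).inv)
    (leftHom : ∀ a : FreeSym E, M (λ_ a).hom)
    (leftInv : ∀ a : FreeSym E, M (λ_ a).inv)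
    (rightHom : ∀ a : FreeSym E, M (ρ_ a).hom)
    (rightInv : ∀ a : FreeSym E, M (ρ_ a).inv)
    (braid : ∀ a b : FreeSym E, M (β_ a b).hom)
    {a b : FreeSym E} (f : a ⟶ b) : M f := by
  induction f using Quotient.inductionOn with | _ w
  induction w with
  | map f => exact map f
  | id a => exact id a
  | comp f g hf hg => exact comp _ _ hf hg
  | tens f g hf hg => exact tens _ _ hf hg
  | assocHom a b c => exact assocHom a b c
  | assocInv a b c => exact assocInv a b c
  | leftHom a => exact leftHom a
  | leftInv a => exact leftInv a
  | rightHom a => exact rightHom a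
  | rightInv a => exact rightInv a
  | braid a b => exact braid a b

end Cat

section Lift

variable {W : Type u} [Category.{v} W] [MonoidalCategory W]

/-- The tensor product of a word of objects of `W`. -/
def liftObj {E : Type u₁} (f : E → W) : FreeSym E → W
  | of a => f a
  | unit => 𝟙_ W
  | mul a b => liftObj f a ⊗ liftObj f b

variable {E : Type u₁} [Category.{v₁} E]

/-- Interpretation of words of morphisms. -/
def liftWord [SymmetricCategory W] (F : E ⥤ W) :
    ∀ {a b : FreeSym E}, Word a b → (liftObj F.obj a ⟶ liftObj F.obj b)
  | _, _, Word.map f => F.map f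
  | _, _, Word.id _ => 𝟙 _
  | _, _, Word.comp f g => liftWord F f ≫ liftWord F g
  | _, _, Word.tens f g => liftWord F f ⊗ₘ liftWord F g
  | _, _, Word.assocHom _ _ _ => (α_ _ _ _).hom
  | _, _, Word.assocInv _ _ _ => (α_ _ _ _).inv
  | _, _, Word.leftHom _ => (λ_ _).hom
  | _, _, Word.leftInv _ => (λ_ _).inv
  | _, _, Word.rightHom _ => (ρ_ _).hom
  | _, _, Word.rightInv _ => (ρ_ _).inv
  | _, _, Word.braid _ _ => (β_ _ _).hom

theorem liftWord_rel [SymmetricCategory W] (F : E ⥤ W) {a b : FreeSym E} {f g : Word a b}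
    (h : Rel f g) : liftWord F f = liftWord F g := by
  induction h with
  | refl => rfl
  | symm _ h => exact h.symm
  | trans _ _ h h' => exact h.trans h'
  | comp_congr _ _ h h' => simp only [liftWord, h, h']
  | tens_congr _ _ h h' => exact congrArg₂ (fun p q => p ⊗ₘ q) h h'
  | map_id => exact F.map_id _
  | map_comp => exact F.map_comp _ _
  | id_comp => exact Category.id_comp _
  | comp_id => exact Category.comp_id _
  | assoc => exact Category.assoc _ _ _
  | tens_id => exact id_tensorHom_id _ _
  | tens_comp => exact tensorHom_comp_tensorHom _ _ _ _
  | assoc_hom_inv => exact Iso.hom_inv_id _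
  | assoc_inv_hom => exact Iso.inv_hom_id _
  | left_hom_inv => exact Iso.hom_inv_id _
  | left_inv_hom => exact Iso.inv_hom_id _
  | right_hom_inv => exact Iso.hom_inv_id _
  | right_inv_hom => exact Iso.inv_hom_id _
  | assoc_nat => exact associator_naturality _ _ _
  | left_nat => exact (by simp [liftWord, liftObj])
  | right_nat => exact (by simp [liftWord, liftObj])
  | braid_nat => exact BraidedCategory.braiding_naturality _ _
  | pentagon => exact (by simp [liftWord, liftObj])
  | triangle => exact (by simp [liftWord, liftObj])
  | hexagon_forward => exact (by simp [liftWord, liftObj])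
  | hexagon_reverse => exact (by simp [liftWord, liftObj])
  | braid_braid => exact SymmetricCategory.symmetry _ _

variable [SymmetricCategory W]

/-- The (strict) symmetric monoidal functor `FreeSym E ⥤ W` extending a functor `F : E ⥤ W`. -/
def lift (F : E ⥤ W) : FreeSym E ⥤ W where
  obj := liftObj F.obj
  map {_ _} f := Quotient.lift (liftWord F) (fun _ _ h => liftWord_rel F h) f
  map_id _ := rfl
  map_comp := by
    rintro _ _ _ ⟨f⟩ ⟨g⟩
    rfl

@[simp] theorem lift_of (F : E ⥤ W) (a : E) : (lift F).obj (of a) = F.obj a := rfl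
@[simp] theorem lift_map_inc (F : E ⥤ W) {a b : E} (f : a ⟶ b) :
    (lift F).map (inc.map f) = F.map f := rfl
theorem lift_map_tensor (F : E ⥤ W) {a b c d : FreeSym E} (f : a ⟶ b) (g : c ⟶ d) :
    (lift F).map (f ⊗ₘ g) = ((lift F).map f ⊗ₘ (lift F).map g) := by
  obtain ⟨f⟩ := f
  obtain ⟨g⟩ := g
  rfl
theorem lift_map_assocHom (F : E ⥤ W) (a b c : FreeSym E) : (lift F).map (α_ a b c).hom =
    (α_ ((lift F).obj a) ((lift F).obj b) ((lift F).obj c)).hom := rfl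
theorem lift_map_assocInv (F : E ⥤ W) (a b c : FreeSym E) : (lift F).map (α_ a b c).inv =
    (α_ ((lift F).obj a) ((lift F).obj b) ((lift F).obj c)).inv := rfl
theorem lift_map_leftHom (F : E ⥤ W) (a : FreeSym E) : (lift F).map (λ_ a).hom =
    (λ_ ((lift F).obj a)).hom := rfl
theorem lift_map_leftInv (F : E ⥤ W) (a : FreeSym E) : (lift F).map (λ_ a).inv =
    (λ_ ((lift F).obj a)).inv := rfl
theorem lift_map_rightHom (F : E ⥤ W) (a : FreeSym E) : (lift F).map (ρ_ a).hom =
    (ρ_ ((lift F).obj a)).hom := rfl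
theorem lift_map_rightInv (F : E ⥤ W) (a : FreeSym E) : (lift F).map (ρ_ a).inv =
    (ρ_ ((lift F).obj a)).inv := rfl
theorem lift_map_braid (F : E ⥤ W) (a b : FreeSym E) : (lift F).map (β_ a b).hom =
    (β_ ((lift F).obj a) ((lift F).obj b)).hom := rfl

/-- The components of the natural transformation `lift F ⟶ lift G` induced by `F ⟶ G`. -/
def liftApp {F G : E ⥤ W} (η : F ⟶ G) : ∀ a : FreeSym E, (lift F).obj a ⟶ (lift G).obj a
  | of a => η.app a
  | unit => 𝟙 (𝟙_ W)
  | mul a b => liftApp η a ⊗ₘ liftApp η b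

theorem liftApp_tensor {F G : E ⥤ W} (η : F ⟶ G) (a b : FreeSym E) :
    liftApp η (a ⊗ b) = (liftApp η a ⊗ₘ liftApp η b) := rfl

/-- `lift` is functorial. -/
def liftMap {F G : E ⥤ W} (η : F ⟶ G) : lift F ⟶ lift G where
  app := liftApp η
  naturality a b f := by
    induction f using hom_induction with
    | map f => exact η.naturality f
    | id a => simp
    | comp f g hf hg => simp [hg, reassoc_of% hf]
    | tens f g hf hg =>
      rw [lift_map_tensor, lift_map_tensor, liftApp_tensor, liftApp_tensor]
      erw [tensorHom_comp_tensorHom, tensorHom_comp_tensorHom]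
      rw [hf, hg]
    | assocHom a b c => exact (associator_naturality _ _ _).symm
    | assocInv a b c => exact (associator_inv_naturality _ _ _).symm
    | leftHom a =>
      have := leftUnitor_naturality (liftApp η a)
      rw [← id_tensorHom] at this
      exact this.symm
    | leftInv a =>
      have := leftUnitor_inv_naturality (liftApp η a)
      rw [← id_tensorHom] at this
      exact this.symm
    | rightHom a =>
      have := rightUnitor_naturality (liftApp η a)
      rw [← tensorHom_id] at this
      exact this.symm
    | rightInv a =>
      have := rightUnitor_inv_naturality (liftApp η a)
      rw [← tensorHom_id] at this
      exact this.symm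
    | braid a b => exact (BraidedCategory.braiding_naturality _ _).symm

end Lift

end FreeSym
section Definitions

theorem inv_aux {V : Type u} [Category.{v} V] [MonoidalCategory V] {A A' B B' C C' : V} (a : A ≅ A') (b : B ≅ B') (c : C ≅ C') (f : A ⊗ B ⟶ C)
    (g : A' ⊗ B' ⟶ C') (h : (a.hom ⊗ₘ b.hom) ≫ g = f ≫ c.hom) :
    (a.inv ⊗ₘ b.inv) ≫ f = g ≫ c.inv := by
  rw [← cancel_mono c.hom, Category.assoc, ← h, Category.assoc, c.inv_hom_id, Category.comp_id,
    ← Category.assoc, tensorHom_comp_tensorHom]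
  simp

/-! ### Enriched natural transformations as ends -/

section HomEnd

variable {V : Type u} [Category.{v} V] [MonoidalCategory V] [MonoidalClosed V] [HasLimits V]
  {J : Type v} [Category.{v} J]

/-- The functor `K ↦ ∫_j [N j, K j]`. -/
noncomputable def homEnd (N : J ⥤ V) : (J ⥤ V) ⥤ V where
  obj K := end_ (N.op ⋙ MonoidalClosed.internalHom ⋙ (Functor.whiskeringLeft J V V).obj K)
  map η := end_.map (Functor.whiskerLeft N.op (Functor.whiskerLeft MonoidalClosed.internalHom
    ((Functor.whiskeringLeft J V V).map η)))
  map_id K := by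
    apply end_.hom_ext
    intro j
    simp
  map_comp f g := by
    apply end_.hom_ext
    intro j
    simp

/-- Evaluation `N j ⊗ ∫_i [N i, K i] ⟶ K j`. -/
noncomputable def homEndEv (N K : J ⥤ V) (j : J) : N.obj j ⊗ (homEnd N).obj K ⟶ K.obj j :=
  MonoidalClosed.uncurry (A := N.obj j) (X := K.obj j) (end_.π
    (N.op ⋙ MonoidalClosed.internalHom ⋙ (Functor.whiskeringLeft J V V).obj K) j)

theorem homEndEv_naturality (N K : J ⥤ V) {i j : J} (f : i ⟶ j) :
    N.map f ▷ (homEnd N).obj K ≫ homEndEv N K j = homEndEv N K i ≫ K.map f := by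
  have h := end_.condition
    (N.op ⋙ MonoidalClosed.internalHom ⋙ (Functor.whiskeringLeft J V V).obj K) f
  have h' := congrArg (MonoidalClosed.uncurry (A := N.obj i) (X := K.obj j)) h
  refine Eq.trans ?_ (h'.symm.trans ?_)
  · exact (MonoidalClosed.uncurry_pre_app _ _ _).symm
  · exact MonoidalClosed.uncurry_natural_right _ _

theorem homEndEv_map (N : J ⥤ V) {K L : J ⥤ V} (η : K ⟶ L) (j : J) :
    N.obj j ◁ (homEnd N).map η ≫ homEndEv N L j = homEndEv N K j ≫ η.app j := by
  refine (MonoidalClosed.uncurry_natural_left _ _).symm.trans ?_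
  refine Eq.trans ?_ (MonoidalClosed.uncurry_natural_right _ _)
  exact congrArg MonoidalClosed.uncurry (end_.map_π _ _)

theorem homEnd_ext (N K : J ⥤ V) {A : V} {f g : A ⟶ (homEnd N).obj K}
    (h : ∀ j, N.obj j ◁ f ≫ homEndEv N K j = N.obj j ◁ g ≫ homEndEv N K j) : f = g := by
  apply end_.hom_ext
  intro j
  apply MonoidalClosed.uncurry_injective
  exact (MonoidalClosed.uncurry_natural_left _ _).trans
    ((h j).trans (MonoidalClosed.uncurry_natural_left _ _).symm)

/-- Maps into `∫_j [N j, K j]` from a natural family of maps `N j ⊗ A ⟶ K j`. -/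
noncomputable def homEndLift (N K : J ⥤ V) {A : V} (θ : ∀ j, N.obj j ⊗ A ⟶ K.obj j)
    (hθ : ∀ {i j : J} (f : i ⟶ j), N.map f ▷ A ≫ θ j = θ i ≫ K.map f) :
    A ⟶ (homEnd N).obj K :=
  end_.lift (fun j => MonoidalClosed.curry (θ j)) (fun i j f => by
    apply MonoidalClosed.uncurry_injective
    refine (MonoidalClosed.uncurry_natural_right _ _).trans ?_
    refine Eq.trans ?_ (MonoidalClosed.uncurry_pre_app _ _ _).symm
    rw [MonoidalClosed.uncurry_curry, MonoidalClosed.uncurry_curry]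
    exact (hθ f).symm)

theorem homEndLift_ev (N K : J ⥤ V) {A : V} (θ : ∀ j, N.obj j ⊗ A ⟶ K.obj j)
    (hθ : ∀ {i j : J} (f : i ⟶ j), N.map f ▷ A ≫ θ j = θ i ≫ K.map f) (j : J) :
    N.obj j ◁ homEndLift N K θ hθ ≫ homEndEv N K j = θ j := by
  refine (MonoidalClosed.uncurry_natural_left _ _).symm.trans ?_
  exact (congrArg MonoidalClosed.uncurry (end_.lift_π _ _ j)).trans
    (MonoidalClosed.uncurry_curry _)

end HomEnd

/-! ### Coloured operads -/

section Operads

variable (X : Type v)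

/-- The free symmetric monoidal category `S(X)` on the set `X`. -/
abbrev SymSeq : Type v := FreeSym (Discrete X)

/-- Pairs `(y, x̄)` of an output colour and a word of input colours. -/
abbrev Vert : Type v := Discrete X × SymSeq X

/-- The output colour of a vertex. -/
def out : Vert X ⥤ SymSeq X := CategoryTheory.Prod.fst _ _ ⋙ FreeSym.inc

/-- For a word `e = (x₁, z̄₁) ⋯ (xₙ, z̄ₙ)` of vertices, `tgt e` is the word `x₁ ⋯ xₙ`. -/
def tgt : FreeSym (Vert X) ⥤ SymSeq X := FreeSym.lift (out X)

/-- For a word `e = (x₁, z̄₁) ⋯ (xₙ, z̄ₙ)` of vertices, `src e` is the word `z̄₁ ⋯ z̄ₙ`. -/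
def src : FreeSym (Vert X) ⥤ SymSeq X := FreeSym.lift (CategoryTheory.Prod.snd _ _)

variable (V : Type u) [Category.{v} V] [MonoidalCategory V]

/-- `S`-distributors with colours `X`; the value at `(y, x̄)` is `P(x̄; y)`. The groupoid `S(X)` is
identified with its opposite, so that permutations act covariantly. -/
abbrev Distributor := Vert X ⥤ V

variable {X V}

/-- The functor `P(-; y)` on `S(X)`. -/
@[simps]
def Distributor.at (P : Distributor X V) (y : Discrete X) : SymSeq X ⥤ V where
  obj z := P.obj (y, z)
  map f := P.map (Prod.mkHom (𝟙 y) f)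
  map_id z := P.map_id (y, z)
  map_comp f g := by
    rw [← P.map_comp]
    congr 1

variable [SymmetricCategory V]

/-- The functor sending a word `e = (x₁, z̄₁) ⋯ (xₙ, z̄ₙ)` to `P(z̄₁; x₁) ⊗ ⋯ ⊗ P(z̄ₙ; xₙ)`. -/
abbrev Distributor.tens (P : Distributor X V) : FreeSym (Vert X) ⥤ V := FreeSym.lift P

/-- The functor sending a word `e = (x₁, z̄₁) ⋯ (xₙ, z̄ₙ)` to
`P(x₁ ⋯ xₙ; y) ⊗ (P(z̄₁; x₁) ⊗ ⋯ ⊗ P(z̄ₙ; xₙ))`. -/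
def Distributor.two (P : Distributor X V) (y : Discrete X) : FreeSym (Vert X) ⥤ V where
  obj e := (P.at y).obj ((tgt X).obj e) ⊗ P.tens.obj e
  map f := (P.at y).map ((tgt X).map f) ⊗ₘ P.tens.map f
  map_id e := by
    rw [(tgt X).map_id, (P.at y).map_id, P.tens.map_id, id_tensorHom_id]
  map_comp f g := by
    rw [(tgt X).map_comp, (P.at y).map_comp, P.tens.map_comp, tensorHom_comp_tensorHom]

/-! Words of two-level trees: `(y, e)` has root `(y, tgt e)` and upper vertices `e`. -/

/-- The word of roots of a word of two-level trees. -/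
def lower (d : FreeSym (Discrete X × FreeSym (Vert X))) : FreeSym (Vert X) :=
  FreeSym.liftObj (fun p => FreeSym.of (p.1, (tgt X).obj p.2)) d

/-- The word of all upper vertices of a word of two-level trees. -/
def upper (d : FreeSym (Discrete X × FreeSym (Vert X))) : FreeSym (Vert X) :=
  FreeSym.liftObj (fun p => p.2) d

/-- The word of vertices obtained by contracting each two-level tree. -/
def contract (d : FreeSym (Discrete X × FreeSym (Vert X))) : FreeSym (Vert X) :=
  FreeSym.liftObj (fun p => FreeSym.of (p.1, (src X).obj p.2)) d

open FreeSym in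
/-- The canonical identification of the output words of `lower d` and `contract d`. -/
def tgtLower : ∀ d : FreeSym (Discrete X × FreeSym (Vert X)),
    (tgt X).obj (contract d) ≅ (tgt X).obj (lower d)
  | of _ => Iso.refl _
  | unit => Iso.refl (𝟙_ (SymSeq X))
  | mul a b => MonoidalCategory.tensorIso (tgtLower a) (tgtLower b)

open FreeSym in
/-- The inputs of the roots are the outputs of the upper vertices. -/
def srcLower : ∀ d : FreeSym (Discrete X × FreeSym (Vert X)),
    (src X).obj (lower d) ≅ (tgt X).obj (upper d)
  | of _ => Iso.refl _
  | unit => Iso.refl (𝟙_ (SymSeq X))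
  | mul a b => MonoidalCategory.tensorIso (srcLower a) (srcLower b)

open FreeSym in
/-- The canonical identification of the input words of `upper d` and `contract d`. -/
def srcUpper : ∀ d : FreeSym (Discrete X × FreeSym (Vert X)),
    (src X).obj (upper d) ≅ (src X).obj (contract d)
  | of _ => Iso.refl _
  | unit => Iso.refl (𝟙_ (SymSeq X))
  | mul a b => MonoidalCategory.tensorIso (srcUpper a) (srcUpper b)

/-- For a word `d = (y₁, e₁) ⋯ (yₙ, eₙ)` of two-level trees, the tensor product over `i` of
`P(tgt eᵢ; yᵢ) ⊗ P.tens eᵢ`. -/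
def Distributor.twoTens (P : Distributor X V) (d : FreeSym (Discrete X × FreeSym (Vert X))) : V :=
  FreeSym.liftObj (fun p => (P.two p.1).obj p.2) d

open FreeSym in
/-- Regrouping the tensor factors of `twoTens` by level. -/
def Distributor.regroup (P : Distributor X V) : ∀ d : FreeSym (Discrete X × FreeSym (Vert X)),
    P.twoTens d ⟶ P.tens.obj (lower d) ⊗ P.tens.obj (upper d)
  | of p => 𝟙 ((P.two p.1).obj p.2)
  | unit => (λ_ (𝟙_ V)).inv
  | mul a b => (regroup P a ⊗ₘ regroup P b) ≫
      tensorμ (P.tens.obj (lower a)) (P.tens.obj (upper a))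
        (P.tens.obj (lower b)) (P.tens.obj (upper b))

open FreeSym in
/-- Composing in each two-level tree, for a given family of composition maps. -/
def Distributor.contractMap (P : Distributor X V)
    (γ : ∀ y : Discrete X, P.two y ⟶ src X ⋙ P.at y) :
    ∀ d : FreeSym (Discrete X × FreeSym (Vert X)), P.twoTens d ⟶ P.tens.obj (contract d)
  | of p => (γ p.1).app p.2
  | unit => 𝟙 (𝟙_ V)
  | mul a b => contractMap P γ a ⊗ₘ contractMap P γ b

/-- The word of vertices `(x₁, x₁) ⋯ (xₙ, xₙ)` attached to a word `x₁ ⋯ xₙ`. -/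
def units (z : SymSeq X) : FreeSym (Vert X) :=
  FreeSym.liftObj (fun x => FreeSym.of (x, FreeSym.of x)) z

open FreeSym in
/-- The canonical identification of the word of outputs of `units z` with `z`. -/
def tgtUnits : ∀ z : SymSeq X, (tgt X).obj (units z) ≅ z
  | of _ => Iso.refl _
  | unit => Iso.refl (𝟙_ (SymSeq X))
  | mul a b => MonoidalCategory.tensorIso (tgtUnits a) (tgtUnits b)

open FreeSym in
/-- The canonical identification of the word of inputs of `units z` with `z`. -/
def srcUnits : ∀ z : SymSeq X, (src X).obj (units z) ≅ z
  | of _ => Iso.refl _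
  | unit => Iso.refl (𝟙_ (SymSeq X))
  | mul a b => MonoidalCategory.tensorIso (srcUnits a) (srcUnits b)

open FreeSym in
/-- The tensor product of the units `𝟙 ⟶ P(x; x)` over the letters of a word. -/
def Distributor.unitsMap (P : Distributor X V)
    (η : ∀ x : Discrete X, 𝟙_ V ⟶ P.obj (x, FreeSym.of x)) :
    ∀ z : SymSeq X, 𝟙_ V ⟶ P.tens.obj (units z)
  | of x => η x
  | unit => 𝟙 (𝟙_ V)
  | mul a b => (λ_ (𝟙_ V)).inv ≫ (unitsMap P η a ⊗ₘ unitsMap P η b)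

variable (X V) in
/-- `X`-coloured symmetric operads in `V`. Naturality of `comp` is equivariance. -/
structure Operad where
  /-- the underlying `S`-distributor -/
  P : Distributor X V
  /-- the units `𝟙 ⟶ P(x; x)` -/
  one : ∀ x : Discrete X, 𝟙_ V ⟶ P.obj (x, FreeSym.of x)
  /-- the compositions `P(x₁ ⋯ xₙ; y) ⊗ (P(z̄₁; x₁) ⊗ ⋯ ⊗ P(z̄ₙ; xₙ)) ⟶ P(z̄₁ ⋯ z̄ₙ; y)` -/
  comp : ∀ y : Discrete X, P.two y ⟶ src X ⋙ P.at y
  one_comp : ∀ (y : Discrete X) (z : SymSeq X),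
    one y ▷ P.obj (y, z) ≫ (comp y).app (FreeSym.of (y, z)) = (λ_ (P.obj (y, z))).hom
  comp_one : ∀ (y : Discrete X) (z : SymSeq X),
    ((P.at y).map (tgtUnits z).inv ⊗ₘ P.unitsMap one z) ≫ (comp y).app (units z) ≫
      (P.at y).map (srcUnits z).hom = (ρ_ ((P.at y).obj z)).hom
  assoc : ∀ (y : Discrete X) (d : FreeSym (Discrete X × FreeSym (Vert X))),
    (P.at y).obj ((tgt X).obj (contract d)) ◁ P.contractMap comp d ≫ (comp y).app (contract d) =
      ((P.at y).map (tgtLower d).hom ⊗ₘ P.regroup d) ≫ (α_ _ _ _).inv ≫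
        ((comp y).app (lower d) ≫ (P.at y).map (srcLower d).hom) ▷ P.tens.obj (upper d) ≫
          (comp y).app (upper d) ≫ (P.at y).map (srcUpper d).hom

end Operads

/-! ### Coalgebras over an operad -/

section Coalgebras

variable {X : Type v} {V : Type u} [Category.{v} V] [MonoidalCategory V] [SymmetricCategory V]

variable (X V) in
/-- The functor `ε` sending `C` to the functor `x₁ ⋯ xₙ ↦ C x₁ ⊗ ⋯ ⊗ C xₙ` on `S(X)`. -/
def power : (X → V) ⥤ (SymSeq X ⥤ V) where
  obj C := FreeSym.lift (Discrete.functor C)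
  map f := FreeSym.liftMap (Discrete.natTrans fun x => f x.as)
  map_id C := by
    ext z
    change FreeSym.liftApp _ z = _
    induction z with
    | of x => rfl
    | unit => rfl
    | mul a b ha hb =>
      exact (congrArg₂ (fun p q => p ⊗ₘ q) ha hb).trans (id_tensorHom_id _ _)
  map_comp f g := by
    ext z
    change FreeSym.liftApp _ z = FreeSym.liftApp _ z ≫ FreeSym.liftApp _ z
    induction z with
    | of x => rfl
    | unit => exact (Category.id_comp _).symm
    | mul a b ha hb =>
      exact (congrArg₂ (fun p q => p ⊗ₘ q) ha hb).trans (tensorHom_comp_tensorHom _ _ _ _).symm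

open FreeSym in
/-- Given maps `θ : P(z̄; x) ⊗ B x ⟶ C^{⊗ z̄}`, the induced maps
`(P(z̄₁; x₁) ⊗ ⋯ ⊗ P(z̄ₙ; xₙ)) ⊗ (B x₁ ⊗ ⋯ ⊗ B xₙ) ⟶ C^{⊗ z̄₁ ⋯ z̄ₙ}`. -/
def tensAct (P : Distributor X V) {B C : X → V}
    (θ : ∀ p : Vert X, P.obj p ⊗ B p.1.as ⟶ ((power X V).obj C).obj p.2) :
    ∀ e : FreeSym (Vert X), P.tens.obj e ⊗ ((power X V).obj B).obj ((tgt X).obj e) ⟶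
      ((power X V).obj C).obj ((src X).obj e)
  | of p => θ p
  | unit => (λ_ (𝟙_ V)).hom
  | mul a b => tensorμ (P.tens.obj a) (P.tens.obj b) (((power X V).obj B).obj ((tgt X).obj a))
      (((power X V).obj B).obj ((tgt X).obj b)) ≫ (tensAct P θ a ⊗ₘ tensAct P θ b)

theorem tensorμ_braid (A B A' B' : V) :
    ((β_ A B).hom ⊗ₘ (β_ A' B').hom) ≫ tensorμ B A B' A' =
      tensorμ A B A' B' ≫ (β_ (A ⊗ A') (B ⊗ B')).hom := by
  simp [tensorμ, MonoidalCategory.tensorHom_def,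
    SymmetricCategory.braiding_swap_eq_inv_braiding B A']

theorem tensorμ_assoc_aux {A₁ A₂ A₃ B₁ B₂ B₃ C₁ C₂ C₃ : V} (f₁ : A₁ ⊗ B₁ ⟶ C₁)
    (f₂ : A₂ ⊗ B₂ ⟶ C₂) (f₃ : A₃ ⊗ B₃ ⟶ C₃) :
    ((α_ A₁ A₂ A₃).hom ⊗ₘ (α_ B₁ B₂ B₃).hom) ≫ tensorμ A₁ (A₂ ⊗ A₃) B₁ (B₂ ⊗ B₃) ≫
        (f₁ ⊗ₘ (tensorμ A₂ A₃ B₂ B₃ ≫ (f₂ ⊗ₘ f₃))) =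
      (tensorμ (A₁ ⊗ A₂) A₃ (B₁ ⊗ B₂) B₃ ≫ ((tensorμ A₁ A₂ B₁ B₂ ≫ (f₁ ⊗ₘ f₂)) ⊗ₘ f₃)) ≫
        (α_ C₁ C₂ C₃).hom := by
  have h := associator_monoidal A₁ A₂ A₃ B₁ B₂ B₃
  have e1 : (f₁ ⊗ₘ (tensorμ A₂ A₃ B₂ B₃ ≫ (f₂ ⊗ₘ f₃))) =
      (A₁ ⊗ B₁) ◁ tensorμ A₂ A₃ B₂ B₃ ≫ (f₁ ⊗ₘ (f₂ ⊗ₘ f₃)) := by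
    simp [← id_tensorHom, tensorHom_comp_tensorHom]
  have e2 : ((tensorμ A₁ A₂ B₁ B₂ ≫ (f₁ ⊗ₘ f₂)) ⊗ₘ f₃) =
      tensorμ A₁ A₂ B₁ B₂ ▷ (A₃ ⊗ B₃) ≫ ((f₁ ⊗ₘ f₂) ⊗ₘ f₃) := by
    rw [← tensorHom_id, tensorHom_comp_tensorHom, Category.id_comp]
  rw [e1, e2, Category.assoc, Category.assoc, associator_naturality, reassoc_of% h]

theorem tensorμ_left_aux {A B C : V} (f : A ⊗ B ⟶ C) :
    ((λ_ A).hom ⊗ₘ (λ_ B).hom) ≫ f =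
      (tensorμ (𝟙_ V) A (𝟙_ V) B ≫ ((λ_ (𝟙_ V)).hom ⊗ₘ f)) ≫ (λ_ C).hom := by
  have h := leftUnitor_monoidal A B
  rw [h, Category.assoc, Category.assoc, Category.assoc,
    MonoidalCategory.tensorHom_def, Category.assoc, leftUnitor_naturality]

theorem tensorμ_right_aux {A B C : V} (f : A ⊗ B ⟶ C) :
    ((ρ_ A).hom ⊗ₘ (ρ_ B).hom) ≫ f =
      (tensorμ A (𝟙_ V) B (𝟙_ V) ≫ (f ⊗ₘ (λ_ (𝟙_ V)).hom)) ≫ (ρ_ C).hom := by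
  have h := rightUnitor_monoidal A B
  rw [h, Category.assoc, Category.assoc, Category.assoc,
    MonoidalCategory.tensorHom_def', Category.assoc, rightUnitor_naturality]

theorem tensorμ_braid_aux {A B A' B' C C' : V} (f : A ⊗ A' ⟶ C) (g : B ⊗ B' ⟶ C') :
    ((β_ A B).hom ⊗ₘ (β_ A' B').hom) ≫ tensorμ B A B' A' ≫ (g ⊗ₘ f) =
      (tensorμ A B A' B' ≫ (f ⊗ₘ g)) ≫ (β_ C C').hom := by
  rw [← Category.assoc, tensorμ_braid, Category.assoc, Category.assoc,
    BraidedCategory.braiding_naturality]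

theorem tensAct_naturality (P : Distributor X V) {B C : X → V}
    (θ : ∀ p : Vert X, P.obj p ⊗ B p.1.as ⟶ ((power X V).obj C).obj p.2)
    (hθ : ∀ {p q : Vert X} (f : p ⟶ q),
      (P.map f ⊗ₘ ((power X V).obj B).map ((out X).map f)) ≫ θ q =
        θ p ≫ ((power X V).obj C).map f.2)
    {e e' : FreeSym (Vert X)} (f : e ⟶ e') :
    (P.tens.map f ⊗ₘ ((power X V).obj B).map ((tgt X).map f)) ≫ tensAct P θ e' =
      tensAct P θ e ≫ ((power X V).obj C).map ((src X).map f) := by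
  induction f using FreeSym.hom_induction with
  | map f => exact hθ f
  | id a => simp
  | comp f g hf hg =>
    rw [P.tens.map_comp, Functor.map_comp, Functor.map_comp, Functor.map_comp, Functor.map_comp,
      ← tensorHom_comp_tensorHom, Category.assoc, hg, reassoc_of% hf]
  | @tens a b c d f g hf hg =>
    have h1 := FreeSym.lift_map_tensor P f g
    have h2 : ((power X V).obj B).map ((tgt X).map (f ⊗ₘ g)) =
        (((power X V).obj B).map ((tgt X).map f) ⊗ₘ ((power X V).obj B).map ((tgt X).map g)) :=
      (congrArg (((power X V).obj B).map) (FreeSym.lift_map_tensor (out X) f g)).trans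
        (FreeSym.lift_map_tensor _ _ _)
    have h3 : ((power X V).obj C).map ((src X).map (f ⊗ₘ g)) =
        (((power X V).obj C).map ((src X).map f) ⊗ₘ ((power X V).obj C).map ((src X).map g)) :=
      (congrArg (((power X V).obj C).map) (FreeSym.lift_map_tensor _ f g)).trans
        (FreeSym.lift_map_tensor _ _ _)
    rw [h2, h3]
    erw [h1]
    refine (tensorμ_natural_assoc _ _ _ _ _).trans ?_
    refine Eq.trans ?_ (Category.assoc _ _ _).symm
    refine congrArg (fun k => tensorμ _ _ _ _ ≫ k) ?_
    refine (tensorHom_comp_tensorHom _ _ _ _).trans ?_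
    refine Eq.trans ?_ (tensorHom_comp_tensorHom _ _ _ _).symm
    exact congrArg₂ (fun p q => p ⊗ₘ q) hf hg
  | assocHom a b c => exact tensorμ_assoc_aux _ _ _
  | assocInv a b c => exact inv_aux (α_ _ _ _) (α_ _ _ _) (α_ _ _ _) _ _ (tensorμ_assoc_aux _ _ _)
  | leftHom a => exact tensorμ_left_aux _
  | leftInv a => exact inv_aux (λ_ _) (λ_ _) (λ_ _) _ _ (tensorμ_left_aux _)
  | rightHom a => exact tensorμ_right_aux _
  | rightInv a => exact inv_aux (ρ_ _) (ρ_ _) (ρ_ _) _ _ (tensorμ_right_aux _)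
  | braid a b => exact tensorμ_braid_aux _ _

/-- Apply first `φ` and then `ψ`. -/
def twoStep {P T A B C : V} (φ : P ⊗ A ⟶ B) (ψ : T ⊗ B ⟶ C) : (P ⊗ T) ⊗ A ⟶ C :=
  (β_ P T).hom ▷ A ≫ (α_ T P A).hom ≫ T ◁ φ ≫ ψ

theorem twoStep_naturality {P P' T T' A B B' C C' : V} (a : P ⟶ P') (b : T ⟶ T')
    (k : B ⟶ B') (m : C ⟶ C') (φ : P ⊗ A ⟶ B) (φ' : P' ⊗ A ⟶ B') (ψ : T ⊗ B ⟶ C)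
    (ψ' : T' ⊗ B' ⟶ C') (h1 : a ▷ A ≫ φ' = φ ≫ k) (h2 : (b ⊗ₘ k) ≫ ψ' = ψ ≫ m) :
    (a ⊗ₘ b) ▷ A ≫ twoStep φ' ψ' = twoStep φ ψ ≫ m := by
  have e1 : (a ⊗ₘ b) ▷ A ≫ (β_ P' T').hom ▷ A = (β_ P T).hom ▷ A ≫ (b ⊗ₘ a) ▷ A := by
    rw [← comp_whiskerRight, ← comp_whiskerRight, BraidedCategory.braiding_naturality]
  have e2 : (b ⊗ₘ a) ▷ A ≫ (α_ T' P' A).hom = (α_ T P A).hom ≫ (b ⊗ₘ a ▷ A) := by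
    rw [← tensorHom_id, associator_naturality, tensorHom_id]
  have e3 : (b ⊗ₘ a ▷ A) ≫ T' ◁ φ' = T ◁ φ ≫ (b ⊗ₘ k) := by
    rw [← id_tensorHom, ← id_tensorHom, tensorHom_comp_tensorHom, tensorHom_comp_tensorHom, h1,
      Category.comp_id, Category.id_comp]
  unfold twoStep
  rw [reassoc_of% e1, reassoc_of% e2, reassoc_of% e3, h2]
  simp only [Category.assoc]

theorem twoStep_left {P T A A' B B' C : V} (g : A' ⟶ A) (f : B' ⟶ B) (φ : P ⊗ A ⟶ B)
    (φ' : P ⊗ A' ⟶ B') (ψ : T ⊗ B ⟶ C) (h : P ◁ g ≫ φ = φ' ≫ f) :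
    (P ⊗ T) ◁ g ≫ twoStep φ ψ = twoStep φ' (T ◁ f ≫ ψ) := by
  have e1 : (P ⊗ T) ◁ g ≫ (β_ P T).hom ▷ A = (β_ P T).hom ▷ A' ≫ (T ⊗ P) ◁ g :=
    whisker_exchange _ _
  have e2 : (T ⊗ P) ◁ g ≫ (α_ T P A).hom = (α_ T P A').hom ≫ T ◁ P ◁ g := by simp
  unfold twoStep
  rw [reassoc_of% e1, reassoc_of% e2, ← whiskerLeft_comp_assoc, h, whiskerLeft_comp_assoc]

theorem twoStep_right {P T A B C C' : V} (φ : P ⊗ A ⟶ B) (ψ : T ⊗ B ⟶ C) (m : C ⟶ C') :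
    twoStep φ ψ ≫ m = twoStep φ (ψ ≫ m) := by
  unfold twoStep
  simp only [Category.assoc]

/-- Given maps `φ : P(x̄; y) ⊗ A ⟶ B^{⊗ x̄}` and `θ : P(z̄; x) ⊗ B x ⟶ C^{⊗ z̄}`, the maps
`(P(x₁ ⋯ xₙ; y) ⊗ (P(z̄₁; x₁) ⊗ ⋯ ⊗ P(z̄ₙ; xₙ))) ⊗ A ⟶ C^{⊗ z̄₁ ⋯ z̄ₙ}` obtained by applying
first `φ` and then `θ` in each factor. -/
def twoAct (P : Distributor X V) {B C : X → V} {A : V} (y : Discrete X)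
    (φ : ∀ z : SymSeq X, (P.at y).obj z ⊗ A ⟶ ((power X V).obj B).obj z)
    (θ : ∀ p : Vert X, P.obj p ⊗ B p.1.as ⟶ ((power X V).obj C).obj p.2)
    (e : FreeSym (Vert X)) :
    (P.two y).obj e ⊗ A ⟶ ((power X V).obj C).obj ((src X).obj e) :=
  twoStep (φ ((tgt X).obj e)) (tensAct P θ e)

theorem tensAct_comp_left (P : Distributor X V) {B B' C : X → V} (f : B' ⟶ B)
    (θ : ∀ p : Vert X, P.obj p ⊗ B p.1.as ⟶ ((power X V).obj C).obj p.2)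
    (e : FreeSym (Vert X)) :
    P.tens.obj e ◁ ((power X V).map f).app ((tgt X).obj e) ≫ tensAct P θ e =
      tensAct P (fun p => P.obj p ◁ f p.1.as ≫ θ p) e := by
  induction e with
  | of p => rfl
  | unit =>
    refine (congrArg (fun k => k ≫ (λ_ (𝟙_ V)).hom) (whiskerLeft_id (𝟙_ V) (𝟙_ V))).trans ?_
    exact Category.id_comp _
  | mul a b ha hb =>
    refine (tensorμ_natural_right_assoc _ _ _ _ _).trans ?_
    refine congrArg (fun k => tensorμ _ _ _ _ ≫ k) ?_
    refine (tensorHom_comp_tensorHom _ _ _ _).trans ?_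
    exact congrArg₂ (fun p q => p ⊗ₘ q) ha hb

theorem tensAct_comp_right (P : Distributor X V) {B C C' : X → V} (f : C ⟶ C')
    (θ : ∀ p : Vert X, P.obj p ⊗ B p.1.as ⟶ ((power X V).obj C).obj p.2)
    (e : FreeSym (Vert X)) :
    tensAct P θ e ≫ ((power X V).map f).app ((src X).obj e) =
      tensAct P (fun p => θ p ≫ ((power X V).map f).app p.2) e := by
  induction e with
  | of p => rfl
  | unit => exact Category.comp_id _
  | mul a b ha hb =>
    refine (Category.assoc _ _ _).trans ?_
    refine congrArg (fun k => tensorμ _ _ _ _ ≫ k) ?_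
    refine (tensorHom_comp_tensorHom _ _ _ _).trans ?_
    exact congrArg₂ (fun p q => p ⊗ₘ q) ha hb

theorem twoAct_naturality (P : Distributor X V) {B C : X → V} {A : V} (y : Discrete X)
    (φ : ∀ z : SymSeq X, (P.at y).obj z ⊗ A ⟶ ((power X V).obj B).obj z)
    (θ : ∀ p : Vert X, P.obj p ⊗ B p.1.as ⟶ ((power X V).obj C).obj p.2)
    (hφ : ∀ {z z' : SymSeq X} (σ : z ⟶ z'),
      (P.at y).map σ ▷ A ≫ φ z' = φ z ≫ ((power X V).obj B).map σ)
    (hθ : ∀ {p q : Vert X} (f : p ⟶ q),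
      (P.map f ⊗ₘ ((power X V).obj B).map ((out X).map f)) ≫ θ q =
        θ p ≫ ((power X V).obj C).map f.2)
    {e e' : FreeSym (Vert X)} (f : e ⟶ e') :
    (P.two y).map f ▷ A ≫ twoAct P y φ θ e' =
      twoAct P y φ θ e ≫ ((power X V).obj C).map ((src X).map f) := by
  exact twoStep_naturality _ _ _ _ _ _ _ _ (hφ _) (tensAct_naturality P θ hθ f)

theorem twoAct_comp_left (P : Distributor X V) {B B' C : X → V} {A A' : V} (y : Discrete X)
    (φ : ∀ z : SymSeq X, (P.at y).obj z ⊗ A ⟶ ((power X V).obj B).obj z)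
    (φ' : ∀ z : SymSeq X, (P.at y).obj z ⊗ A' ⟶ ((power X V).obj B').obj z)
    (g : A' ⟶ A) (f : B' ⟶ B)
    (h : ∀ z, (P.at y).obj z ◁ g ≫ φ z = φ' z ≫ ((power X V).map f).app z)
    (θ : ∀ p : Vert X, P.obj p ⊗ B p.1.as ⟶ ((power X V).obj C).obj p.2)
    (e : FreeSym (Vert X)) :
    (P.two y).obj e ◁ g ≫ twoAct P y φ θ e =
      twoAct P y φ' (fun p => P.obj p ◁ f p.1.as ≫ θ p) e :=
  (twoStep_left g _ _ _ _ (h _)).trans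
    (congrArg (fun k => twoStep (φ' ((tgt X).obj e)) k) (tensAct_comp_left P f θ e))

theorem twoAct_comp_right (P : Distributor X V) {B C C' : X → V} {A : V} (y : Discrete X)
    (φ : ∀ z : SymSeq X, (P.at y).obj z ⊗ A ⟶ ((power X V).obj B).obj z)
    (f : C ⟶ C')
    (θ : ∀ p : Vert X, P.obj p ⊗ B p.1.as ⟶ ((power X V).obj C).obj p.2)
    (e : FreeSym (Vert X)) :
    twoAct P y φ θ e ≫ ((power X V).map f).app ((src X).obj e) =
      twoAct P y φ (fun p => θ p ≫ ((power X V).map f).app p.2) e := by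
  exact (twoStep_right _ _ _).trans
    (congrArg (fun k => twoStep (φ ((tgt X).obj e)) k) (tensAct_comp_right P f θ e))

/-- The axioms of a `P`-coalgebra for a family of maps `P(x̄; y) ⊗ C y ⟶ C^{⊗ x̄}`. -/
structure Operad.IsCoaction (P : Operad X V) (C : X → V)
    (act : ∀ p : Vert X, P.P.obj p ⊗ C p.1.as ⟶ ((power X V).obj C).obj p.2) : Prop where
  equivariant : ∀ (y : Discrete X) {z z' : SymSeq X} (σ : z ⟶ z'),
    (P.P.at y).map σ ▷ C y.as ≫ act (y, z') = act (y, z) ≫ ((power X V).obj C).map σ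
  counit : ∀ y : Discrete X,
    P.one y ▷ C y.as ≫ act (y, FreeSym.of y) = (λ_ (C y.as)).hom
  coassoc : ∀ (y : Discrete X) (e : FreeSym (Vert X)),
    (P.comp y).app e ▷ C y.as ≫ act (y, (src X).obj e) =
      twoAct P.P y (fun z => act (y, z)) act e

/-- Coalgebras over the operad `P`. -/
structure Operad.Coalgebra (P : Operad X V) where
  carrier : X → V
  act : ∀ p : Vert X, P.P.obj p ⊗ carrier p.1.as ⟶ ((power X V).obj carrier).obj p.2
  isCoaction : P.IsCoaction carrier act

/-- Maps of `P`-coalgebras. -/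
@[ext]
structure Operad.Coalgebra.Hom {P : Operad X V} (C D : P.Coalgebra) where
  f : C.carrier ⟶ D.carrier
  comm : ∀ p : Vert X, C.act p ≫ ((power X V).map f).app p.2 =
    P.P.obj p ◁ f p.1.as ≫ D.act p

instance (P : Operad X V) : Category P.Coalgebra where
  Hom := Operad.Coalgebra.Hom
  id C := ⟨𝟙 _, fun p => by simp⟩
  comp f g := ⟨f.f ≫ g.f, fun p => by
    simp [reassoc_of% (f.comm p), g.comm p]⟩
  id_comp f := Operad.Coalgebra.Hom.ext (Category.id_comp f.f)
  comp_id f := Operad.Coalgebra.Hom.ext (Category.comp_id f.f)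
  assoc f g h := Operad.Coalgebra.Hom.ext (Category.assoc f.f g.f h.f)

/-- The forgetful functor from `P`-coalgebras to `V^X`. -/
def Operad.forget (P : Operad X V) : P.Coalgebra ⥤ (X → V) where
  obj C := C.carrier
  map f := f.f

end Coalgebras

/-! ### The functors `P^∧`, `P^∧₂` and the maps between them -/

section Coanalytic

variable {X : Type v} {V : Type u} [Category.{v} V] [MonoidalCategory V] [SymmetricCategory V]
  [MonoidalClosed V] [HasLimits V]

/-- The co-analytic functor `P^∧`, with `P^∧(C) y = ∫_{x̄} [P(x̄; y), C^{⊗ x̄}]`. -/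
noncomputable def coanalytic (P : Distributor X V) : (X → V) ⥤ (X → V) :=
  Functor.pi' fun y => power X V ⋙ homEnd (P.at ⟨y⟩)

/-- The functor `P^∧₂`, with `P^∧₂(C) y` the end over all words `x₁ ⋯ xₙ` and `z̄₁, …, z̄ₙ` of
`[P(x₁ ⋯ xₙ; y) ⊗ (P(z̄₁; x₁) ⊗ ⋯ ⊗ P(z̄ₙ; xₙ)), C^{⊗ z̄₁ ⋯ z̄ₙ}]`. -/
noncomputable def coanalytic₂ (P : Distributor X V) : (X → V) ⥤ (X → V) :=
  Functor.pi' fun y => power X V ⋙ (Functor.whiskeringLeft _ _ V).obj (src X) ⋙ homEnd (P.two ⟨y⟩)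

/-- The evaluation `P(x̄; y) ⊗ P^∧(C) y ⟶ C^{⊗ x̄}`. -/
noncomputable def coanalyticEv (P : Distributor X V) (C : X → V) (p : Vert X) :
    P.obj p ⊗ (coanalytic P).obj C p.1.as ⟶ ((power X V).obj C).obj p.2 :=
  homEndEv (P.at p.1) ((power X V).obj C) p.2

theorem coanalyticEv_naturality (P : Distributor X V) (C : X → V) {p q : Vert X} (f : p ⟶ q) :
    (P.map f ⊗ₘ ((power X V).obj ((coanalytic P).obj C)).map ((out X).map f)) ≫
        coanalyticEv P C q =
      coanalyticEv P C p ≫ ((power X V).obj C).map f.2 := by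
  obtain ⟨⟨y⟩, z⟩ := p
  obtain ⟨⟨y'⟩, z'⟩ := q
  obtain ⟨f₁, f₂⟩ := f
  obtain rfl : y = y' := Discrete.eq_of_hom f₁
  obtain rfl : f₁ = 𝟙 _ := Subsingleton.elim _ _
  have h : ((power X V).obj ((coanalytic P).obj C)).map
      ((out X).map (Prod.mkHom (𝟙 (⟨y⟩ : Discrete X)) f₂)) = 𝟙 _ :=
    ((power X V).obj ((coanalytic P).obj C) |>.congr_map
      (FreeSym.inc.map_id (⟨y⟩ : Discrete X))).trans (CategoryTheory.Functor.map_id _ _)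
  refine Eq.trans ?_ (homEndEv_naturality (P.at ⟨y⟩) ((power X V).obj C) f₂)
  refine congrArg (fun k => k ≫ homEndEv (P.at ⟨y⟩) ((power X V).obj C) z') ?_
  refine (congrArg (fun k => P.map (Prod.mkHom (𝟙 (⟨y⟩ : Discrete X)) f₂) ⊗ₘ k) h).trans ?_
  exact tensorHom_id _ _

theorem coanalyticEv_map (P : Distributor X V) {C D : X → V} (f : C ⟶ D) (p : Vert X) :
    P.obj p ◁ (coanalytic P).map f p.1.as ≫ coanalyticEv P D p =
      coanalyticEv P C p ≫ ((power X V).map f).app p.2 :=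
  homEndEv_map (P.at p.1) ((power X V).map f) p.2

/-- The lax structure `α : P^∧ P^∧ ⟶ P^∧₂`, induced by the maps
`⨂ᵢ [Aᵢ, Bᵢ] ⟶ [⨂ᵢ Aᵢ, ⨂ᵢ Bᵢ]`. -/
noncomputable def laxMap (P : Distributor X V) :
    coanalytic P ⋙ coanalytic P ⟶ coanalytic₂ P where
  app C y := homEndLift (P.two ⟨y⟩) (src X ⋙ (power X V).obj C)
    (fun e => twoAct P ⟨y⟩ (B := (coanalytic P).obj C)
      (A := (coanalytic P).obj ((coanalytic P).obj C) y)
      (fun z => coanalyticEv P ((coanalytic P).obj C) (⟨y⟩, z)) (coanalyticEv P C) e)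
    (twoAct_naturality P ⟨y⟩ (B := (coanalytic P).obj C) _ _
      (fun σ => homEndEv_naturality (P.at ⟨y⟩) ((power X V).obj ((coanalytic P).obj C)) σ)
      (coanalyticEv_naturality P C))
  naturality C D f := by
    funext y
    apply homEnd_ext
    intro e
    refine (whiskerLeft_comp_assoc _ _ _ _).trans ?_
    refine Eq.trans ?_ (whiskerLeft_comp_assoc _ _ _ _).symm
    refine (congrArg (fun k => _ ≫ k) (homEndLift_ev _ _ _ _ _)).trans ?_
    refine Eq.trans ?_ (congrArg (fun k => _ ≫ k)
      (homEndEv_map (P.two ⟨y⟩) (Functor.whiskerLeft (src X) ((power X V).map f)) e)).symm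
    refine Eq.trans ?_ (Category.assoc _ _ _)
    refine Eq.trans ?_ (congrArg (fun k => k ≫ _) (homEndLift_ev _ _ _ _ _)).symm
    refine (twoAct_comp_left P ⟨y⟩ _ (fun z => coanalyticEv P ((coanalytic P).obj C) (⟨y⟩, z))
      _ ((coanalytic P).map f) (fun z => coanalyticEv_map P ((coanalytic P).map f) (⟨y⟩, z))
      _ e).trans ?_
    refine Eq.trans ?_ (twoAct_comp_right P ⟨y⟩ _ f _ e).symm
    congr 1
    funext p
    exact coanalyticEv_map P f p

/-- The counit `P^∧ ⟶ id`, evaluation at the units of `P`. -/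
noncomputable def Operad.counit (P : Operad X V) : coanalytic P.P ⟶ 𝟭 (X → V) where
  app C y := (λ_ ((coanalytic P.P).obj C y)).inv ≫ P.one ⟨y⟩ ▷ (coanalytic P.P).obj C y ≫
    coanalyticEv P.P C (⟨y⟩, FreeSym.of ⟨y⟩)
  naturality C D f := by
    funext y
    have h1 := coanalyticEv_map P.P f (⟨y⟩, FreeSym.of ⟨y⟩)
    have h2 : (P.one ⟨y⟩) ▷ (coanalytic P.P).obj C y ≫
        P.P.obj (⟨y⟩, FreeSym.of ⟨y⟩) ◁ (coanalytic P.P).map f y =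
        𝟙_ V ◁ (coanalytic P.P).map f y ≫ (P.one ⟨y⟩) ▷ (coanalytic P.P).obj D y :=
      (whisker_exchange _ _).symm
    have h3 : (λ_ ((coanalytic P.P).obj C y)).inv ≫ 𝟙_ V ◁ (coanalytic P.P).map f y =
        (coanalytic P.P).map f y ≫ (λ_ ((coanalytic P.P).obj D y)).inv :=
      (leftUnitor_inv_naturality _).symm
    change (coanalytic P.P).map f y ≫ _ = (_ ≫ _ ≫ _) ≫ ((power X V).map f).app (FreeSym.of ⟨y⟩)
    rw [Category.assoc, Category.assoc]
    refine Eq.trans ?_ (congrArg (fun k => _ ≫ _ ≫ k) h1)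
    rw [reassoc_of% h2, reassoc_of% h3]
    rfl

/-- The map `Δ : P^∧ ⟶ P^∧₂` induced by the composition of `P`. -/
noncomputable def Operad.diag (P : Operad X V) : coanalytic P.P ⟶ coanalytic₂ P.P where
  app C y := homEndLift (P.P.two ⟨y⟩) (src X ⋙ (power X V).obj C)
    (fun e => (P.comp ⟨y⟩).app e ▷ (coanalytic P.P).obj C y ≫
      coanalyticEv P.P C (⟨y⟩, (src X).obj e))
    (fun {e e'} f => by
      have h1 := (P.comp ⟨y⟩).naturality f
      have h2 := homEndEv_naturality (P.P.at ⟨y⟩) ((power X V).obj C) ((src X).map f)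
      have h3 := congrArg (fun k => k ▷ (coanalytic P.P).obj C y) h1
      rw [comp_whiskerRight, comp_whiskerRight] at h3
      refine (Category.assoc _ _ _).symm.trans ?_
      refine (congrArg (fun k => k ≫ _) h3).trans ?_
      refine (Category.assoc _ _ _).trans ?_
      refine Eq.trans ?_ (Category.assoc _ _ _).symm
      exact congrArg (fun k => _ ≫ k) h2)
  naturality C D f := by
    funext y
    apply homEnd_ext
    intro e
    refine (whiskerLeft_comp_assoc _ _ _ _).trans ?_
    refine Eq.trans ?_ (whiskerLeft_comp_assoc _ _ _ _).symm
    refine (congrArg (fun k => _ ≫ k) (homEndLift_ev _ _ _ _ _)).trans ?_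
    refine Eq.trans ?_ (congrArg (fun k => _ ≫ k)
      (homEndEv_map (P.P.two ⟨y⟩) (Functor.whiskerLeft (src X) ((power X V).map f)) e)).symm
    refine Eq.trans ?_ (Category.assoc _ _ _)
    refine Eq.trans ?_ (congrArg (fun k => k ≫ _) (homEndLift_ev _ _ _ _ _)).symm
    refine (Category.assoc _ _ _).symm.trans ?_
    refine (congrArg (fun k => k ≫ _) (whisker_exchange _ _)).trans ?_
    refine (Category.assoc _ _ _).trans ?_
    refine Eq.trans ?_ (Category.assoc _ _ _).symm
    exact congrArg (fun k => _ ≫ k) (coanalyticEv_map P.P f (⟨y⟩, (src X).obj e))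

/-- The family of maps `P(x̄; y) ⊗ C y ⟶ C^{⊗ x̄}` corresponding to `c : C ⟶ P^∧(C)`. -/
noncomputable def transpose (P : Distributor X V) {C : X → V} (c : C ⟶ (coanalytic P).obj C)
    (p : Vert X) : P.obj p ⊗ C p.1.as ⟶ ((power X V).obj C).obj p.2 :=
  P.obj p ◁ c p.1.as ≫ coanalyticEv P C p

end Coanalytic

end Definitions

/-! ### The comonad `Q_∞` -/

section Tower

instance {X : Type v} {V : Type u} [Category.{v} V] {J : Type v₁} [Category.{u₁} J]
    [HasLimitsOfShape J V] : HasLimitsOfShape J (X → V) where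
  has_limit F := HasLimit.mk
    { cone :=
        { pt := fun x => limit (F ⋙ Pi.eval (fun _ => V) x)
          π :=
            { app := fun j x => limit.π (F ⋙ Pi.eval (fun _ => V) x) j
              naturality := fun i j f => by
                funext x
                exact (limit.cone (F ⋙ Pi.eval (fun _ => V) x)).π.naturality f } }
      isLimit :=
        { lift := fun s x => limit.lift (F ⋙ Pi.eval (fun _ => V) x)
            ((Pi.eval (fun _ => V) x).mapCone s)
          fac := fun s j => by
            funext x
            exact limit.lift_π ((Pi.eval (fun _ => V) x).mapCone s) j
          uniq := fun s m h => by
            funext x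
            apply limit.hom_ext
            intro j
            exact (congrFun (h j) x).trans
              (limit.lift_π ((Pi.eval (fun _ => V) x).mapCone s) j).symm } }

variable {C : Type u₁} [Category.{v₁} C]

/-- A stage `χ : Q_{k+1} ⟶ Q_k`, `δ : Q_{k+1} ⟶ Q_k Q_k` of the tower; here `prev` is `Q_k` and
`next` is `Q_{k+1}`. -/
structure Stage (C : Type u₁) [Category.{v₁} C] where
  prev : C ⥤ C
  next : C ⥤ C
  χ : next ⟶ prev
  δ : next ⟶ prev ⋙ prev

variable [HasLimitsOfShape WalkingCospan C] [HasLimitsOfShape WalkingParallelPair C]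

/-- The first stage: `Q_0 = T` and `Q_1` is the pullback of `Δ : T ⟶ T₂` and `α : T T ⟶ T₂`. -/
noncomputable def Stage.init {T T₂ : C ⥤ C} (Δ : T ⟶ T₂) (α : T ⋙ T ⟶ T₂) : Stage C where
  prev := T
  next := pullback Δ α
  χ := pullback.fst Δ α
  δ := pullback.snd Δ α

/-- The next stage: `Q_{k+1}` is the limit of the diagram
`Q_k ⟶ Q_{k-1} Q_{k-1} ⟵ Q_k Q_k ⇉ Q_{k-1} Q_{k-1} Q_{k-1}`, with maps `δ`, `χχ` and
`δχ`, `χδ`. -/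
noncomputable def Stage.succ (S : Stage C) : Stage C where
  prev := S.next
  next := equalizer
    (pullback.snd S.δ (S.χ ◫ S.χ) ≫ (S.δ ◫ S.χ) ≫ (Functor.associator _ _ _).hom)
    (pullback.snd S.δ (S.χ ◫ S.χ) ≫ (S.χ ◫ S.δ))
  χ := equalizer.ι _ _ ≫ pullback.fst S.δ (S.χ ◫ S.χ)
  δ := equalizer.ι _ _ ≫ pullback.snd S.δ (S.χ ◫ S.χ)

/-- All stages. -/
noncomputable def Stage.iter (S : Stage C) : ℕ → Stage C
  | 0 => S
  | k + 1 => (S.iter k).succ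

/-- The tower `⋯ ⟶ Q_{k+1} ⟶ Q_k ⟶ ⋯ ⟶ Q_0`. -/
noncomputable def Stage.tower (S : Stage C) : ℕᵒᵖ ⥤ (C ⥤ C) :=
  Functor.ofOpSequence (X := fun k => (S.iter k).prev) (fun k => (S.iter k).χ)

end Tower

section Main

variable {X : Type v} {V : Type u} [Category.{v} V] [MonoidalCategory V] [SymmetricCategory V]
  [MonoidalClosed V] [HasLimits V]

/-- The stages of the tower of an operad. -/
noncomputable def Operad.stage (P : Operad X V) (k : ℕ) : Stage (X → V) :=
  (Stage.init P.diag (laxMap P.P)).iter k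

/-- The functors `Q_k`; in particular `Q_0 = P^∧`. -/
noncomputable abbrev Operad.Q (P : Operad X V) (k : ℕ) : (X → V) ⥤ (X → V) :=
  (P.stage k).prev

/-- The maps `δ : Q_{k+1} ⟶ Q_k Q_k`. -/
noncomputable def Operad.δ (P : Operad X V) (k : ℕ) : P.Q (k + 1) ⟶ P.Q k ⋙ P.Q k :=
  (P.stage k).δ

/-- The functor `Q_∞ = P^∨`, the limit of the tower of the `Q_k`. -/
noncomputable def Operad.Qinf (P : Operad X V) : (X → V) ⥤ (X → V) :=
  limit (Stage.init P.diag (laxMap P.P)).tower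

/-- The projections `Q_∞ ⟶ Q_k`. -/
noncomputable def Operad.π (P : Operad X V) (k : ℕ) : P.Qinf ⟶ P.Q k :=
  limit.π (Stage.init P.diag (laxMap P.P)).tower (op k)

/-- The projection `Q_∞ ⟶ P^∧`. -/
noncomputable def Operad.proj (P : Operad X V) : P.Qinf ⟶ coanalytic P.P := P.π 0

end Main

/-- A comonad structure on a functor. -/
structure ComonadStructure {C : Type u₁} [Category.{v₁} C] (Q : C ⥤ C) where
  counit : Q ⟶ 𝟭 C
  comult : Q ⟶ Q ⋙ Q
  coassoc : ∀ A, comult.app A ≫ Q.map (comult.app A) = comult.app A ≫ comult.app (Q.obj A)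
  left_counit : ∀ A, comult.app A ≫ counit.app (Q.obj A) = 𝟙 (Q.obj A)
  right_counit : ∀ A, comult.app A ≫ Q.map (counit.app A) = 𝟙 (Q.obj A)

/-- The bundled comonad. -/
def ComonadStructure.toComonad {C : Type u₁} [Category.{v₁} C] {Q : C ⥤ C}
    (W : ComonadStructure Q) : Comonad C where
  toFunctor := Q
  ε := W.counit
  δ := W.comult
  coassoc := W.coassoc
  left_counit := W.left_counit
  right_counit := W.right_counit

/-! ### The hypotheses on the base category -/

section Hypotheses

variable (V : Type u) [Category.{v} V] [MonoidalCategory V] [SymmetricCategory V]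
  [MonoidalClosed V]

variable {V} in
/-- The canonical map `[A, A'] ⊗ [B, B'] ⟶ [A ⊗ B, A' ⊗ B']`. -/
noncomputable def homTensor (A A' B B' : V) :
    (ihom A).obj A' ⊗ (ihom B).obj B' ⟶ (ihom (A ⊗ B)).obj (A' ⊗ B') :=
  MonoidalClosed.curry (tensorμ A B ((ihom A).obj A') ((ihom B).obj B') ≫
    ((ihom.ev A).app A' ⊗ₘ (ihom.ev B).app B'))

/-- The maps `[A, A'] ⊗ [B, B'] ⟶ [A ⊗ B, A' ⊗ B']` are monomorphisms, for objects of `V`. -/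
def HomTensorMono : Prop :=
  ∀ A A' B B' : V, Mono (homTensor A A' B B')

/-- The maps `[A, A'] ⊗ [B, B'] ⟶ [A ⊗ B, A' ⊗ B']` are monomorphisms, for families of objects
of `V`, where `[A, A']` is the product of the objects `[A j, A' j]`. -/
def FamilyHomTensorMono [HasLimits V] : Prop :=
  ∀ (J K : Type v) (A A' : J → V) (B B' : K → V),
    Mono (Pi.lift (fun p : J × K =>
      (Pi.π (fun j => (ihom (A j)).obj (A' j)) p.1 ⊗ₘ
        Pi.π (fun k => (ihom (B k)).obj (B' k)) p.2) ≫
          homTensor (A p.1) (A' p.1) (B p.2) (B' p.2)))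

/-- Small coproducts exist and their coprojections are monomorphisms. -/
def MonicCoproducts (V : Type u) [Category.{v} V] : Prop :=
  ∃ _ : HasCoproducts.{v} V, ∀ (K : Type v) (B : K → V) (k : K), Mono (Sigma.ι B k)

/-- The tensor product preserves countable intersections: it sends towers of monomorphisms to
towers of monomorphisms, and preserves their limits. -/
def TensorPreservesIntersections (V : Type u) [Category.{v} V] [MonoidalCategory V] : Prop :=
  ∀ A : V, (∀ {B C : V} (m : B ⟶ C), Mono m → Mono (A ◁ m)) ∧
    ∀ F : ℕᵒᵖ ⥤ V, (∀ {i j : ℕᵒᵖ} (f : i ⟶ j), Mono (F.map f)) →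
      PreservesLimit F (tensorLeft A)

/-- The monoidal structure is cartesian: the unit is terminal, and `A ⊗ B` is the product of `A`
and `B`. -/
def IsCartesian (V : Type u) [Category.{v} V] [MonoidalCategory V] : Prop :=
  ∃ t : IsTerminal (𝟙_ V), ∀ A B : V,
    Nonempty (IsLimit (BinaryFan.mk (A ◁ t.from B ≫ (ρ_ A).hom) (t.from A ▷ B ≫ (λ_ B).hom)))

/-- The standing hypothesis on `V`. -/
def BaseHypothesis [HasLimits V] : Prop :=
  ((FamilyHomTensorMono V ∨ (HomTensorMono V ∧ MonicCoproducts V)) ∧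
    TensorPreservesIntersections V) ∨ IsCartesian V

end Hypotheses

end CofreeCoalg

-- A coaction `c : C ⟶ P^∧(C)` satisfies `Δ c = α P^∧(c) c`, which says exactly that it lifts to the
-- pullback `Q_1`. Once `g : C ⟶ Q_k(C)` is compatible with the level below, the pair formed by `g`
-- and `Q_k(g) g` satisfies the equations defining `Q_{k+1}`. A coaction therefore climbs the whole
-- tower and gives `C ⟶ Q_∞(C)` (`Stage.coacts_succ`, `ComultTower.Lawful.exists_coalgebra`).
-- Nothing is lost on the way: maps into `Q_{k+1}` are separated by `χ` and `δ`, so by induction a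
-- map compatible with the coactions is compatible with the `Q_∞`-structures
-- (`ComultTower.JointlyMono.map_comm`). This makes the two categories of coalgebras isomorphic, and
-- cofreeness and comonadicity are carried over from the comonad.
--
-- The comonad exists because `Q_∞ Q_∞` is the limit of the diagonal tower `Q_k Q_k`. The maps `δ_k`
-- then assemble uniquely to `δ_∞`, and the equaliser condition in the definition of `Q_{k+2}` gives
-- coassociativity after projection to `Q_k Q_k Q_k`. The diagonal argument (`diag_hom_ext`,
-- `diag_lift`) requires each `Q_k` to preserve the limit of the tower `m ↦ Q_m(A)`.
--
-- The two hypotheses on the base category supply this differently, and a proposition `b` lets one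
-- proof serve both. With `b` true, only towers of monomorphisms need be preserved, and every `χ`
-- must be shown monic. This reduces to monicity of `α` (`mono_laxMap`), which follows from the
-- hypothesis on internal homs by induction on words. With `b` false, all limits of towers are
-- preserved and no monicity is needed. In both cases preservation passes from `⊗` to tensor powers,
-- then to `P^∧` through a right adjoint, and then to each `Q_k`, a pointwise finite limit of
-- functors already treated.
--
-- The counit laws start at `Q_1`, where the unit laws of `P` are inserted into `Δ f = α g`
-- (`Operad.comp_counit_app`, `Operad.comp_map_counit_app`). They pass upwards because they can be
-- tested on `χ` and `δ` (`Stage.Lawful.left_counit_next`, `Stage.Lawful.right_counit_next`).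

universe v₂ u₂ v₃ u₃

namespace CofreeCoalg

/-! ### Limits of towers in two variables -/

section Diagonal

variable {D₁ : Type u₁} [Category.{v₁} D₁] {D₂ : Type u₂} [Category.{v₂} D₂]
  {C : Type u₃} [Category.{v₃} C] (B : D₁ ⥤ D₂ ⥤ C) {K₁ : ℕᵒᵖ ⥤ D₁} {K₂ : ℕᵒᵖ ⥤ D₂}
  (c₁ : Cone K₁) (c₂ : Cone K₂)

/-- The component at `n` of the projection from the limit of a diagonal tower. -/
abbrev diagProj (n m : ℕᵒᵖ) :
    (B.obj c₁.pt).obj c₂.pt ⟶ (B.obj (K₁.obj n)).obj (K₂.obj m) :=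
  (B.map (c₁.π.app n)).app c₂.pt ≫ (B.obj (K₁.obj n)).map (c₂.π.app m)

/-- The action of the transition maps on a grid. -/
abbrev gridMap {n n' m m' : ℕᵒᵖ} (f : n ⟶ n') (g : m ⟶ m') :
    (B.obj (K₁.obj n)).obj (K₂.obj m) ⟶ (B.obj (K₁.obj n')).obj (K₂.obj m') :=
  (B.map (K₁.map f)).app (K₂.obj m) ≫ (B.obj (K₁.obj n')).map (K₂.map g)

theorem gridMap_comp {n n' n'' m m' m'' : ℕᵒᵖ} (f : n ⟶ n') (f' : n' ⟶ n'') (g : m ⟶ m')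
    (g' : m' ⟶ m'') :
    gridMap B (K₁ := K₁) (K₂ := K₂) f g ≫ gridMap B f' g' = gridMap B (f ≫ f') (g ≫ g') := by
  simp [gridMap]

theorem diagProj_gridMap {n n' m m' : ℕᵒᵖ} (f : n ⟶ n') (g : m ⟶ m') :
    diagProj B c₁ c₂ n m ≫ gridMap B f g = diagProj B c₁ c₂ n' m' := by
  have h1 := c₁.w f
  have h2 := c₂.w g
  simp only [diagProj, gridMap, Category.assoc, NatTrans.naturality_assoc, ← h1, ← h2,
    Functor.map_comp, NatTrans.comp_app]

variable {c₁ c₂} (h₂ : ∀ n, IsLimit ((B.obj (K₁.obj n)).mapCone c₂))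
  (h₁ : IsLimit ((B.flip.obj c₂.pt).mapCone c₁))
include h₁ h₂

/-- The grid of projections separates maps into an iterated limit, and the projection to the point
`(n, m)` factors through the diagonal point `max n m`. -/
theorem diag_hom_ext {Z : C} {f g : Z ⟶ (B.obj c₁.pt).obj c₂.pt}
    (h : ∀ n, f ≫ diagProj B c₁ c₂ n n = g ≫ diagProj B c₁ c₂ n n) : f = g := by
  refine h₁.hom_ext fun n => (h₂ n).hom_ext fun m => ?_
  let k : ℕᵒᵖ := op (max n.unop m.unop)
  let kn : k ⟶ n := (homOfLE (le_max_left n.unop m.unop)).op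
  let km : k ⟶ m := (homOfLE (le_max_right n.unop m.unop)).op
  have e := diagProj_gridMap B c₁ c₂ kn km
  refine (Category.assoc _ _ _).trans (Eq.trans ?_ (Category.assoc _ _ _).symm)
  change f ≫ diagProj B c₁ c₂ n m = g ≫ diagProj B c₁ c₂ n m
  rw [← e, ← Category.assoc, h, Category.assoc]

/-- The diagonal is cofinal in the grid. A cone on the diagonal extends to the grid through the
index `max n m`; it is then lifted in the second variable and afterwards in the first. -/
theorem diag_lift {Z : C} (w : ∀ n, Z ⟶ (B.obj (K₁.obj n)).obj (K₂.obj n))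
    (hw : ∀ {n m : ℕᵒᵖ} (f : n ⟶ m), w n ≫ gridMap B f f = w m) :
    ∃ t : Z ⟶ (B.obj c₁.pt).obj c₂.pt, ∀ n, t ≫ diagProj B c₁ c₂ n n = w n := by
  let k (n m : ℕᵒᵖ) : ℕᵒᵖ := op (max n.unop m.unop)
  let kn (n m : ℕᵒᵖ) : k n m ⟶ n := (homOfLE (le_max_left n.unop m.unop)).op
  let km (n m : ℕᵒᵖ) : k n m ⟶ m := (homOfLE (le_max_right n.unop m.unop)).op
  let x (n m : ℕᵒᵖ) : Z ⟶ (B.obj (K₁.obj n)).obj (K₂.obj m) := w (k n m) ≫ gridMap B (kn n m) (km n m)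
  -- Any diagonal index above both `n` and `m` yields the same map, because it factors through the
  -- maximum.
  have hx {n m l : ℕᵒᵖ} (f : l ⟶ n) (g : l ⟶ m) : w l ≫ gridMap B f g = x n m := by
    have hl : l ⟶ k n m := (homOfLE (max_le (leOfHom f.unop) (leOfHom g.unop))).op
    change _ = w (k n m) ≫ _
    rw [← hw hl, Category.assoc, gridMap_comp]
    rfl
  have hxx {n m n' m' : ℕᵒᵖ} (f : n ⟶ n') (g : m ⟶ m') : x n m ≫ gridMap B f g = x n' m' := by
    change (w (k n m) ≫ _) ≫ _ = _
    rw [Category.assoc, gridMap_comp, hx]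
  let cn (n : ℕᵒᵖ) : Cone (K₂ ⋙ B.obj (K₁.obj n)) :=
    { pt := Z
      π := { app := fun m => x n m
             naturality := fun m m' g => by
              simpa [gridMap] using (hxx (𝟙 n) g).symm } }
  let y (n : ℕᵒᵖ) : Z ⟶ (B.obj (K₁.obj n)).obj c₂.pt := (h₂ n).lift (cn n)
  have hy (n m) : y n ≫ (B.obj (K₁.obj n)).map (c₂.π.app m) = x n m := (h₂ n).fac (cn n) m
  let d : Cone (K₁ ⋙ B.flip.obj c₂.pt) :=
    { pt := Z
      π := { app := fun n => y n
             naturality := fun n n' f => by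
              refine (h₂ n').hom_ext fun m => ?_
              have h : x n m ≫ (B.map (K₁.map f)).app (K₂.obj m) = x n' m := by
                simpa [gridMap] using hxx f (𝟙 m)
              have e := (B.map (K₁.map f)).naturality (c₂.π.app m)
              have hn := hy n m
              have hn' := hy n' m
              dsimp only [Functor.const_obj_obj] at e hn hn'
              change (𝟙 Z ≫ y n') ≫ (B.obj (K₁.obj n')).map (c₂.π.app m) =
                (y n ≫ (B.map (K₁.map f)).app c₂.pt) ≫ (B.obj (K₁.obj n')).map (c₂.π.app m)
              rw [Category.id_comp, hn', ← h, ← hn, Category.assoc, Category.assoc, e] } }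
  refine ⟨h₁.lift d, fun n => ?_⟩
  have := h₁.fac d n
  change h₁.lift d ≫ (B.map (c₁.π.app n)).app c₂.pt = y n at this
  rw [diagProj, reassoc_of% this, hy, ← hx (𝟙 n) (𝟙 n)]
  simp [gridMap]

end Diagonal

/-! ### Functors preserving countable intersections -/

/-- For `b` true: the functor preserves countable intersections, that is monomorphisms and limits
of towers of monomorphisms. For `b` false: the functor preserves limits of towers. -/
structure TowerGood {C : Type u₁} [Category.{v₁} C] {D : Type u₂} [Category.{v₂} D] (b : Prop)
    (F : C ⥤ D) : Prop where
  map_mono : b → ∀ {A B : C} (f : A ⟶ B), Mono f → Mono (F.map f)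
  preserves : ∀ K : ℕᵒᵖ ⥤ C, (∀ {i j : ℕᵒᵖ} (f : i ⟶ j), b → Mono (K.map f)) → PreservesLimit K F

namespace TowerGood

variable {C : Type u₁} [Category.{v₁} C] {D : Type u₂} [Category.{v₂} D]
  {E : Type u₃} [Category.{v₃} E] {b : Prop}

theorem comp {F : C ⥤ D} {G : D ⥤ E} (hF : TowerGood b F) (hG : TowerGood b G) :
    TowerGood b (F ⋙ G) where
  map_mono hb _ _ f hf := hG.map_mono hb _ (hF.map_mono hb f hf)
  preserves K hK := by
    have := hF.preserves K hK
    have := hG.preserves (K ⋙ F) (fun f hb => hF.map_mono hb _ (hK f hb))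
    infer_instance

theorem of_preservesLimits {F : C ⥤ D} [PreservesLimitsOfShape WalkingCospan F]
    [PreservesLimitsOfShape ℕᵒᵖ F] : TowerGood b F where
  map_mono _ _ _ _ _ := inferInstance
  preserves _ _ := inferInstance

end TowerGood

/-- A functor which is pointwise a limit of functors preserving the limit of `K` preserves the limit
of `K`. -/
theorem preservesLimit_of_pointwise {C : Type u₁} [Category.{v₁} C] {J : Type u₂} [Category.{v₂} J]
    {N F G H H' : C ⥤ C} (p : N ⟶ F) (q : N ⟶ G) (a : F ⟶ H) (b : G ⟶ H) (c d : G ⟶ H')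
    (hext : ∀ {Z A : C} (f g : Z ⟶ N.obj A), f ≫ p.app A = g ≫ p.app A →
      f ≫ q.app A = g ≫ q.app A → f = g)
    (hlift : ∀ {Z A : C} (f : Z ⟶ F.obj A) (g : Z ⟶ G.obj A), f ≫ a.app A = g ≫ b.app A →
      g ≫ c.app A = g ≫ d.app A → ∃ t : Z ⟶ N.obj A, t ≫ p.app A = f ∧ t ≫ q.app A = g)
    (h₁ : ∀ A, p.app A ≫ a.app A = q.app A ≫ b.app A)
    (h₂ : ∀ A, q.app A ≫ c.app A = q.app A ≫ d.app A)
    (K : J ⥤ C) [PreservesLimit K F] [PreservesLimit K G] [PreservesLimit K H]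
    [PreservesLimit K H'] : PreservesLimit K N := by
  refine ⟨fun {e} he => ⟨?_⟩⟩
  have lF := isLimitOfPreserves F he
  have lG := isLimitOfPreserves G he
  have lH := isLimitOfPreserves H he
  have lH' := isLimitOfPreserves H' he
  have key : ∀ s : Cone (K ⋙ N), ∃ t : s.pt ⟶ N.obj e.pt,
      ∀ j, t ≫ N.map (e.π.app j) = s.π.app j := by
    intro s
    let sF : Cone (K ⋙ F) := (Cone.postcompose (Functor.whiskerLeft K p)).obj s
    let sG : Cone (K ⋙ G) := (Cone.postcompose (Functor.whiskerLeft K q)).obj s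
    obtain ⟨f, hf⟩ : ∃ f : s.pt ⟶ F.obj e.pt,
        ∀ j, f ≫ F.map (e.π.app j) = s.π.app j ≫ p.app (K.obj j) := ⟨lF.lift sF, lF.fac sF⟩
    obtain ⟨g, hg⟩ : ∃ g : s.pt ⟶ G.obj e.pt,
        ∀ j, g ≫ G.map (e.π.app j) = s.π.app j ≫ q.app (K.obj j) := ⟨lG.lift sG, lG.fac sG⟩
    -- The equations required by `hlift` are checked after the projections of the limits of `H` and
    -- `H'`, where naturality reduces them to `h₁` and `h₂` at `K.obj j`.
    obtain ⟨t, rfl, rfl⟩ := hlift f g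
      (lH.hom_ext fun j => by
        change (f ≫ a.app e.pt) ≫ H.map (e.π.app j) = (g ≫ b.app e.pt) ≫ H.map (e.π.app j)
        have ea := a.naturality (e.π.app j)
        have eb := b.naturality (e.π.app j)
        have hf := hf j
        have hg := hg j
        dsimp only [Functor.const_obj_obj] at ea eb hf hg
        rw [Category.assoc, Category.assoc, ← ea, ← eb, reassoc_of% hf, reassoc_of% hg, h₁])
      (lH'.hom_ext fun j => by
        change (g ≫ c.app e.pt) ≫ H'.map (e.π.app j) = (g ≫ d.app e.pt) ≫ H'.map (e.π.app j)
        have ea := c.naturality (e.π.app j)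
        have eb := d.naturality (e.π.app j)
        have hg := hg j
        dsimp only [Functor.const_obj_obj] at ea eb hg
        rw [Category.assoc, Category.assoc, ← ea, ← eb, reassoc_of% hg, reassoc_of% hg, h₂])
    refine ⟨t, fun j => hext _ _ ?_ ?_⟩
    · rw [← hf j, Category.assoc, Category.assoc]
      exact congrArg (fun k => t ≫ k) (p.naturality _)
    · rw [← hg j, Category.assoc, Category.assoc]
      exact congrArg (fun k => t ≫ k) (q.naturality _)
  choose t ht using key
  refine ⟨t, ht, fun s m hm => hext m (t s) ?_ ?_⟩
  · refine lF.hom_ext fun j => ?_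
    refine (Category.assoc _ _ _).trans (Eq.trans ?_ (Category.assoc _ _ _).symm)
    refine (congrArg (fun k => m ≫ k) (p.naturality _).symm).trans
      (Eq.trans ?_ (congrArg (fun k => t s ≫ k) (p.naturality _)))
    exact (Category.assoc _ _ _).symm.trans ((congrArg (fun k => k ≫ p.app (K.obj j))
      ((hm j).trans (ht s j).symm)).trans (Category.assoc _ _ _))
  · refine lG.hom_ext fun j => ?_
    refine (Category.assoc _ _ _).trans (Eq.trans ?_ (Category.assoc _ _ _).symm)
    refine (congrArg (fun k => m ≫ k) (q.naturality _).symm).trans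
      (Eq.trans ?_ (congrArg (fun k => t s ≫ k) (q.naturality _)))
    exact (Category.assoc _ _ _).symm.trans ((congrArg (fun k => k ≫ q.app (K.obj j))
      ((hm j).trans (ht s j).symm)).trans (Category.assoc _ _ _))

/-! ### The stages of the tower -/

namespace Stage

variable {C : Type u₁} [Category.{v₁} C]

/-- A morphism into the next stage is determined by its components. -/
def JointlyMono (S : Stage C) : Prop :=
  ∀ {Z A : C} (f g : Z ⟶ S.next.obj A), f ≫ S.χ.app A = g ≫ S.χ.app A →
    f ≫ S.δ.app A = g ≫ S.δ.app A → f = g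

/-- The properties of the stages that are needed in the construction of the comonad. -/
structure Lawful (b : Prop) (S : Stage C) (e : S.prev ⟶ 𝟭 C) : Prop where
  prev_good : TowerGood b S.prev
  next_good : TowerGood b S.next
  mono_χ : b → ∀ A, Mono (S.χ.app A)
  jointlyMono : S.JointlyMono
  left_counit : ∀ A, S.δ.app A ≫ e.app (S.prev.obj A) = S.χ.app A
  right_counit : ∀ A, S.δ.app A ≫ S.prev.map (e.app A) = S.χ.app A

/-- Compatible structure maps on an object `A` for the two functors of a stage. -/
structure Coacts (S : Stage C) {A : C} (f : A ⟶ S.prev.obj A) (g : A ⟶ S.next.obj A) : Prop where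
  χ : g ≫ S.χ.app A = f
  δ : g ≫ S.δ.app A = f ≫ S.prev.map f

/-- By naturality `next.map f ≫ χ` equals `χ ≫ prev.map f`, a composite of monomorphisms. -/
theorem mono_of_mono_χ {S : Stage C} {b : Prop} (h : b → ∀ A, Mono (S.χ.app A))
    (hS : TowerGood b S.prev) (hb : b) {A B : C} (f : A ⟶ B) (hf : Mono f) :
    Mono (S.next.map f) := by
  have := h hb A
  have := hS.map_mono hb f hf
  have : Mono (S.next.map f ≫ S.χ.app B) := by
    rw [S.χ.naturality]
    infer_instance
  exact mono_of_mono _ (S.χ.app B)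

section Init

variable [HasLimitsOfShape WalkingCospan C]
  {T T₂ : C ⥤ C} (Δ : T ⟶ T₂) (α : T ⋙ T ⟶ T₂)

theorem isPullback_init (A : C) :
    IsPullback ((init Δ α).χ.app A) ((init Δ α).δ.app A) (Δ.app A) (α.app A) :=
  (IsPullback.of_hasPullback Δ α).map ((evaluation C C).obj A)

theorem init_jointlyMono : (init Δ α).JointlyMono :=
  fun {_ A} _ _ h1 h2 => (isPullback_init Δ α A).hom_ext h1 h2

/-- The first stage is lawful. -/
theorem lawful_init {b : Prop} {ε : T ⟶ 𝟭 C} (hT : TowerGood b T) (hT₂ : TowerGood b T₂)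
    (hα : b → ∀ A, Mono (α.app A))
    (hl : ∀ {Z A : C} (f : Z ⟶ T.obj A) (g : Z ⟶ T.obj (T.obj A)),
      f ≫ Δ.app A = g ≫ α.app A → g ≫ ε.app (T.obj A) = f)
    (hr : ∀ {Z A : C} (f : Z ⟶ T.obj A) (g : Z ⟶ T.obj (T.obj A)),
      f ≫ Δ.app A = g ≫ α.app A → g ≫ T.map (ε.app A) = f) :
    (init Δ α).Lawful b ε := by
  -- Base change of the monomorphism `α`.
  have hχ : b → ∀ A, Mono ((init Δ α).χ.app A) := fun hb A => by
    have := hα hb A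
    have hw := (isPullback_init Δ α A).w
    refine ⟨fun f g h => (isPullback_init Δ α A).hom_ext h ?_⟩
    refine (cancel_mono (α.app A)).1 ?_
    refine (Category.assoc _ _ _).trans (Eq.trans ?_ (Category.assoc _ _ _).symm)
    refine (congrArg (fun k => f ≫ k) hw.symm).trans
      (Eq.trans ?_ (congrArg (fun k => g ≫ k) hw))
    exact (Category.assoc _ _ _).symm.trans
      ((congrArg (fun k => k ≫ Δ.app A) h).trans (Category.assoc _ _ _))
  exact
    { prev_good := hT
      next_good := ⟨mono_of_mono_χ (S := init Δ α) hχ hT, fun K hK => by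
        have := hT.preserves K hK
        have := hT₂.preserves K hK
        have := (hT.comp hT).preserves K hK
        -- A pullback imposes no equaliser condition, so the parallel pair is taken to be two
        -- identities.
        exact preservesLimit_of_pointwise (N := (init Δ α).next) (F := T)
          (G := T ⋙ T) (init Δ α).χ (init Δ α).δ Δ α
          (𝟙 (T ⋙ T)) (𝟙 (T ⋙ T)) (init_jointlyMono Δ α)
          (fun {_ A} f g h _ => ⟨(isPullback_init Δ α A).lift f g h,
            (isPullback_init Δ α A).lift_fst _ _ _, (isPullback_init Δ α A).lift_snd _ _ _⟩)
          (fun A => (isPullback_init Δ α A).w) (fun _ => rfl) K⟩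
      mono_χ := hχ
      jointlyMono := init_jointlyMono Δ α
      left_counit := fun A => hl _ _ (isPullback_init Δ α A).w
      right_counit := fun A => hr _ _ (isPullback_init Δ α A).w }

theorem coacts_init {A : C} (f : A ⟶ T.obj A)
    (hf : f ≫ Δ.app A = (f ≫ T.map f) ≫ α.app A) : ∃ g, (init Δ α).Coacts f g :=
  ⟨(isPullback_init Δ α A).lift f (f ≫ T.map f) hf, (isPullback_init Δ α A).lift_fst _ _ _,
    (isPullback_init Δ α A).lift_snd _ _ _⟩

end Init

section Succ

variable [HasLimitsOfShape WalkingCospan C] (S : Stage C)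

theorem isPullback_succ (A : C) :
    IsPullback ((pullback.fst S.δ (S.χ ◫ S.χ)).app A) ((pullback.snd S.δ (S.χ ◫ S.χ)).app A)
      (S.δ.app A) ((S.χ ◫ S.χ).app A) :=
  (IsPullback.of_hasPullback S.δ (S.χ ◫ S.χ)).map ((evaluation C C).obj A)

variable [HasLimitsOfShape WalkingParallelPair C]

theorem succ_χ_δ (A : C) :
    S.succ.χ.app A ≫ S.δ.app A = S.succ.δ.app A ≫ (S.χ ◫ S.χ).app A := by
  change (_ ≫ (pullback.fst S.δ (S.χ ◫ S.χ)).app A) ≫ _ =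
    (_ ≫ (pullback.snd S.δ (S.χ ◫ S.χ)).app A) ≫ _
  exact (Category.assoc _ _ _).trans ((congrArg (fun k => _ ≫ k) (isPullback_succ S A).w).trans
    (Category.assoc _ _ _).symm)

/-- This is the equaliser condition at `A`. The associator in one of the parallel maps has identity
components and disappears. -/
theorem succ_coassoc (A : C) :
    S.succ.δ.app A ≫ (S.δ ◫ S.χ).app A = S.succ.δ.app A ≫ (S.χ ◫ S.δ).app A := by
  have h := congrArg (fun k => k.app A) (equalizer.condition
    (pullback.snd S.δ (S.χ ◫ S.χ) ≫ (S.δ ◫ S.χ) ≫ (Functor.associator _ _ _).hom)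
    (pullback.snd S.δ (S.χ ◫ S.χ) ≫ (S.χ ◫ S.δ)))
  have h2 : ((S.δ ◫ S.χ) ≫ (Functor.associator _ _ _).hom).app A = (S.δ ◫ S.χ).app A :=
    Category.comp_id _
  change _ ≫ _ ≫ ((S.δ ◫ S.χ) ≫ (Functor.associator _ _ _).hom).app A = _ ≫ _ ≫ _ at h
  rw [h2] at h
  exact (Category.assoc _ _ _).trans (h.trans (Category.assoc _ _ _).symm)

theorem succ_jointlyMono : S.succ.JointlyMono := by
  intro Z A f g h1 h2
  have hl := isLimitForkMapOfIsLimit ((evaluation C C).obj A) _ (equalizerIsEqualizer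
    (pullback.snd S.δ (S.χ ◫ S.χ) ≫ (S.δ ◫ S.χ) ≫ (Functor.associator _ _ _).hom)
    (pullback.snd S.δ (S.χ ◫ S.χ) ≫ (S.χ ◫ S.δ)))
  refine Fork.IsLimit.hom_ext hl ?_
  apply (isPullback_succ S A).hom_ext
  · exact (Category.assoc _ _ _).trans (h1.trans (Category.assoc _ _ _).symm)
  · exact (Category.assoc _ _ _).trans (h2.trans (Category.assoc _ _ _).symm)

theorem succ_lift {Z A : C} (f : Z ⟶ S.next.obj A) (g : Z ⟶ S.next.obj (S.next.obj A))
    (h1 : f ≫ S.δ.app A = g ≫ (S.χ ◫ S.χ).app A)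
    (h2 : g ≫ (S.δ ◫ S.χ).app A = g ≫ (S.χ ◫ S.δ).app A) :
    ∃ t : Z ⟶ S.succ.next.obj A, t ≫ S.succ.χ.app A = f ∧ t ≫ S.succ.δ.app A = g := by
  have hl := isLimitForkMapOfIsLimit ((evaluation C C).obj A) _ (equalizerIsEqualizer
    (pullback.snd S.δ (S.χ ◫ S.χ) ≫ (S.δ ◫ S.χ) ≫ (Functor.associator _ _ _).hom)
    (pullback.snd S.δ (S.χ ◫ S.χ) ≫ (S.χ ◫ S.δ)))
  have hp := isPullback_succ S A
  have h2' : ((S.δ ◫ S.χ) ≫ (Functor.associator _ _ _).hom).app A = (S.δ ◫ S.χ).app A :=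
    Category.comp_id _
  obtain ⟨t, ht⟩ := Fork.IsLimit.lift' hl (hp.lift f g h1) (by
    change _ ≫ _ ≫ ((S.δ ◫ S.χ) ≫ (Functor.associator _ _ _).hom).app A = _ ≫ _ ≫ _
    rw [h2']
    exact (hp.lift_snd_assoc _ _ _ _).trans (h2.trans (hp.lift_snd_assoc _ _ _ _).symm))
  refine ⟨t, ?_, ?_⟩
  · exact ((Category.assoc _ _ _).symm.trans (congrArg (fun k => k ≫ _) ht)).trans
      (hp.lift_fst _ _ _)
  · exact ((Category.assoc _ _ _).symm.trans (congrArg (fun k => k ≫ _) ht)).trans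
      (hp.lift_snd _ _ _)

/-- The lift is given by the pair `g`, `g ≫ S.next.map g`. Its image in `Q_k Q_k` is `f ≫ S.prev.map
f`, and both parallel maps send it to the threefold iterate of `f`, so coassociativity costs no
further assumption. -/
theorem coacts_succ {S : Stage C} {A : C} {f : A ⟶ S.prev.obj A} {g : A ⟶ S.next.obj A}
    (h : S.Coacts f g) : ∃ k, S.succ.Coacts g k := by
  obtain ⟨t, h1, h2⟩ := succ_lift S g (g ≫ S.next.map g)
    (by
      have e := S.χ.naturality_assoc g (S.prev.map (S.χ.app A))
      rw [NatTrans.hcomp_app, Category.assoc, e, reassoc_of% h.χ, ← Functor.map_comp, h.χ, h.δ])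
    (by
      have e1 := S.χ.naturality_assoc g (S.prev.map (S.δ.app A))
      have e2 := S.δ.naturality_assoc g ((S.prev ⋙ S.prev).map (S.χ.app A))
      rw [NatTrans.hcomp_app, NatTrans.hcomp_app, Category.assoc, Category.assoc, e1, e2,
        reassoc_of% h.χ, reassoc_of% h.δ, ← Functor.map_comp, ← Functor.map_comp, h.χ, h.δ,
        Functor.map_comp]
      rfl)
  exact ⟨t, h1, h2⟩

end Succ

/-- Tested on `χ`, the claim reduces by `h1` to the counit law one level down. Tested on `δ`,
naturality of `e` produces one side of `h2`; exchanging it for the other side makes the counit law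
applicable again. No monicity of `χ` enters, so the argument covers the cartesian case. -/
theorem Lawful.left_counit_next {b : Prop} {S : Stage C} {e : S.prev ⟶ 𝟭 C} (hS : S.Lawful b e)
    {Z A : C} (x : Z ⟶ S.next.obj A) (d : Z ⟶ S.next.obj (S.next.obj A))
    (h1 : x ≫ S.δ.app A = d ≫ (S.χ ◫ S.χ).app A)
    (h2 : d ≫ (S.δ ◫ S.χ).app A = d ≫ (S.χ ◫ S.δ).app A) :
    d ≫ (S.χ ≫ e).app (S.next.obj A) = x := by
  simp only [NatTrans.hcomp_app] at h1 h2
  have n1 : e.app (S.next.obj A) ≫ S.χ.app A = S.prev.map (S.χ.app A) ≫ e.app (S.prev.obj A) :=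
    (e.naturality (S.χ.app A)).symm
  have n2 : e.app (S.next.obj A) ≫ S.δ.app A =
      S.prev.map (S.δ.app A) ≫ e.app (S.prev.obj (S.prev.obj A)) :=
    (e.naturality (S.δ.app A)).symm
  have n3 : (S.prev ⋙ S.prev).map (S.χ.app A) ≫ e.app (S.prev.obj (S.prev.obj A)) =
      e.app (S.prev.obj (S.next.obj A)) ≫ S.prev.map (S.χ.app A) :=
    e.naturality (S.prev.map (S.χ.app A))
  have l := hS.left_counit
  apply hS.jointlyMono
  · rw [NatTrans.comp_app, Category.assoc, Category.assoc, n1]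
    conv_rhs => rw [← l A, reassoc_of% h1]
  · have h2' := congrArg (fun k => k ≫ e.app (S.prev.obj (S.prev.obj A))) h2
    simp only [Category.assoc] at h2'
    rw [NatTrans.comp_app, Category.assoc, Category.assoc, n2]
    refine h2'.trans ?_
    rw [n3, h1, reassoc_of% (l (S.next.obj A))]

/-- The mirror image of `left_counit_next`: `h2` is read in the opposite direction, and the counit
law one level down is applied under `S.prev`. -/
theorem Lawful.right_counit_next {b : Prop} {S : Stage C} {e : S.prev ⟶ 𝟭 C} (hS : S.Lawful b e)
    {Z A : C} (x : Z ⟶ S.next.obj A) (d : Z ⟶ S.next.obj (S.next.obj A))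
    (h1 : x ≫ S.δ.app A = d ≫ (S.χ ◫ S.χ).app A)
    (h2 : d ≫ (S.δ ◫ S.χ).app A = d ≫ (S.χ ◫ S.δ).app A) :
    d ≫ S.next.map ((S.χ ≫ e).app A) = x := by
  simp only [NatTrans.hcomp_app] at h1 h2
  have r := hS.right_counit
  have n1 : S.next.map ((S.χ ≫ e).app A) ≫ S.χ.app A =
      S.χ.app (S.next.obj A) ≫ S.prev.map (S.χ.app A) ≫ S.prev.map (e.app A) := by
    rw [← Functor.map_comp]
    exact S.χ.naturality _
  have n2 : S.next.map ((S.χ ≫ e).app A) ≫ S.δ.app A = S.δ.app (S.next.obj A) ≫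
      (S.prev ⋙ S.prev).map (S.χ.app A) ≫ (S.prev ⋙ S.prev).map (e.app A) := by
    rw [← Functor.map_comp]
    exact S.δ.naturality _
  refine hS.jointlyMono (A := A) _ _ ?_ ?_
  · rw [Category.assoc, n1]
    conv_rhs => rw [← r A, reassoc_of% h1]
  · have h2' := congrArg (fun k => k ≫ (S.prev ⋙ S.prev).map (e.app A)) h2
    simp only [Category.assoc] at h2'
    have r' : S.prev.map (S.δ.app A) ≫ (S.prev ⋙ S.prev).map (e.app A) =
        S.prev.map (S.χ.app A) :=
      (S.prev.map_comp _ _).symm.trans (congrArg S.prev.map (r A))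
    rw [Category.assoc, n2]
    refine h2'.symm.trans ?_
    rw [r', h1]

/-- The successor of a lawful stage is lawful. -/
theorem Lawful.succ [HasLimitsOfShape WalkingCospan C] [HasLimitsOfShape WalkingParallelPair C]
    {b : Prop} {S : Stage C} {e : S.prev ⟶ 𝟭 C} (hS : S.Lawful b e) :
    S.succ.Lawful b (S.χ ≫ e) := by
  -- As `χχ` is monic, the identity `succ_χ_δ` makes the new `δ` a function of the new `χ`, and the
  -- two together are jointly monic.
  have hχ : b → ∀ A, Mono (S.succ.χ.app A) := fun hb A => by
    have h1 := hS.mono_χ hb (S.next.obj A)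
    have h2 := hS.prev_good.map_mono hb _ (hS.mono_χ hb A)
    have h3 : Mono ((S.χ ◫ S.χ).app A) := by
      rw [NatTrans.hcomp_app]
      exact mono_comp _ _
    have hw := succ_χ_δ S A
    refine ⟨fun f g h => succ_jointlyMono S f g h ?_⟩
    refine (cancel_mono ((S.χ ◫ S.χ).app A)).1 ?_
    refine (Category.assoc _ _ _).trans (Eq.trans ?_ (Category.assoc _ _ _).symm)
    refine (congrArg (fun k => f ≫ k) hw.symm).trans
      (Eq.trans ?_ (congrArg (fun k => g ≫ k) hw))
    exact (Category.assoc _ _ _).symm.trans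
      ((congrArg (fun k => k ≫ S.δ.app A) h).trans (Category.assoc _ _ _))
  exact
    { prev_good := hS.next_good
      next_good := ⟨mono_of_mono_χ (S := S.succ) hχ hS.next_good, fun K hK => by
        have := hS.next_good.preserves K hK
        have := (hS.next_good.comp hS.next_good).preserves K hK
        have := (hS.prev_good.comp hS.prev_good).preserves K hK
        have := ((hS.prev_good.comp hS.prev_good).comp hS.prev_good).preserves K hK
        -- The two parallel maps end in differently bracketed triple composites, which agree
        -- definitionally.
        let d : S.next ⋙ S.next ⟶ S.prev ⋙ S.prev ⋙ S.prev := S.χ ◫ S.δ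
        exact preservesLimit_of_pointwise (N := S.succ.next) (F := S.next) (G := S.next ⋙ S.next)
          S.succ.χ S.succ.δ S.δ (S.χ ◫ S.χ) (S.δ ◫ S.χ) d (succ_jointlyMono S)
          (succ_lift S) (succ_χ_δ S) (succ_coassoc S) K⟩
      mono_χ := hχ
      jointlyMono := succ_jointlyMono S
      left_counit := fun A => hS.left_counit_next _ _ (succ_χ_δ S A) (succ_coassoc S A)
      right_counit := fun A => hS.right_counit_next _ _ (succ_χ_δ S A) (succ_coassoc S A) }

end Stage

end CofreeCoalg

namespace CofreeCoalg

theorem ComonadStructure.ext' {C : Type u₁} [Category.{v₁} C] {Q : C ⥤ C}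
    {W W' : ComonadStructure Q} (h₁ : W.counit = W'.counit) (h₂ : W.comult = W'.comult) :
    W = W' := by
  cases W
  cases W'
  subst h₁ h₂
  rfl

/-! ### The comonad on the limit of a tower -/

/-- A tower of functors `χ : Q_{k+1} ⟶ Q_k` with maps `δ : Q_{k+1} ⟶ Q_k Q_k`. -/
structure ComultTower (C : Type u₁) [Category.{v₁} C] where
  Q : ℕ → C ⥤ C
  χ : ∀ k, Q (k + 1) ⟶ Q k
  δ : ∀ k, Q (k + 1) ⟶ Q k ⋙ Q k

namespace ComultTower

variable {C : Type u₁} [Category.{v₁} C]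

/-- The underlying tower of functors. -/
abbrev tower (S : ComultTower C) : ℕᵒᵖ ⥤ (C ⥤ C) := Functor.ofOpSequence S.χ

/-- Morphisms into the functors of the tower are determined by `χ` and `δ`. -/
def JointlyMono (S : ComultTower C) : Prop :=
  ∀ (k : ℕ) {Z A : C} (f g : Z ⟶ (S.Q (k + 1)).obj A), f ≫ (S.χ k).app A = g ≫ (S.χ k).app A →
    f ≫ (S.δ k).app A = g ≫ (S.δ k).app A → f = g

/-- Compatible structure maps on an object `A` for two consecutive functors of the tower. -/
structure Coacts (S : ComultTower C) (k : ℕ) {A : C} (f : A ⟶ (S.Q k).obj A)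
    (g : A ⟶ (S.Q (k + 1)).obj A) : Prop where
  χ : g ≫ (S.χ k).app A = f
  δ : g ≫ (S.δ k).app A = f ≫ (S.Q k).map f

/-- The properties of the tower which make its limit a comonad. -/
structure Lawful (b : Prop) (S : ComultTower C) (e : ∀ k, S.Q k ⟶ 𝟭 C) : Prop where
  good : ∀ k, TowerGood b (S.Q k)
  mono_χ : b → ∀ k A, Mono ((S.χ k).app A)
  χ_counit : ∀ k, S.χ k ≫ e k = e (k + 1)
  left_counit : ∀ k A, (S.δ k).app A ≫ (e k).app ((S.Q k).obj A) = (S.χ k).app A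
  right_counit : ∀ k A, (S.δ k).app A ≫ (S.Q k).map ((e k).app A) = (S.χ k).app A
  χ_δ : ∀ k A, (S.χ (k + 1)).app A ≫ (S.δ k).app A =
    (S.δ (k + 1)).app A ≫ (S.χ k ◫ S.χ k).app A
  coassoc : ∀ k A, (S.δ (k + 1)).app A ≫ (S.δ k ◫ S.χ k).app A =
    (S.δ (k + 1)).app A ≫ (S.χ k ◫ S.δ k).app A

variable (S : ComultTower C)

theorem tower_map_succ (k : ℕ) : S.tower.map (homOfLE (Nat.le_succ k)).op = S.χ k :=
  Functor.ofOpSequence_map_homOfLE_succ _ k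

/-- Every transition map is a composite of components of the `χ k`. -/
theorem tower_mono {b : Prop} {e : ∀ k, S.Q k ⟶ 𝟭 C} (hS : S.Lawful b e) {i j : ℕᵒᵖ} (f : i ⟶ j)
    (A : C) (hb : b) : Mono ((S.tower.map f).app A) := by
  obtain ⟨i⟩ := i
  obtain ⟨j⟩ := j
  have hij : j ≤ i := leOfHom f.unop
  induction i, hij using Nat.le_induction with
  | base =>
    obtain rfl : f = 𝟙 _ := Subsingleton.elim _ _
    rw [CategoryTheory.Functor.map_id, NatTrans.id_app]
    infer_instance
  | succ i hij ih =>
    obtain rfl : f = (homOfLE (Nat.le_succ i)).op ≫ (homOfLE hij).op := Subsingleton.elim _ _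
    have h1 := hS.mono_χ hb i A
    have h2 := ih (homOfLE hij).op
    rw [← tower_map_succ] at h1
    rw [Functor.map_comp, NatTrans.comp_app]
    exact @mono_comp _ _ _ _ _ _ h1 _ h2

variable [HasLimitsOfShape ℕᵒᵖ C]

/-- The limit of the tower. -/
noncomputable abbrev lim : C ⥤ C := limit S.tower

/-- The projections from the limit of the tower. -/
noncomputable def proj (k : ℕ) : S.lim ⟶ S.Q k := limit.π S.tower (op k)

theorem exists_proj_factor {k m : ℕ} (h : k ≤ m) : ∃ t : S.Q m ⟶ S.Q k, S.proj m ≫ t = S.proj k :=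
  ⟨S.tower.map (homOfLE h).op, limit.w S.tower (homOfLE h).op⟩

theorem proj_χ (k : ℕ) : S.proj (k + 1) ≫ S.χ k = S.proj k := by
  rw [← tower_map_succ]
  exact limit.w S.tower (homOfLE (Nat.le_succ k)).op

theorem proj_χ_app (k : ℕ) (A : C) :
    (S.proj (k + 1)).app A ≫ (S.χ k).app A = (S.proj k).app A :=
  congrArg (fun t => t.app A) (S.proj_χ k)

/-- The limit cone of the tower at an object. -/
noncomputable abbrev coneAt (A : C) : Cone (S.tower ⋙ (evaluation C C).obj A) :=
  ((evaluation C C).obj A).mapCone (limit.cone S.tower)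

/-- The limit of the tower is computed pointwise. -/
noncomputable def isLimitConeAt (A : C) : IsLimit (S.coneAt A) :=
  isLimitOfPreserves _ (limit.isLimit S.tower)

theorem lim_hom_ext {Z A : C} {f g : Z ⟶ S.lim.obj A}
    (h : ∀ k, f ≫ (S.proj k).app A = g ≫ (S.proj k).app A) : f = g :=
  (S.isLimitConeAt A).hom_ext fun ⟨k⟩ => h k

theorem lim_lift {Z A : C} (f : ∀ k, Z ⟶ (S.Q k).obj A)
    (hf : ∀ k, f (k + 1) ≫ (S.χ k).app A = f k) :
    ∃ t : Z ⟶ S.lim.obj A, ∀ k, t ≫ (S.proj k).app A = f k := by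
  let s : Cone (S.tower ⋙ (evaluation C C).obj A) :=
    { pt := Z
      π := NatTrans.ofOpSequence f fun k => by
        have h : (S.tower ⋙ (evaluation C C).obj A).map (homOfLE (Nat.le_succ k)).op =
            (S.χ k).app A := congrArg (fun t => t.app A) (S.tower_map_succ k)
        refine (Category.id_comp _).trans ?_
        exact ((congrArg (fun t => f (k + 1) ≫ t) h).trans (hf k)).symm }
  exact ⟨(S.isLimitConeAt A).lift s, fun k => (S.isLimitConeAt A).fac s (op k)⟩

section Lawful

variable {S} {b : Prop} {e : ∀ k, S.Q k ⟶ 𝟭 C} (hS : S.Lawful b e)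
include hS

theorem Lawful.proj_counit (k : ℕ) : S.proj k ≫ e k = S.proj 0 ≫ e 0 := by
  induction k with
  | zero => rfl
  | succ k ih => rw [← hS.χ_counit, reassoc_of% (S.proj_χ k), ih]

/-- When `b` holds the tower at `A` consists of monomorphisms, so in either case `F` preserves its
limit `Q_∞(A)`. -/
theorem Lawful.good_hom_ext {D : Type u₂} [Category.{v₂} D] {F : C ⥤ D} (hF : TowerGood b F)
    {Z : D} {A : C} {f g : Z ⟶ F.obj (S.lim.obj A)}
    (h : ∀ k, f ≫ F.map ((S.proj k).app A) = g ≫ F.map ((S.proj k).app A)) : f = g := by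
  have := hF.preserves (S.tower ⋙ (evaluation C C).obj A) (fun f hb => tower_mono S hS f A hb)
  exact (isLimitOfPreserves F (S.isLimitConeAt A)).hom_ext fun ⟨k⟩ => h k

theorem Lawful.exists_isLimit_map (A : C) (k : ℕᵒᵖ) :
    Nonempty (IsLimit (((𝟭 (C ⥤ C)).obj (S.tower.obj k)).mapCone (S.coneAt A))) := by
  have := (hS.good k.unop).preserves (S.tower ⋙ (evaluation C C).obj A)
    (fun f hb => tower_mono S hS f A hb)
  exact ⟨isLimitOfPreserves (S.Q k.unop) (S.isLimitConeAt A)⟩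

/-- This is the diagonal lemma for the evaluation bifunctor: the limit in the outer variable is
pointwise, and the one in the inner variable is preserved by every `Q_n`. -/
theorem Lawful.lim_lim_hom_ext {Z A : C} {f g : Z ⟶ S.lim.obj (S.lim.obj A)}
    (h : ∀ k, f ≫ (S.proj k ◫ S.proj k).app A = g ≫ (S.proj k ◫ S.proj k).app A) : f = g :=
  diag_hom_ext (𝟭 (C ⥤ C)) (c₁ := limit.cone S.tower) (c₂ := S.coneAt A)
    (fun n => (hS.exists_isLimit_map A n).some) (S.isLimitConeAt _) fun ⟨k⟩ => h k

theorem Lawful.lim_lim_lift {Z A : C} (f : ∀ k, Z ⟶ (S.Q k).obj ((S.Q k).obj A))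
    (hf : ∀ k, f (k + 1) ≫ (S.χ k ◫ S.χ k).app A = f k) :
    ∃ t : Z ⟶ S.lim.obj (S.lim.obj A), ∀ k, t ≫ (S.proj k ◫ S.proj k).app A = f k := by
  obtain ⟨t, ht⟩ := diag_lift (𝟭 (C ⥤ C)) (c₁ := limit.cone S.tower) (c₂ := S.coneAt A)
    (fun n => (hS.exists_isLimit_map A n).some) (S.isLimitConeAt _) (Z := Z)
    (fun n => f n.unop) (fun {n m} g => by
      change f n.unop ≫ (S.tower.map g ◫ S.tower.map g).app A = f m.unop
      obtain ⟨i⟩ := n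
      obtain ⟨j⟩ := m
      have hij : j ≤ i := leOfHom g.unop
      -- Compatibility is given only for single steps `χ ◫ χ`; the interchange law composes them.
      induction i, hij using Nat.le_induction with
      | base =>
        obtain rfl : g = 𝟙 _ := Subsingleton.elim _ _
        refine (congrArg (fun t => f j ≫ (t ◫ t).app A) (S.tower.map_id (op j))).trans ?_
        refine Eq.trans (congrArg (fun t => f j ≫ t) ?_) (Category.comp_id (f j))
        change (𝟙 (S.Q j) ◫ 𝟙 (S.Q j)).app A = _
        simp
      | succ i hij ih =>
        obtain rfl : g = (homOfLE (Nat.le_succ i)).op ≫ (homOfLE hij).op := Subsingleton.elim _ _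
        have h := hf i
        rw [← tower_map_succ] at h
        rw [Functor.map_comp, NatTrans.exchange, NatTrans.comp_app]
        refine (Category.assoc _ _ _).symm.trans ?_
        exact (congrArg (fun t => t ≫ _) h).trans (ih _))
  exact ⟨t, fun k => ht (op k)⟩

/-- The three layers are first separated by independent indices, from the outermost inwards, and the
resulting projection is then factored through the projection at their maximum. -/
theorem Lawful.lim_lim_lim_hom_ext {Z A : C} {f g : Z ⟶ S.lim.obj (S.lim.obj (S.lim.obj A))}
    (h : ∀ k, f ≫ (S.proj k ◫ (S.proj k ◫ S.proj k)).app A =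
      g ≫ (S.proj k ◫ (S.proj k ◫ S.proj k)).app A) : f = g := by
  refine S.lim_hom_ext fun k => hS.good_hom_ext (hS.good k) fun m => ?_
  refine hS.good_hom_ext ((hS.good m).comp (hS.good k)) fun l => ?_
  obtain ⟨t, ht⟩ := S.exists_proj_factor (le_max_left k (max m l))
  obtain ⟨t', ht'⟩ := S.exists_proj_factor ((le_max_left m l).trans (le_max_right k (max m l)))
  obtain ⟨t'', ht''⟩ := S.exists_proj_factor ((le_max_right m l).trans (le_max_right k (max m l)))
  have key := congrArg (fun x => x ≫ (t'' ◫ (t' ◫ t)).app A) (h (max k (max m l)))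
  simp only [Category.assoc, ← NatTrans.comp_app] at key
  rw [← NatTrans.exchange, ← NatTrans.exchange, ht, ht', ht''] at key
  simpa [NatTrans.hcomp_app] using key

/-- The comonad structure on the limit of a lawful tower. -/
theorem Lawful.exists_comonadStructure : ∃ W : ComonadStructure S.lim,
    W.counit = S.proj 0 ≫ e 0 ∧
      ∀ k, W.comult ≫ (S.proj k ◫ S.proj k) = S.proj (k + 1) ≫ S.δ k := by
  -- The comultiplication is the lift of the maps `δ_k π_{k+1}`, whose compatibility along the
  -- diagonal tower is `χ_δ`.
  have key (A : C) : ∃ t : S.lim.obj A ⟶ S.lim.obj (S.lim.obj A),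
      ∀ k, t ≫ (S.proj k ◫ S.proj k).app A = (S.proj (k + 1)).app A ≫ (S.δ k).app A :=
    hS.lim_lim_lift _ fun k => by
      rw [Category.assoc, ← hS.χ_δ, reassoc_of% (S.proj_χ_app)]
  choose d hd using key
  have hd' (A : C) (k : ℕ) : d A ≫ (S.proj k).app (S.lim.obj A) ≫
      (S.Q k).map ((S.proj k).app A) = (S.proj (k + 1)).app A ≫ (S.δ k).app A := hd A k
  let D : S.lim ⟶ S.lim ⋙ S.lim :=
    { app := d
      naturality := fun A B f => by
        refine hS.lim_lim_hom_ext fun k => ?_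
        have h1 := (S.proj k ◫ S.proj k).naturality f
        rw [Category.assoc, hd, Category.assoc, h1, reassoc_of% (hd A k),
          NatTrans.naturality_assoc, NatTrans.naturality] }
  -- The counit can be read at any level, so after projection to `Q_k` it is replaced by `e k` and
  -- meets the counit law of `δ_k`.
  have hc (k : ℕ) (A : C) :
      (S.proj 0 ≫ e 0).app A = (S.proj k).app A ≫ (e k).app A := by
    rw [← hS.proj_counit k, NatTrans.comp_app]
  refine ⟨⟨S.proj 0 ≫ e 0, D, fun A => ?_, fun A => ?_, fun A => ?_⟩, rfl, fun k => ?_⟩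
  · refine hS.lim_lim_lim_hom_ext fun k => ?_
    change (d A ≫ S.lim.map (d A)) ≫ _ = (d A ≫ d (S.lim.obj A)) ≫ _
    -- Both iterated comultiplications, projected to `Q_k Q_k Q_k`, factor through `π_{k+2}` and
    -- `δ_{k+1}`. Two levels above `k` are needed because each application of `δ` lowers the level
    -- by one.
    have e1 : d A ≫ S.lim.map (d A) ≫ (S.proj k ◫ (S.proj k ◫ S.proj k)).app A =
        (S.proj (k + 2)).app A ≫ (S.δ (k + 1)).app A ≫ (S.δ k ◫ S.χ k).app A := by
      have n1 := (S.proj k).naturality_assoc (d A)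
        ((S.Q k).map ((S.proj k).app (S.lim.obj A) ≫ (S.Q k).map ((S.proj k).app A)))
      have n2 := (S.χ k).naturality_assoc ((S.proj (k + 1)).app A)
        ((S.Q k).map ((S.δ k).app A))
      have e0 : (S.proj k ◫ (S.proj k ◫ S.proj k)).app A =
          (S.proj k).app (S.lim.obj (S.lim.obj A)) ≫ (S.Q k).map
            ((S.proj k).app (S.lim.obj A) ≫ (S.Q k).map ((S.proj k).app A)) := by
        simp [NatTrans.hcomp_app]
      rw [e0, n1, ← Functor.map_comp, hd', Functor.map_comp, ← reassoc_of% (S.proj_χ_app), ← n2,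
        NatTrans.hcomp_app, reassoc_of% (hd' A (k + 1))]
    have e2 : d A ≫ d (S.lim.obj A) ≫ (S.proj k ◫ (S.proj k ◫ S.proj k)).app A =
        (S.proj (k + 2)).app A ≫ (S.δ (k + 1)).app A ≫ (S.χ k ◫ S.δ k).app A := by
      have e0 : (S.proj k ◫ (S.proj k ◫ S.proj k)).app A =
          (S.proj k ◫ S.proj k).app (S.lim.obj A) ≫ (S.Q k ⋙ S.Q k).map ((S.proj k).app A) := rfl
      have n1 := (S.δ k).naturality ((S.proj k).app A)
      have n2 := (S.δ k).naturality ((S.χ k).app A)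
      rw [e0, reassoc_of% (hd (S.lim.obj A) k), ← n1, ← S.proj_χ_app k A, Functor.map_comp,
        Category.assoc, n2, reassoc_of% (hd' A (k + 1)), NatTrans.hcomp_app]
    rw [Category.assoc, Category.assoc]
    exact e1.trans ((congrArg _ (hS.coassoc k A)).trans e2.symm)
  · refine S.lim_hom_ext fun k => ?_
    have n1 : (e k).app (S.lim.obj A) ≫ (S.proj k).app A =
        (S.Q k).map ((S.proj k).app A) ≫ (e k).app ((S.Q k).obj A) :=
      ((e k).naturality ((S.proj k).app A)).symm
    change (d A ≫ (S.proj 0 ≫ e 0).app (S.lim.obj A)) ≫ (S.proj k).app A = _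
    rw [hc k, Category.assoc, Category.assoc, n1, reassoc_of% (hd' A k), hS.left_counit,
      proj_χ_app, Category.id_comp]
  · refine S.lim_hom_ext fun k => ?_
    change (d A ≫ S.lim.map ((S.proj 0 ≫ e 0).app A)) ≫ (S.proj k).app A = _
    have n1 : S.lim.map ((S.proj k).app A ≫ (e k).app A) ≫ (S.proj k).app A =
        (S.proj k).app (S.lim.obj A) ≫ (S.Q k).map ((S.proj k).app A ≫ (e k).app A) :=
      (S.proj k).naturality _
    rw [hc k, Category.assoc]
    refine (congrArg (fun t => d A ≫ t) n1).trans ?_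
    rw [Functor.map_comp, reassoc_of% (hd' A k), hS.right_counit, proj_χ_app, Category.id_comp]
    rfl
  · ext A
    exact hd A k

theorem Lawful.comonadStructure_unique {W W' : ComonadStructure S.lim}
    (hc : W.counit = W'.counit)
    (h : ∀ k, W.comult ≫ (S.proj k ◫ S.proj k) = S.proj (k + 1) ≫ S.δ k)
    (h' : ∀ k, W'.comult ≫ (S.proj k ◫ S.proj k) = S.proj (k + 1) ≫ S.δ k) : W = W' := by
  refine ComonadStructure.ext' hc ?_
  ext A
  exact hS.lim_lim_hom_ext fun k => congrArg (fun t => t.app A) ((h k).trans (h' k).symm)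

end Lawful

/-! ### Coalgebras over the limit of a tower -/

section Coalgebra

variable {S} {W : ComonadStructure S.lim}
  (hW : ∀ k, W.comult ≫ (S.proj k ◫ S.proj k) = S.proj (k + 1) ≫ S.δ k)
include hW

/-- A coalgebra over the limit of the tower has compatible structure maps for the `Q_k`. -/
theorem coacts_of_coalgebra {A : C} (a : A ⟶ S.lim.obj A)
    (ha : a ≫ W.comult.app A = a ≫ S.lim.map a) (k : ℕ) :
    S.Coacts k (a ≫ (S.proj k).app A) (a ≫ (S.proj (k + 1)).app A) where
  χ := by rw [Category.assoc, proj_χ_app]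
  δ := by
    have h1 : W.comult.app A ≫ (S.proj k).app (S.lim.obj A) ≫
        (S.Q k).map ((S.proj k).app A) = (S.proj (k + 1)).app A ≫ (S.δ k).app A :=
      congrArg (fun t => t.app A) (hW k)
    have n := (S.proj k).naturality a
    rw [Functor.map_comp, Category.assoc, Category.assoc, ← h1, reassoc_of% ha,
      reassoc_of% n]

/-- Compatibility climbs the tower. At level `k + 1` it is tested on `χ`, where it is the induction
hypothesis, and on `δ`, where the structure map has become the twofold iterate of the one at level
`k` and the hypothesis is applied twice. -/
theorem JointlyMono.map_comm (hS : S.JointlyMono) {A B : C} (a : A ⟶ S.lim.obj A)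
    (ha : a ≫ W.comult.app A = a ≫ S.lim.map a) (b : B ⟶ S.lim.obj B)
    (hb : b ≫ W.comult.app B = b ≫ S.lim.map b) (f : A ⟶ B)
    (hf : (a ≫ (S.proj 0).app A) ≫ (S.Q 0).map f = f ≫ b ≫ (S.proj 0).app B) :
    a ≫ S.lim.map f = f ≫ b := by
  have key (k : ℕ) :
      (a ≫ (S.proj k).app A) ≫ (S.Q k).map f = f ≫ b ≫ (S.proj k).app B := by
    induction k with
    | zero => exact hf
    | succ k ih =>
      have hA := coacts_of_coalgebra hW a ha k
      have hB := coacts_of_coalgebra hW b hb k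
      generalize a ≫ (S.proj k).app A = x at *
      generalize a ≫ (S.proj (k + 1)).app A = x' at *
      generalize b ≫ (S.proj k).app B = y at *
      generalize b ≫ (S.proj (k + 1)).app B = y' at *
      apply hS
      · rw [Category.assoc, Category.assoc, NatTrans.naturality, reassoc_of% hA.χ, hB.χ, ih]
      · have n := (S.δ k).naturality f
        rw [Category.assoc, Category.assoc, n, reassoc_of% hA.δ, hB.δ, ← reassoc_of% ih]
        rw [Functor.comp_map, ← Functor.map_comp, ih, Functor.map_comp]
  refine S.lim_hom_ext fun k => ?_
  have n := (S.proj k).naturality f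
  have := key k
  rw [Category.assoc] at this ⊢
  rw [n, this, Category.assoc]

/-- Compatible structure maps for the `Q_k` define a coalgebra over the limit. -/
theorem Lawful.exists_coalgebra {b : Prop} {e : ∀ k, S.Q k ⟶ 𝟭 C} (hS : S.Lawful b e)
    (hc : W.counit = S.proj 0 ≫ e 0) {A : C} (f : ∀ k, A ⟶ (S.Q k).obj A)
    (hf : ∀ k, S.Coacts k (f k) (f (k + 1))) (h0 : f 0 ≫ (e 0).app A = 𝟙 A) :
    ∃ a : A ⟶ S.lim.obj A, a ≫ W.counit.app A = 𝟙 A ∧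
      a ≫ W.comult.app A = a ≫ S.lim.map a ∧ a ≫ (S.proj 0).app A = f 0 := by
  obtain ⟨a, ha⟩ := S.lim_lift f fun k => (hf k).χ
  refine ⟨a, ?_, ?_, ha 0⟩
  · rw [hc, NatTrans.comp_app, reassoc_of% (ha 0), h0]
  · refine hS.lim_lim_hom_ext fun k => ?_
    have h1 : W.comult.app A ≫ (S.proj k ◫ S.proj k).app A =
        (S.proj (k + 1)).app A ≫ (S.δ k).app A := congrArg (fun t => t.app A) (hW k)
    have n := (S.proj k).naturality_assoc a ((S.Q k).map ((S.proj k).app A))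
    rw [Category.assoc, h1, reassoc_of% (ha (k + 1)), (hf k).δ, NatTrans.hcomp_app,
      Category.assoc, n, reassoc_of% (ha k), ← Functor.map_comp, ha]

end Coalgebra

end ComultTower

/-! ### The comultiplication tower generated by an initial stage -/

namespace Stage

variable {C : Type u₁} [Category.{v₁} C] [HasLimitsOfShape WalkingCospan C]
  [HasLimitsOfShape WalkingParallelPair C]

/-- The tower of all stages. -/
noncomputable def comultTower (S : Stage C) : ComultTower C where
  Q k := (S.iter k).prev
  χ k := (S.iter k).χ
  δ k := (S.iter k).δ

/-- The counits of the functors of the tower. -/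
noncomputable def counitAt (S : Stage C) (e : S.prev ⟶ 𝟭 C) : ∀ k, (S.iter k).prev ⟶ 𝟭 C
  | 0 => e
  | k + 1 => (S.iter k).χ ≫ counitAt S e k

theorem Lawful.iter {b : Prop} {S : Stage C} {e : S.prev ⟶ 𝟭 C} (hS : S.Lawful b e) :
    ∀ k, (S.iter k).Lawful b (S.counitAt e k)
  | 0 => hS
  | k + 1 => (hS.iter k).succ

theorem Lawful.comultTower {b : Prop} {S : Stage C} {e : S.prev ⟶ 𝟭 C} (hS : S.Lawful b e) :
    S.comultTower.Lawful b (S.counitAt e) where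
  good k := (hS.iter k).prev_good
  mono_χ hb k := (hS.iter k).mono_χ hb
  χ_counit _ := rfl
  left_counit k := (hS.iter k).left_counit
  right_counit k := (hS.iter k).right_counit
  χ_δ k := succ_χ_δ (S.iter k)
  coassoc k := succ_coassoc (S.iter k)

theorem Lawful.comultTower_jointlyMono {b : Prop} {S : Stage C} {e : S.prev ⟶ 𝟭 C}
    (hS : S.Lawful b e) : S.comultTower.JointlyMono :=
  fun k => (hS.iter k).jointlyMono

/-- A structure map for the first stage extends to the whole tower. -/
theorem exists_coacts (S : Stage C) {A : C} (f : A ⟶ S.prev.obj A)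
    (hf : ∃ g, S.Coacts f g) : ∃ h : ∀ k, A ⟶ (S.comultTower.Q k).obj A,
      h 0 = f ∧ ∀ k, S.comultTower.Coacts k (h k) (h (k + 1)) := by
  obtain ⟨g, hg⟩ := hf
  -- The recursion carries two consecutive structure maps with the proof of their compatibility,
  -- which is the input `coacts_succ` needs.
  let s : ∀ k, { p : (A ⟶ (S.iter k).prev.obj A) × (A ⟶ (S.iter k).next.obj A) //
      (S.iter k).Coacts p.1 p.2 } := fun k =>
    Nat.rec ⟨(f, g), hg⟩ (fun _ p => ⟨(p.1.2, (coacts_succ p.2).choose),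
      (coacts_succ p.2).choose_spec⟩) k
  exact ⟨fun k => (s k).1.1, rfl, fun k => ⟨(s k).2.χ, (s k).2.δ⟩⟩

end Stage

end CofreeCoalg

namespace CofreeCoalg

/-! ### Limits and monomorphisms in `V^X` -/

section Pi

variable {X : Type v} {V : Type u} [Category.{v} V]

/-- A cone in `V^X` is a limit cone if its components are. -/
def isLimitOfEval {J : Type u₁} [Category.{v₁} J] {F : J ⥤ (X → V)} (c : Cone F)
    (h : ∀ x, IsLimit ((Pi.eval (fun _ => V) x).mapCone c)) : IsLimit c where
  lift s x := (h x).lift ((Pi.eval (fun _ => V) x).mapCone s)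
  fac s j := by
    funext x
    exact (h x).fac ((Pi.eval (fun _ => V) x).mapCone s) j
  uniq s m w := by
    funext x
    exact (h x).uniq ((Pi.eval (fun _ => V) x).mapCone s) (m x) fun j => congrFun (w j) x

instance preservesLimitsOfShape_eval {J : Type u₁} [Category.{v₁} J] [HasLimitsOfShape J V]
    (x : X) : PreservesLimitsOfShape J (Pi.eval (fun _ : X => V) x) where
  preservesLimit {F} := by
    let c : Cone F :=
      { pt := fun x => limit (F ⋙ Pi.eval (fun _ => V) x)
        π :=
          { app := fun j x => limit.π (F ⋙ Pi.eval (fun _ => V) x) j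
            naturality := fun i j f => by
              funext x
              exact (limit.cone (F ⋙ Pi.eval (fun _ => V) x)).π.naturality f } }
    have h (x) : IsLimit ((Pi.eval (fun _ => V) x).mapCone c) :=
      limit.isLimit (F ⋙ Pi.eval (fun _ => V) x)
    exact preservesLimit_of_preserves_limit_cone (isLimitOfEval c h) (h x)

theorem mono_of_eval {A B : X → V} (f : A ⟶ B) (h : ∀ x, Mono (f x)) : Mono f where
  right_cancellation u v e := by
    funext x
    exact (cancel_mono (f x)).1 (congrFun e x)

theorem TowerGood.pi {b : Prop} {C : Type u₁} [Category.{v₁} C] {F : X → C ⥤ V}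
    (h : ∀ x, TowerGood b (F x)) : TowerGood b (Functor.pi' F) where
  map_mono hb _ _ f hf := mono_of_eval _ fun x => (h x).map_mono hb f hf
  preserves K hK := ⟨fun {c} hc => ⟨isLimitOfEval _ fun x => by
    have := (h x).preserves K hK
    exact isLimitOfPreserves (F x) hc⟩⟩

end Pi

/-! ### Tensor powers preserve countable intersections -/

section Tensor

variable {C : Type u₁} [Category.{v₁} C]

/-- The index category of a tower is connected: all legs of a cone over a constant tower coincide,
and the leg at `0` is the lift. -/
theorem TowerGood.const {D : Type u₂} [Category.{v₂} D] (b : Prop) (A : D) :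
    TowerGood b ((Functor.const C).obj A) where
  map_mono _ _ _ _ _ := inferInstanceAs (Mono (𝟙 A))
  preserves K hK := ⟨fun {c} hc => ⟨
    { lift := fun s => s.π.app (op 0)
      fac := fun s j => by
        have h := s.w (homOfLE (Nat.zero_le j.unop)).op
        refine (Category.comp_id _).trans (h.symm.trans ?_)
        exact Category.comp_id _
      uniq := fun s m hm => (Category.comp_id m).symm.trans (hm (op 0)) }⟩⟩

theorem TowerGood.of_iso {D : Type u₂} [Category.{v₂} D] {b : Prop} {F G : C ⥤ D} (i : F ≅ G)
    (hF : TowerGood b F) : TowerGood b G where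
  map_mono hb A B f hf := by
    have := hF.map_mono hb f hf
    have e : G.map f = i.inv.app A ≫ F.map f ≫ i.hom.app B := by simp
    rw [e]
    infer_instance
  preserves K hK := by
    have := hF.preserves K hK
    exact preservesLimit_of_natIso K i

variable {V : Type u} [Category.{v} V] [MonoidalCategory V] [SymmetricCategory V] {b : Prop}
  (hV : ∀ A : V, TowerGood b (tensorLeft A))
include hV

theorem towerGood_tensorRight (A : V) : TowerGood b (tensorRight A) :=
  (hV A).of_iso (BraidedCategory.tensorLeftIsoTensorRight A)

theorem mono_tensorHom (hb : b) {A B A' B' : V} (f : A ⟶ B) (g : A' ⟶ B') (hf : Mono f)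
    (hg : Mono g) : Mono (f ⊗ₘ g) := by
  have h1 : Mono (f ▷ A') := (towerGood_tensorRight hV A').map_mono hb f hf
  have h2 : Mono (B ◁ g) := (hV B).map_mono hb g hg
  rw [MonoidalCategory.tensorHom_def]
  exact mono_comp _ _

/-- Preservation in each variable separately becomes preservation along the diagonal by `diag_lift`
and `diag_hom_ext`, applied to the bifunctor `⊗`. When `b` holds, `F` and `G` keep the towers monic,
as the hypothesis on `⊗` demands. -/
theorem TowerGood.tensor {F G : C ⥤ V} (hF : TowerGood b F) (hG : TowerGood b G) :
    TowerGood b (F.prod' G ⋙ MonoidalCategory.tensor V) where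
  map_mono hb _ _ f hf := mono_tensorHom hV hb _ _ (hF.map_mono hb f hf) (hG.map_mono hb f hf)
  preserves K hK := ⟨fun {c} hc => by
    have := hF.preserves K hK
    have := hG.preserves K hK
    have h₂ (n : ℕᵒᵖ) : Nonempty (IsLimit (((curriedTensor V).obj ((K ⋙ F).obj n)).mapCone
        (G.mapCone c))) := by
      have := (hV (F.obj (K.obj n))).preserves (K ⋙ G)
        (fun f hb => hG.map_mono hb _ (hK f hb))
      exact ⟨isLimitOfPreserves (tensorLeft (F.obj (K.obj n))) (isLimitOfPreserves G hc)⟩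
    have h₁ : Nonempty (IsLimit (((curriedTensor V).flip.obj (G.mapCone c).pt).mapCone
        (F.mapCone c))) := by
      have := (towerGood_tensorRight hV (G.obj c.pt)).preserves (K ⋙ F)
        (fun f hb => hF.map_mono hb _ (hK f hb))
      exact ⟨isLimitOfPreserves (tensorRight (G.obj c.pt)) (isLimitOfPreserves F hc)⟩
    have hd (n : ℕᵒᵖ) : diagProj (curriedTensor V) (F.mapCone c) (G.mapCone c) n n =
        (F.map (c.π.app n) ⊗ₘ G.map (c.π.app n)) := (MonoidalCategory.tensorHom_def _ _).symm
    have key (s : Cone (K ⋙ F.prod' G ⋙ MonoidalCategory.tensor V)) :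
        ∃ t : s.pt ⟶ F.obj c.pt ⊗ G.obj c.pt,
          ∀ n, t ≫ (F.map (c.π.app n) ⊗ₘ G.map (c.π.app n)) = s.π.app n := by
      obtain ⟨t, ht⟩ := diag_lift (curriedTensor V) (fun n => (h₂ n).some) h₁.some
        (fun n => s.π.app n) (fun {n m} f => by
          refine Eq.trans ?_ (s.w f)
          exact congrArg (fun k => s.π.app n ≫ k) (MonoidalCategory.tensorHom_def _ _).symm)
      exact ⟨t, fun n => (congrArg (fun k => t ≫ k) (hd n).symm).trans (ht n)⟩
    choose t ht using key
    refine ⟨t, ht, fun s m hm => ?_⟩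
    refine diag_hom_ext (curriedTensor V) (fun n => (h₂ n).some) h₁.some fun n => ?_
    refine (congrArg (fun k => m ≫ k) (hd n)).trans
      (Eq.trans ?_ (congrArg (fun k => t s ≫ k) (hd n)).symm)
    exact (hm n).trans (ht s n).symm⟩

variable [HasLimits V] {X : Type v}

/-- A tensor power is built from evaluations, which preserve limits, the constant functor at the
unit, and binary tensor products. -/
theorem towerGood_power_eval (z : SymSeq X) :
    TowerGood b (power X V ⋙ (evaluation (SymSeq X) V).obj z) := by
  induction z with
  | of x =>
    exact (TowerGood.of_preservesLimits : TowerGood b (Pi.eval (fun _ : X => V) x.as))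
  | unit => exact TowerGood.const b (𝟙_ V)
  | mul a c ha hc => exact TowerGood.tensor hV ha hc

theorem towerGood_power : TowerGood b (power X V) where
  map_mono hb _ _ f hf := by
    have := fun z => (towerGood_power_eval hV z).map_mono hb f hf
    exact @NatTrans.mono_of_mono_app _ _ _ _ _ _ _ this
  preserves K hK := preservesLimit_of_evaluation _ _ fun z =>
    (towerGood_power_eval hV z).preserves K hK

end Tensor

/-! ### The co-analytic functors preserve countable intersections -/

section HomEnd

variable {V : Type u} [Category.{v} V] [MonoidalCategory V] [MonoidalClosed V] [HasLimits V]
  {J : Type v} [Category.{v} J]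

/-- `homEnd N` is right adjoint to `A ↦ (j ↦ N j ⊗ A)`. -/
noncomputable def homEndAdj (N : J ⥤ V) : (curriedTensor V).flip ⋙
    (Functor.whiskeringLeft J V V).obj N ⊣ homEnd N :=
  Adjunction.mkOfHomEquiv
    { homEquiv := fun A K =>
        { toFun := fun η => homEndLift N K (fun j => η.app j) (fun f => η.naturality f)
          invFun := fun f =>
            { app := fun j => N.obj j ◁ f ≫ homEndEv N K j
              naturality := fun i j g => by
                have h := homEndEv_naturality N K g
                change N.map g ▷ A ≫ N.obj j ◁ f ≫ homEndEv N K j = _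
                rw [← whisker_exchange_assoc, h, Category.assoc] }
          left_inv := fun η => by
            ext j
            exact homEndLift_ev _ _ _ _ _
          right_inv := fun f => homEnd_ext _ _ fun j => homEndLift_ev _ _ _ _ _ }
      homEquiv_naturality_left_symm := fun f g => by
        ext j
        change N.obj j ◁ (f ≫ g) ≫ _ = N.obj j ◁ f ≫ N.obj j ◁ g ≫ _
        rw [whiskerLeft_comp, Category.assoc]
      homEquiv_naturality_right := fun f g => homEnd_ext _ _ fun j => by
        refine (homEndLift_ev N _ (fun j => (f ≫ g).app j) (fun k => (f ≫ g).naturality k)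
          j).trans ?_
        refine Eq.trans ?_ (whiskerLeft_comp_assoc _ _ _ _).symm
        refine Eq.trans ?_ (congrArg (fun k => _ ≫ k) (homEndEv_map N g j)).symm
        refine Eq.trans ?_ (Category.assoc _ _ _)
        exact (congrArg (fun k => k ≫ g.app j)
          (homEndLift_ev N _ (fun j => f.app j) (fun k => f.naturality k) j)).symm }

/-- A right adjoint preserves all limits, and monomorphisms because it preserves pullbacks; hence
`b` plays no role here. -/
theorem towerGood_homEnd (b : Prop) (N : J ⥤ V) : TowerGood b (homEnd N) where
  map_mono _ _ _ f hf := by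
    have : PreservesLimitsOfShape WalkingCospan (homEnd N) :=
      (Adjunction.rightAdjoint_preservesLimits.{0, 0} (homEndAdj N)).preservesLimitsOfShape
    infer_instance
  preserves _ _ :=
    (Adjunction.rightAdjoint_preservesLimits.{0, 0} (homEndAdj N))
      |>.preservesLimitsOfShape.preservesLimit

end HomEnd

section Coanalytic

variable {X : Type v} {V : Type u} [Category.{v} V] [MonoidalCategory V] [SymmetricCategory V]
  [MonoidalClosed V] [HasLimits V] {b : Prop} (hV : ∀ A : V, TowerGood b (tensorLeft A))
  (P : Distributor X V)
include hV

theorem towerGood_coanalytic : TowerGood b (coanalytic P) :=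
  TowerGood.pi fun y => (towerGood_power hV).comp (towerGood_homEnd b (P.at ⟨y⟩))

theorem towerGood_coanalytic₂ : TowerGood b (coanalytic₂ P) :=
  TowerGood.pi fun y => (towerGood_power hV).comp
    (TowerGood.of_preservesLimits.comp (towerGood_homEnd b (P.two ⟨y⟩)))

end Coanalytic

/-! ### The cartesian case -/

/-- A product with `A` commutes with limits of connected shape: the `A`-components of a cone over a
tower all agree, and the other components form a cone over `F`. No map need be monic, whence the
choice `False`. -/
theorem towerGood_of_isCartesian {V : Type u} [Category.{v} V] [MonoidalCategory V]
    (h : IsCartesian V) (A : V) : TowerGood False (tensorLeft A) where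
  map_mono hb := hb.elim
  preserves F _ := ⟨fun {c} hc => by
    obtain ⟨t, ht⟩ := h
    let p (B : V) : A ⊗ B ⟶ A := A ◁ t.from B ≫ (ρ_ A).hom
    let q (B : V) : A ⊗ B ⟶ B := t.from A ▷ B ≫ (λ_ B).hom
    have hp {B B' : V} (f : B ⟶ B') : A ◁ f ≫ p B' = p B := by
      rw [← whiskerLeft_comp_assoc, t.hom_ext (f ≫ t.from B') (t.from B)]
    have hq {B B' : V} (f : B ⟶ B') : A ◁ f ≫ q B' = q B ≫ f := by
      simp only [q]
      rw [whisker_exchange_assoc, leftUnitor_naturality, Category.assoc]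
    have hext {Z B : V} (f g : Z ⟶ A ⊗ B) (h1 : f ≫ p B = g ≫ p B) (h2 : f ≫ q B = g ≫ q B) :
        f = g := BinaryFan.IsLimit.hom_ext (ht A B).some h1 h2
    have hlift {Z B : V} (f : Z ⟶ A) (g : Z ⟶ B) : ∃ k : Z ⟶ A ⊗ B, k ≫ p B = f ∧ k ≫ q B = g :=
      ⟨(BinaryFan.IsLimit.lift' (ht A B).some f g).1,
        (BinaryFan.IsLimit.lift' (ht A B).some f g).2⟩
    have key (s : Cone (F ⋙ tensorLeft A)) :
        ∃ k : s.pt ⟶ A ⊗ c.pt, ∀ j, k ≫ A ◁ c.π.app j = s.π.app j := by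
      let s' : Cone F :=
        { pt := s.pt
          π :=
            { app := fun j => s.π.app j ≫ q (F.obj j)
              naturality := fun i j f => by
                have e : s.π.app i ≫ A ◁ F.map f = s.π.app j := s.w f
                refine (Category.id_comp _).trans ?_
                rw [Category.assoc, ← hq, reassoc_of% e] } }
      -- The common `A`-component is read off at index `0`, to which every other index maps.
      obtain ⟨k, h1, h2⟩ := hlift (s.π.app (op 0) ≫ p (F.obj (op 0))) (hc.lift s')
      refine ⟨k, fun j => hext _ _ ?_ ?_⟩
      · have e : s.π.app j ≫ A ◁ F.map (homOfLE (Nat.zero_le j.unop)).op = s.π.app (op 0) :=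
          s.w _
        have hc' := hp (c.π.app j)
        rw [Category.assoc]
        refine (congrArg (fun x => k ≫ x) hc').trans (h1.trans ?_)
        rw [← e, Category.assoc, hp]
      · have hc' := hq (c.π.app j)
        rw [Category.assoc]
        refine (congrArg (fun x => k ≫ x) hc').trans ?_
        refine (Category.assoc _ _ _).symm.trans ?_
        exact (congrArg (fun x => x ≫ c.π.app j) h2).trans (hc.fac s' j)
    choose k hk using key
    refine ⟨k, hk, fun s m hm => hext _ _ ?_ ?_⟩
    · have e := (hm (op 0)).trans (hk s (op 0)).symm
      have hc' := hp (c.π.app (op 0))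
      refine (congrArg (fun x => m ≫ x) hc'.symm).trans
        (Eq.trans ?_ (congrArg (fun x => k s ≫ x) hc'))
      exact (Category.assoc _ _ _).symm.trans
        ((congrArg (fun x => x ≫ p _) e).trans (Category.assoc _ _ _))
    · refine hc.hom_ext fun j => ?_
      have e := (hm j).trans (hk s j).symm
      have hc' := hq (c.π.app j)
      refine (Category.assoc _ _ _).trans (Eq.trans ?_ (Category.assoc _ _ _).symm)
      refine (congrArg (fun x => m ≫ x) hc'.symm).trans
        (Eq.trans ?_ (congrArg (fun x => k s ≫ x) hc'))
      exact (Category.assoc _ _ _).symm.trans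
        ((congrArg (fun x => x ≫ q _) e).trans (Category.assoc _ _ _))⟩

end CofreeCoalg

namespace CofreeCoalg

/-! ### The maps `[A, A'] ⊗ [B, B'] ⟶ [A ⊗ B, A' ⊗ B']` for families -/

section HomTensor

/-- Restricted to the summand `A j`, the transpose of `m` is evaluation of the `j`-th factor
followed by the coprojection of `A' j`. Since that coprojection is monic, the `j`-th factor can be
recovered. -/
theorem mono_pi_ihom_to_ihom_sigma {V : Type u} [Category.{v} V] [MonoidalCategory V]
    [MonoidalClosed V] [HasCoproducts.{v} V] [HasLimits V] {J : Type v} (A A' : J → V) (h : ∀ j, Mono (Sigma.ι A' j))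
    (m : (∏ᶜ fun j => (ihom (A j)).obj (A' j)) ⟶ (ihom (∐ A)).obj (∐ A'))
    (hm : ∀ j, Sigma.ι A j ▷ _ ≫ MonoidalClosed.uncurry m =
        A j ◁ Pi.π (fun j => (ihom (A j)).obj (A' j)) j ≫ (ihom.ev (A j)).app (A' j) ≫
          Sigma.ι A' j) : Mono m where
  right_cancellation u w e := by
    refine Limits.Pi.hom_ext _ _ fun j => ?_
    apply MonoidalClosed.uncurry_injective
    have := h j
    rw [← cancel_mono (Sigma.ι A' j), MonoidalClosed.uncurry_eq, MonoidalClosed.uncurry_eq]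
    have e' := congrArg (fun k => Sigma.ι A j ▷ _ ≫ MonoidalClosed.uncurry k) e
    simp only [MonoidalClosed.uncurry_natural_left] at e'
    rw [← whisker_exchange_assoc, ← whisker_exchange_assoc, hm] at e'
    simpa using e'

variable {V : Type u} [Category.{v} V] [MonoidalCategory V] [SymmetricCategory V]
  [MonoidalClosed V]

theorem uncurry_comp_homTensor {A A' B B' Z : V}
    (x : Z ⟶ (ihom A).obj A' ⊗ (ihom B).obj B') :
    MonoidalClosed.uncurry (x ≫ homTensor A A' B B') = (A ⊗ B) ◁ x ≫
      tensorμ A B ((ihom A).obj A') ((ihom B).obj B') ≫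
        ((ihom.ev A).app A' ⊗ₘ (ihom.ev B).app B') := by
  rw [MonoidalClosed.uncurry_natural_left, homTensor, MonoidalClosed.uncurry_curry]

theorem uncurry_tensorHom_homTensor {A A' B B' Y Z : V} (f : Y ⟶ (ihom A).obj A')
    (g : Z ⟶ (ihom B).obj B') :
    MonoidalClosed.uncurry ((f ⊗ₘ g) ≫ homTensor A A' B B') =
      tensorμ A B Y Z ≫ (MonoidalClosed.uncurry f ⊗ₘ MonoidalClosed.uncurry g) := by
  rw [uncurry_comp_homTensor, tensorμ_natural_right_assoc, tensorHom_comp_tensorHom,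
    MonoidalClosed.uncurry_eq, MonoidalClosed.uncurry_eq]

section Coproducts

variable [HasCoproducts.{v} V]

/-- Tensoring is a left adjoint, so tensored coprojections remain jointly epic. The braiding moves
the coproduct to the side on which the closed structure curries. -/
theorem sigma_tensor_hom_ext {J : Type v} {A : J → V} {Z W : V} {f g : (∐ A) ⊗ Z ⟶ W}
    (h : ∀ j, Sigma.ι A j ▷ Z ≫ f = Sigma.ι A j ▷ Z ≫ g) : f = g := by
  rw [← cancel_epi (β_ Z (∐ A)).hom]
  apply MonoidalClosed.curry_injective
  refine Sigma.hom_ext _ _ fun j => ?_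
  rw [← MonoidalClosed.curry_natural_left, ← MonoidalClosed.curry_natural_left,
    BraidedCategory.braiding_naturality_right_assoc,
    BraidedCategory.braiding_naturality_right_assoc, h]

theorem sigma_tensor_sigma_tensor_hom_ext {J K : Type v} {A : J → V} {B : K → V} {Z W : V}
    {f g : ((∐ A) ⊗ (∐ B)) ⊗ Z ⟶ W}
    (h : ∀ j k, (Sigma.ι A j ⊗ₘ Sigma.ι B k) ▷ Z ≫ f = (Sigma.ι A j ⊗ₘ Sigma.ι B k) ▷ Z ≫ g) :
    f = g := by
  rw [← cancel_epi (α_ (∐ A) (∐ B) Z).inv]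
  refine sigma_tensor_hom_ext fun j => ?_
  apply MonoidalClosed.curry_injective
  refine sigma_tensor_hom_ext fun k => ?_
  rw [← MonoidalClosed.curry_natural_left, ← MonoidalClosed.curry_natural_left]
  have e : A j ◁ Sigma.ι B k ▷ Z ≫ Sigma.ι A j ▷ ((∐ B) ⊗ Z) ≫ (α_ (∐ A) (∐ B) Z).inv =
      (α_ (A j) (B k) Z).inv ≫ (Sigma.ι A j ⊗ₘ Sigma.ι B k) ▷ Z := by
    rw [MonoidalCategory.tensorHom_def']
    simp
  rw [reassoc_of% e, reassoc_of% e, h]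

variable [HasLimits V]

/-- A product of internal homs maps to the internal hom of the coproducts. -/
theorem exists_pi_ihom_to_ihom_sigma {J : Type v} (A A' : J → V) :
    ∃ m : (∏ᶜ fun j => (ihom (A j)).obj (A' j)) ⟶ (ihom (∐ A)).obj (∐ A'),
      ∀ j, Sigma.ι A j ▷ _ ≫ MonoidalClosed.uncurry m =
        A j ◁ Pi.π (fun j => (ihom (A j)).obj (A' j)) j ≫ (ihom.ev (A j)).app (A' j) ≫
          Sigma.ι A' j := by
  refine ⟨MonoidalClosed.curry ((β_ _ _).hom ≫ MonoidalClosed.uncurry (Sigma.desc fun j =>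
    MonoidalClosed.curry ((β_ _ _).hom ≫ A j ◁ Pi.π (fun j => (ihom (A j)).obj (A' j)) j ≫
      (ihom.ev (A j)).app (A' j) ≫ Sigma.ι A' j))), fun j => ?_⟩
  rw [MonoidalClosed.uncurry_curry, BraidedCategory.braiding_naturality_left_assoc,
    ← MonoidalClosed.uncurry_natural_left, Sigma.ι_desc, MonoidalClosed.uncurry_curry,
    SymmetricCategory.symmetry_assoc]

/-- Products of internal homs embed in `[∐ A, ∐ A']` and `[∐ B, ∐ B']`. The tensor product of these
embeddings followed by `homTensor` for the four coproducts is monic. On the summand `(j, k)` this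
composite depends only on the `(j, k)`-component of the family map, so the family map is monic too.
-/
theorem familyHomTensorMono_of_monicCoproducts {b : Prop} (hb : b)
    (hV : ∀ A : V, TowerGood b (tensorLeft A)) (h : HomTensorMono V)
    (hι : ∀ (K : Type v) (B : K → V) (k : K), Mono (Sigma.ι B k)) : FamilyHomTensorMono V := by
  intro J K A A' B B'
  obtain ⟨m, hm⟩ := exists_pi_ihom_to_ihom_sigma A A'
  obtain ⟨n, hn⟩ := exists_pi_ihom_to_ihom_sigma B B'
  have hmm := mono_pi_ihom_to_ihom_sigma A A' (hι _ _) m hm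
  have hnn := mono_pi_ihom_to_ihom_sigma B B' (hι _ _) n hn
  have h1 := mono_tensorHom hV hb m n hmm hnn
  have h2 := h (∐ A) (∐ A') (∐ B) (∐ B')
  refine ⟨fun u w e => ?_⟩
  rw [← cancel_mono (m ⊗ₘ n), ← cancel_mono (homTensor (∐ A) (∐ A') (∐ B) (∐ B'))]
  apply MonoidalClosed.uncurry_injective
  refine sigma_tensor_sigma_tensor_hom_ext fun j k => ?_
  have e' := congrArg (fun t => MonoidalClosed.uncurry (t ≫ Pi.π (fun p : J × K =>
    (ihom (A p.1 ⊗ B p.2)).obj (A' p.1 ⊗ B' p.2)) (j, k))) e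
  simp only [Category.assoc, limit.lift_π, Fan.mk_π_app] at e'
  rw [MonoidalClosed.uncurry_natural_left, uncurry_tensorHom_homTensor,
    MonoidalClosed.uncurry_natural_left, uncurry_tensorHom_homTensor] at e'
  have key {Z : V} (x : Z ⟶ (∏ᶜ fun j => (ihom (A j)).obj (A' j)) ⊗
      (∏ᶜ fun k => (ihom (B k)).obj (B' k))) :
      (Sigma.ι A j ⊗ₘ Sigma.ι B k) ▷ Z ≫ MonoidalClosed.uncurry ((x ≫ (m ⊗ₘ n)) ≫
        homTensor (∐ A) (∐ A') (∐ B) (∐ B')) =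
      ((A j ⊗ B k) ◁ x ≫ tensorμ _ _ _ _ ≫
        (MonoidalClosed.uncurry (Pi.π (fun j => (ihom (A j)).obj (A' j)) j) ⊗ₘ
          MonoidalClosed.uncurry (Pi.π (fun k => (ihom (B k)).obj (B' k)) k))) ≫
        (Sigma.ι A' j ⊗ₘ Sigma.ι B' k) := by
    rw [Category.assoc, MonoidalClosed.uncurry_natural_left, uncurry_tensorHom_homTensor,
      ← whisker_exchange_assoc, tensorμ_natural_left_assoc, tensorHom_comp_tensorHom, hm, hn]
    simp [MonoidalClosed.uncurry_eq]
  rw [key, key, e']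

end Coproducts

end HomTensor

/-! ### The lax structure is a monomorphism -/

section LaxMono

variable {X : Type v}

open FreeSym in
/-- Choices of a word of inputs for each letter of a word. -/
def Choice : SymSeq X → Type v
  | of _ => SymSeq X
  | unit => PUnit
  | mul a b => Choice a × Choice b

open FreeSym in
/-- The word of vertices determined by a choice. -/
def Choice.word : ∀ {z : SymSeq X}, Choice z → FreeSym (Vert X)
  | of x, c => of (x, c)
  | unit, _ => unit
  | mul _ _, c => mul (word c.1) (word c.2)

open FreeSym in
/-- The word of outputs of a choice is the given word. -/
def Choice.tgtIso : ∀ {z : SymSeq X} (c : Choice z), (tgt X).obj c.word ≅ z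
  | of _, _ => Iso.refl _
  | unit, _ => Iso.refl (𝟙_ (SymSeq X))
  | mul _ _, c => MonoidalCategory.tensorIso (tgtIso c.1) (tgtIso c.2)

variable {V : Type u} [Category.{v} V] [MonoidalCategory V] [SymmetricCategory V]

theorem twoStep_cancel {P T A B C : V} {φ φ' : P ⊗ A ⟶ B} {ψ : T ⊗ B ⟶ C}
    (h : twoStep φ ψ = twoStep φ' ψ) : T ◁ φ ≫ ψ = T ◁ φ' ≫ ψ := by
  unfold twoStep at h
  rw [cancel_epi, cancel_epi] at h
  exact h

variable [MonoidalClosed V]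

/-- The components of `tensAct` at the words with outputs `z`. -/
noncomputable def choiceMap (P : Distributor X V) {B C : X → V}
    (θ : ∀ p : Vert X, P.obj p ⊗ B p.1.as ⟶ ((power X V).obj C).obj p.2) {z : SymSeq X}
    (c : Choice z) : ((power X V).obj B).obj z ⟶
      (ihom (P.tens.obj c.word)).obj (((power X V).obj C).obj ((src X).obj c.word)) :=
  MonoidalClosed.curry (P.tens.obj c.word ◁ ((power X V).obj B).map c.tgtIso.inv ≫
    tensAct P θ c.word)

/-- Acting on a concatenation is the tensor product of the actions after `tensorμ`, and `homTensor`
is the transpose of that operation. This is how `homTensor` enters the study of `α`. -/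
theorem choiceMap_mul (P : Distributor X V) {B C : X → V}
    (θ : ∀ p : Vert X, P.obj p ⊗ B p.1.as ⟶ ((power X V).obj C).obj p.2) {z z' : SymSeq X}
    (c : Choice z) (c' : Choice z') :
    choiceMap P θ (z := FreeSym.mul z z') (c, c') =
      (choiceMap P θ c ⊗ₘ choiceMap P θ c') ≫ homTensor _ _ _ _ := by
  apply MonoidalClosed.uncurry_injective
  refine Eq.trans ?_ (uncurry_tensorHom_homTensor _ _).symm
  refine (MonoidalClosed.uncurry_curry _).trans ?_
  have e : ((power X V).obj B).map (Choice.tgtIso (z := FreeSym.mul z z') (c, c')).inv =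
      (((power X V).obj B).map c.tgtIso.inv ⊗ₘ ((power X V).obj B).map c'.tgtIso.inv) :=
    FreeSym.lift_map_tensor _ _ _
  refine (congrArg (fun k => _ ◁ k ≫ _) e).trans ?_
  refine (tensorμ_natural_right_assoc _ _ _ _ _).trans ?_
  refine congrArg (fun k => tensorμ _ _ _ _ ≫ k) ?_
  refine (tensorHom_comp_tensorHom _ _ _ _).trans ?_
  exact (congrArg₂ (fun p q => p ⊗ₘ q) (MonoidalClosed.uncurry_curry _)
    (MonoidalClosed.uncurry_curry _)).symm

/-- The maps indexed by all choices of input words are jointly monic, by induction on `z`. For a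
concatenation the two induction hypotheses give monomorphisms into products over choices, their
tensor product is monic, and `FamilyHomTensorMono` separates the result. The form for families is
needed because choices for the two halves vary independently. -/
theorem choiceMap_hom_ext [HasLimits V] {b : Prop} (hb : b)
    (hV : ∀ A : V, TowerGood b (tensorLeft A)) (hF : FamilyHomTensorMono V)
    (P : Distributor X V) {B C : X → V}
    (θ : ∀ p : Vert X, P.obj p ⊗ B p.1.as ⟶ ((power X V).obj C).obj p.2)
    (hθ : ∀ (x : Discrete X) {Z : V} (f g : Z ⟶ B x.as),
      (∀ z, P.obj (x, z) ◁ f ≫ θ (x, z) = P.obj (x, z) ◁ g ≫ θ (x, z)) → f = g)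
    (z : SymSeq X) {Z : V} (f g : Z ⟶ ((power X V).obj B).obj z)
    (h : ∀ c : Choice z, f ≫ choiceMap P θ c = g ≫ choiceMap P θ c) : f = g := by
  induction z generalizing Z with
  | of x =>
    refine hθ x f g fun z => ?_
    have e := congrArg MonoidalClosed.uncurry (h z)
    have hc : choiceMap P θ (z := FreeSym.of x) z = MonoidalClosed.curry (θ (x, z)) := by
      refine congrArg MonoidalClosed.curry ?_
      have : ((power X V).obj B).map (Choice.tgtIso (z := FreeSym.of x) z).inv =
        𝟙 (B x.as) := ((power X V).obj B).map_id _
      refine (congrArg (fun k => P.obj (x, z) ◁ k ≫ θ (x, z)) this).trans ?_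
      exact (congrArg (fun k => k ≫ θ (x, z)) (whiskerLeft_id _ _)).trans (Category.id_comp _)
    rw [hc] at e
    refine Eq.trans ?_ (e.trans ?_)
    · refine Eq.trans ?_ (MonoidalClosed.uncurry_natural_left _ _).symm
      exact congrArg (fun k => _ ≫ k) (MonoidalClosed.uncurry_curry _).symm
    · refine (MonoidalClosed.uncurry_natural_left _ _).trans ?_
      exact congrArg (fun k => _ ≫ k) (MonoidalClosed.uncurry_curry _)
  | unit =>
    let c : Choice (FreeSym.unit : SymSeq X) := PUnit.unit
    have e := congrArg MonoidalClosed.uncurry (h c)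
    have hc : choiceMap P θ c =
        MonoidalClosed.curry (λ_ (𝟙_ V)).hom := by
      refine congrArg MonoidalClosed.curry ?_
      have : ((power X V).obj B).map c.tgtIso.inv =
        𝟙 (𝟙_ V) := ((power X V).obj B).map_id _
      refine (congrArg (fun k => 𝟙_ V ◁ k ≫ (λ_ (𝟙_ V)).hom) this).trans ?_
      exact (congrArg (fun k => k ≫ (λ_ (𝟙_ V)).hom) (whiskerLeft_id _ _)).trans
        (Category.id_comp _)
    rw [hc] at e
    have e' : 𝟙_ V ◁ f ≫ (λ_ (𝟙_ V)).hom = 𝟙_ V ◁ g ≫ (λ_ (𝟙_ V)).hom := by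
      refine Eq.trans ?_ (e.trans ?_)
      · refine Eq.trans ?_ (MonoidalClosed.uncurry_natural_left _ _).symm
        exact congrArg (fun k => _ ≫ k) (MonoidalClosed.uncurry_curry _).symm
      · refine (MonoidalClosed.uncurry_natural_left _ _).trans ?_
        exact congrArg (fun k => _ ≫ k) (MonoidalClosed.uncurry_curry _)
    have e'' := (leftUnitor_naturality f).symm.trans (e'.trans (leftUnitor_naturality g))
    exact (cancel_epi (λ_ Z).hom).1 e''
  | mul a a' ha ha' =>
    -- The induction hypothesis says that the map into the product over all choices for `a` is
    -- monic.
    let m := Pi.lift (fun c : Choice a => choiceMap P θ c)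
    let m' := Pi.lift (fun c : Choice a' => choiceMap P θ c)
    have hm : Mono m := ⟨fun u w e => ha _ _ fun c => by
      simpa [m] using congrArg (fun k => k ≫ Pi.π _ c) e⟩
    have hm' : Mono m' := ⟨fun u w e => ha' _ _ fun c => by
      simpa [m'] using congrArg (fun k => k ≫ Pi.π _ c) e⟩
    have h1 := mono_tensorHom hV hb m m' hm hm'
    have h2 := hF (Choice a) (Choice a') (fun c => P.tens.obj c.word)
      (fun c => ((power X V).obj C).obj ((src X).obj c.word)) (fun c => P.tens.obj c.word)
      (fun c => ((power X V).obj C).obj ((src X).obj c.word))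
    refine (cancel_mono (m ⊗ₘ m')).1 ?_
    refine h2.right_cancellation _ _ (Limits.Pi.hom_ext _ _ fun c => ?_)
    have e := h c
    have hq : (m ⊗ₘ m') ≫ (Pi.π _ c.1 ⊗ₘ Pi.π _ c.2) ≫ homTensor (P.tens.obj c.1.word)
        (((power X V).obj C).obj ((src X).obj c.1.word)) (P.tens.obj c.2.word)
        (((power X V).obj C).obj ((src X).obj c.2.word)) =
        choiceMap P θ (z := FreeSym.mul a a') c := by
      refine Eq.trans ?_ (choiceMap_mul P θ c.1 c.2).symm
      refine (tensorHom_comp_tensorHom_assoc _ _ _ _ _).trans ?_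
      refine congrArg (fun k => k ≫ _) ?_
      exact congrArg₂ (fun k l => k ⊗ₘ l) (limit.lift_π _ _) (limit.lift_π _ _)
    refine (Category.assoc _ _ _).trans ?_
    refine Eq.trans ?_ (Category.assoc _ _ _).symm
    refine (congrArg (fun k => (f ≫ (m ⊗ₘ m')) ≫ k) (limit.lift_π _ _)).trans ?_
    refine Eq.trans ?_ (congrArg (fun k => (g ≫ (m ⊗ₘ m')) ≫ k) (limit.lift_π _ _)).symm
    refine (Category.assoc _ _ _).trans ((congrArg (fun k => f ≫ k) hq).trans (e.trans ?_))
    exact (congrArg (fun k => g ≫ k) hq).symm.trans (Category.assoc _ _ _).symm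

variable [HasLimits V]

/-- The evaluation of `α` at a word of vertices. -/
theorem laxMap_ev (P : Distributor X V) {C : X → V} {y : X} {A : V}
    (g : A ⟶ (coanalytic P).obj ((coanalytic P).obj C) y) (e : FreeSym (Vert X)) :
    (P.two ⟨y⟩).obj e ◁ (g ≫ (laxMap P).app C y) ≫
      homEndEv (P.two ⟨y⟩) (src X ⋙ (power X V).obj C) e =
    twoStep ((P.at ⟨y⟩).obj ((tgt X).obj e) ◁ g ≫
      coanalyticEv P ((coanalytic P).obj C) (⟨y⟩, (tgt X).obj e))
      (tensAct P (coanalyticEv P C) e) := by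
  refine (whiskerLeft_comp_assoc _ _ _ _).trans ?_
  refine (congrArg (fun k => _ ≫ k) (homEndLift_ev (P.two ⟨y⟩)
    (src X ⋙ (power X V).obj C)
    (fun e => twoAct P ⟨y⟩ (B := (coanalytic P).obj C)
      (A := (coanalytic P).obj ((coanalytic P).obj C) y) (fun z => coanalyticEv P ((coanalytic P).obj C) (⟨y⟩, z))
      (coanalyticEv P C) e)
    (twoAct_naturality P ⟨y⟩ (B := (coanalytic P).obj C) _ _
      (fun σ => homEndEv_naturality (P.at ⟨y⟩) ((power X V).obj ((coanalytic P).obj C)) σ)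
      (coanalyticEv_naturality P C)) e)).trans ?_
  refine (twoStep_left g (𝟙 _) _ ((P.at ⟨y⟩).obj ((tgt X).obj e) ◁ g ≫
      coanalyticEv P ((coanalytic P).obj C) (⟨y⟩, (tgt X).obj e)) _
      (Category.comp_id _).symm).trans ?_
  refine congrArg (fun k => twoStep _ k) ?_
  exact (congrArg (fun k => k ≫ _) (whiskerLeft_id _ _)).trans (Category.id_comp _)

/-- A map into `P^∧ P^∧` is determined by its outer evaluations at words `z`, and these by the inner
ones at all choices over `z`, by `choiceMap_hom_ext`. Up to the identification `tgtIso` and the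
isomorphisms in `twoStep`, the resulting data are the evaluations of `α` at the words of vertices
`c.word`. -/
theorem mono_laxMap {b : Prop} (hb : b) (hV : ∀ A : V, TowerGood b (tensorLeft A))
    (hF : FamilyHomTensorMono V) (P : Distributor X V) (C : X → V) :
    Mono ((laxMap P).app C) := by
  refine mono_of_eval _ fun y => ⟨fun {Z} f g h => ?_⟩
  refine homEnd_ext (P.at ⟨y⟩) ((power X V).obj ((coanalytic P).obj C)) fun z => ?_
  refine choiceMap_hom_ext hb hV hF P (coanalyticEv P C)
    (fun x {Z} f g h => homEnd_ext (P.at x) ((power X V).obj C) h) z _ _ fun c => ?_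
  apply MonoidalClosed.uncurry_injective
  have n : (P.at ⟨y⟩).map c.tgtIso.inv ▷ (coanalytic P).obj ((coanalytic P).obj C) y ≫
      coanalyticEv P ((coanalytic P).obj C) (⟨y⟩, (tgt X).obj c.word) =
      coanalyticEv P ((coanalytic P).obj C) (⟨y⟩, z) ≫
        ((power X V).obj ((coanalytic P).obj C)).map c.tgtIso.inv :=
    homEndEv_naturality (P.at ⟨y⟩) ((power X V).obj ((coanalytic P).obj C)) c.tgtIso.inv
  have key (f : Z ⟶ (coanalytic P).obj ((coanalytic P).obj C) y) :
      MonoidalClosed.uncurry ((P.obj (⟨y⟩, z) ◁ f ≫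
        coanalyticEv P ((coanalytic P).obj C) (⟨y⟩, z)) ≫ choiceMap P (coanalyticEv P C) c) =
      P.tens.obj c.word ◁ (P.at ⟨y⟩).map c.tgtIso.inv ▷ Z ≫ P.tens.obj c.word ◁
        (P.obj (⟨y⟩, (tgt X).obj c.word) ◁ f ≫
          coanalyticEv P ((coanalytic P).obj C) (⟨y⟩, (tgt X).obj c.word)) ≫
        tensAct P (coanalyticEv P C) c.word := by
    rw [MonoidalClosed.uncurry_natural_left, choiceMap, MonoidalClosed.uncurry_curry,
      ← whiskerLeft_comp_assoc]
    refine Eq.trans ?_ (whiskerLeft_comp_assoc _ _ _ _)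
    refine congrArg (fun k => P.tens.obj c.word ◁ k ≫ _) ?_
    refine (Category.assoc _ _ _).trans ?_
    refine (congrArg (fun k => _ ≫ k) n.symm).trans ?_
    exact whisker_exchange_assoc _ _ _
  refine (key f).trans (Eq.trans ?_ (key g).symm)
  refine congrArg (fun k => _ ≫ k) (twoStep_cancel ?_)
  refine (laxMap_ev P f c.word).symm.trans (Eq.trans ?_ (laxMap_ev P g c.word))
  exact congrArg (fun k => (P.two ⟨y⟩).obj c.word ◁ k ≫ _) h

end LaxMono

/-- The cartesian alternative gives `b = False`. The other gives `b = True`, with its second variant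
reduced to the condition on families. -/
theorem BaseHypothesis.exists_towerGood {V : Type u} [Category.{v} V] [MonoidalCategory V]
    [SymmetricCategory V] [MonoidalClosed V] [HasLimits V] (h : BaseHypothesis V) :
    ∃ b : Prop, (∀ A : V, TowerGood b (tensorLeft A)) ∧ (b → FamilyHomTensorMono V) := by
  obtain ⟨h1, h2⟩ | h := h
  · have hV : ∀ A : V, TowerGood True (tensorLeft A) := fun A =>
      ⟨fun _ _ _ f hf => (h2 A).1 f hf, fun K hK => (h2 A).2 K fun f => hK f trivial⟩
    refine ⟨True, hV, fun _ => ?_⟩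
    obtain h1 | ⟨h1, _, h3⟩ := h1
    · exact h1
    · exact familyHomTensorMono_of_monicCoproducts trivial hV h1 h3
  · exact ⟨False, towerGood_of_isCartesian h, False.elim⟩

end CofreeCoalg

namespace CofreeCoalg

/-! ### Acting with the units of an operad -/

section Units

theorem whiskerRight_comp_eq {V : Type u} [Category.{v} V] [MonoidalCategory V] {Q P₀ P₁ P₂ A C C' : V} {q : Q ⟶ P₀} {γ : P₀ ⟶ P₁} {m : P₁ ⟶ P₂}
    {r : Q ⟶ P₂} {F : P₁ ⊗ A ⟶ C} {F' : P₂ ⊗ A ⟶ C'} {s : C ⟶ C'} (h : F ≫ s = m ▷ A ≫ F')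
    (h' : q ≫ γ ≫ m = r) : q ▷ A ≫ (γ ▷ A ≫ F) ≫ s = r ▷ A ≫ F' := by
  rw [← h', Category.assoc, h]
  simp

variable {V : Type u} [Category.{v} V] [MonoidalCategory V] [SymmetricCategory V]

theorem twoStep_comp {P T A B B' C : V} (φ : P ⊗ A ⟶ B) (k : B ⟶ B') (ψ : T ⊗ B' ⟶ C) :
    twoStep (φ ≫ k) ψ = twoStep φ (T ◁ k ≫ ψ) := by
  simp [twoStep]

theorem whiskerRight_twoStep {P P' T T' A B C : V} (a : P ⟶ P') (b : T ⟶ T') (φ : P' ⊗ A ⟶ B)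
    (ψ : T' ⊗ B ⟶ C) :
    (a ⊗ₘ b) ▷ A ≫ twoStep φ ψ = twoStep (a ▷ A ≫ φ) (b ▷ B ≫ ψ) := by
  refine (twoStep_naturality a b (𝟙 B) (𝟙 C) (a ▷ A ≫ φ) φ (b ▷ B ≫ ψ) ψ (by simp)
    (by simp)).trans (Category.comp_id _)

theorem twoStep_leftUnitor {T A B C : V} (h : A ⟶ B) (ψ : T ⊗ B ⟶ C) :
    twoStep ((λ_ A).hom ≫ h) ψ = (λ_ T).hom ▷ A ≫ T ◁ h ≫ ψ := by
  simp [twoStep, braiding_tensorUnit_left]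

theorem twoStep_rightUnitor {P A B C : V} (φ : P ⊗ A ⟶ B) (h : B ⟶ C) :
    twoStep φ ((λ_ B).hom ≫ h) = (ρ_ P).hom ▷ A ≫ φ ≫ h := by
  simp [twoStep, braiding_tensorUnit_right]

/-- The formal part of the right counit law: `b` inserts units into all upper vertices, so the
second step of the action collapses to `w`. -/
theorem twoStep_comp_eq_rightUnitor {P P' T A B B' C C' : V} {a : P' ⟶ P} {b : 𝟙_ V ⟶ T}
    {t : B' ⟶ B} {s : C ⟶ C'} {Φ : P ⊗ A ⟶ B} {φ : P' ⊗ A ⟶ B'} {Ψ : T ⊗ B ⟶ C} {w : B' ⟶ C'}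
    (h : a ▷ A ≫ Φ = φ ≫ t) (h' : (b ⊗ₘ t) ≫ Ψ ≫ s = (λ_ B').hom ≫ w) :
    (a ⊗ₘ b) ▷ A ≫ twoStep Φ Ψ ≫ s = (ρ_ P').hom ▷ A ≫ φ ≫ w := by
  rw [twoStep_right, whiskerRight_twoStep, h, twoStep_comp, ← twoStep_rightUnitor, ← h',
    MonoidalCategory.tensorHom_def', Category.assoc]

theorem tensorμ_unit_unit (A B : V) :
    (λ_ (𝟙_ V)).inv ▷ (A ⊗ B) ≫ tensorμ (𝟙_ V) (𝟙_ V) A B ≫ ((λ_ A).hom ⊗ₘ (λ_ B).hom) =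
      (λ_ (A ⊗ B)).hom := by
  simp only [tensorμ, braiding_tensorUnit_left]
  monoidal

/-- The inductive step of `tensAct_units` for a concatenation of words. -/
theorem tensorHom_tensorμ_unit {T T' A A' B B' C C' D D' : V} {u : 𝟙_ V ⟶ T} {u' : 𝟙_ V ⟶ T'}
    {t : A ⟶ B} {t' : A' ⟶ B'} {f : T ⊗ B ⟶ C} {f' : T' ⊗ B' ⟶ C'} {s : C ⟶ D} {s' : C' ⟶ D'}
    {w : A ⟶ D} {w' : A' ⟶ D'} (h : (u ⊗ₘ t) ≫ f ≫ s = (λ_ A).hom ≫ w)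
    (h' : (u' ⊗ₘ t') ≫ f' ≫ s' = (λ_ A').hom ≫ w') :
    (((λ_ (𝟙_ V)).inv ≫ (u ⊗ₘ u')) ⊗ₘ (t ⊗ₘ t')) ≫ (tensorμ T T' B B' ≫ (f ⊗ₘ f')) ≫
      (s ⊗ₘ s') = (λ_ (A ⊗ A')).hom ≫ (w ⊗ₘ w') := by
  have e : (((λ_ (𝟙_ V)).inv ≫ (u ⊗ₘ u')) ⊗ₘ (t ⊗ₘ t')) =
      (λ_ (𝟙_ V)).inv ▷ (A ⊗ A') ≫ ((u ⊗ₘ u') ⊗ₘ (t ⊗ₘ t')) := by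
    rw [← tensorHom_id, tensorHom_comp_tensorHom, Category.id_comp]
  rw [e, Category.assoc, Category.assoc, tensorμ_natural_assoc, tensorHom_comp_tensorHom,
    tensorHom_comp_tensorHom, h, h', ← tensorHom_comp_tensorHom, ← Category.assoc,
    ← Category.assoc, Category.assoc _ (tensorμ _ _ _ _), tensorμ_unit_unit]

variable {X : Type v}

/-- Acting by units in each factor is the power of the action of the units. -/
theorem tensAct_units (P : Distributor X V) (η : ∀ x : Discrete X, 𝟙_ V ⟶ P.obj (x, FreeSym.of x))
    {B C : X → V} (θ : ∀ p : Vert X, P.obj p ⊗ B p.1.as ⟶ ((power X V).obj C).obj p.2)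
    (w : B ⟶ C)
    (h : ∀ x : Discrete X, η x ▷ B x.as ≫ θ (x, FreeSym.of x) = (λ_ (B x.as)).hom ≫ w x.as)
    (z : SymSeq X) :
    (P.unitsMap η z ⊗ₘ ((power X V).obj B).map (tgtUnits z).inv) ≫ tensAct P θ (units z) ≫
      ((power X V).obj C).map (srcUnits z).hom =
    (λ_ (((power X V).obj B).obj z)).hom ≫ ((power X V).map w).app z := by
  induction z with
  | of x =>
    have e1 : ((power X V).obj B).map (tgtUnits (FreeSym.of x)).inv = 𝟙 (B x.as) :=
      CategoryTheory.Functor.map_id _ _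
    have e2 : ((power X V).obj C).map (srcUnits (FreeSym.of x)).hom = 𝟙 _ :=
      CategoryTheory.Functor.map_id _ _
    refine Eq.trans ?_ (h x)
    refine congrArg₂ (fun k l => k ≫ l) ?_ ?_
    · exact (congrArg (fun k => η x ⊗ₘ k) e1).trans (tensorHom_id _ _)
    · exact (congrArg (fun k => θ (x, FreeSym.of x) ≫ k) e2).trans (Category.comp_id _)
  | unit =>
    have e1 : ((power X V).obj B).map (tgtUnits (FreeSym.unit : SymSeq X)).inv = 𝟙 (𝟙_ V) :=
      CategoryTheory.Functor.map_id _ _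
    have e2 : ((power X V).obj C).map (srcUnits (FreeSym.unit : SymSeq X)).hom = 𝟙 (𝟙_ V) :=
      CategoryTheory.Functor.map_id _ _
    refine (congrArg₂ (fun k l => (𝟙 (𝟙_ V) ⊗ₘ k) ≫ (λ_ (𝟙_ V)).hom ≫ l) e1 e2).trans ?_
    refine (congrArg (fun k => k ≫ _) (id_tensorHom_id _ _)).trans ?_
    exact Category.id_comp _
  | mul a b ha hb =>
    have e1 : ((power X V).obj B).map (tgtUnits (FreeSym.mul a b)).inv =
        (((power X V).obj B).map (tgtUnits a).inv ⊗ₘ ((power X V).obj B).map (tgtUnits b).inv) :=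
      FreeSym.lift_map_tensor _ _ _
    have e2 : ((power X V).obj C).map (srcUnits (FreeSym.mul a b)).hom =
        (((power X V).obj C).map (srcUnits a).hom ⊗ₘ ((power X V).obj C).map (srcUnits b).hom) :=
      FreeSym.lift_map_tensor _ _ _
    refine (congrArg₂ (fun k l => (P.unitsMap η (FreeSym.mul a b) ⊗ₘ k) ≫
      tensAct P θ (units (FreeSym.mul a b)) ≫ l) e1 e2).trans ?_
    exact tensorHom_tensorμ_unit ha hb

end Units

/-! ### The counit laws for pairs equalising `Δ` and `α` -/

section Counits

variable {X : Type v} {V : Type u} [Category.{v} V] [MonoidalCategory V] [SymmetricCategory V]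
  [MonoidalClosed V] [HasLimits V] (P : Operad X V)

/-- The evaluation of `Δ` at a word of vertices. -/
theorem Operad.diag_ev {C : X → V} {y : X} {A : V} (f : A ⟶ (coanalytic P.P).obj C y)
    (e : FreeSym (Vert X)) :
    (P.P.two ⟨y⟩).obj e ◁ (f ≫ P.diag.app C y) ≫
      homEndEv (P.P.two ⟨y⟩) (src X ⋙ (power X V).obj C) e =
    (P.comp ⟨y⟩).app e ▷ A ≫ P.P.obj (⟨y⟩, (src X).obj e) ◁ f ≫
      coanalyticEv P.P C (⟨y⟩, (src X).obj e) := by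
  refine (whiskerLeft_comp_assoc _ _ _ _).trans ?_
  refine (congrArg (fun k => _ ≫ k) (homEndLift_ev (P.P.two ⟨y⟩) (src X ⋙ (power X V).obj C)
    (fun e => (P.comp ⟨y⟩).app e ▷ (coanalytic P.P).obj C y ≫
      coanalyticEv P.P C (⟨y⟩, (src X).obj e)) (fun {e e'} f => ?_) e)).trans ?_
  · refine (Category.assoc _ _ _).symm.trans ?_
    refine (congrArg (fun k => k ≫ _) ((comp_whiskerRight _ _ _).symm.trans
      ((congrArg (fun k => k ▷ (coanalytic P.P).obj C y) ((P.comp ⟨y⟩).naturality f)).trans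
        (comp_whiskerRight _ _ _)))).trans ?_
    refine (Category.assoc _ _ _).trans ?_
    refine Eq.trans ?_ (Category.assoc _ _ _).symm
    exact congrArg (fun k => _ ≫ k)
      (homEndEv_naturality (P.P.at ⟨y⟩) ((power X V).obj C) ((src X).map f))
  · refine (Category.assoc _ _ _).symm.trans ?_
    refine (congrArg (fun k => k ≫ _) (whisker_exchange _ _)).trans ?_
    exact Category.assoc _ _ _

/-- The counit as an action of the units of `P`. -/
theorem Operad.one_whiskerRight_ev {C : X → V} {A : V} {y : X}
    (g : A ⟶ (coanalytic P.P).obj C y) :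
    P.one ⟨y⟩ ▷ A ≫ P.P.obj (⟨y⟩, FreeSym.of ⟨y⟩) ◁ g ≫
      coanalyticEv P.P C (⟨y⟩, FreeSym.of ⟨y⟩) = (λ_ A).hom ≫ g ≫ P.counit.app C y := by
  have h : (λ_ A).hom ≫ g = 𝟙_ V ◁ g ≫ (λ_ ((coanalytic P.P).obj C y)).hom :=
    (leftUnitor_naturality g).symm
  refine (Category.assoc _ _ _).symm.trans ?_
  refine (congrArg (fun k => k ≫ _) (whisker_exchange (P.one ⟨y⟩) g)).symm.trans ?_
  refine Eq.trans ?_ (Category.assoc _ _ _)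
  refine Eq.trans ?_ (congrArg (fun k => k ≫ P.counit.app C y) h).symm
  refine (Category.assoc _ _ _).trans ?_
  refine Eq.trans ?_ (Category.assoc _ _ _).symm
  refine congrArg (fun k => 𝟙_ V ◁ g ≫ k) ?_
  exact (Iso.hom_inv_id_assoc (λ_ ((coanalytic P.P).obj C y)) _).symm

variable {Z A : X → V} (f : Z ⟶ (coanalytic P.P).obj A)
  (g : Z ⟶ (coanalytic P.P).obj ((coanalytic P.P).obj A))

/-- Maps into the end `P^∧₂` are compared after evaluation at every word of vertices, which turns
the pullback condition into a coassociativity equation. -/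
theorem Operad.diag_eq_laxMap_iff :
    f ≫ P.diag.app A = g ≫ (laxMap P.P).app A ↔ ∀ (y : X) (e : FreeSym (Vert X)),
      (P.comp ⟨y⟩).app e ▷ Z y ≫ P.P.obj (⟨y⟩, (src X).obj e) ◁ f y ≫
        coanalyticEv P.P A (⟨y⟩, (src X).obj e) =
      twoStep ((P.P.at ⟨y⟩).obj ((tgt X).obj e) ◁ g y ≫
        coanalyticEv P.P ((coanalytic P.P).obj A) (⟨y⟩, (tgt X).obj e))
        (tensAct P.P (coanalyticEv P.P A) e) := by
  constructor
  · intro h y e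
    refine (P.diag_ev (f y) e).symm.trans (Eq.trans ?_ (laxMap_ev P.P (g y) e))
    exact congrArg (fun k => (P.P.two ⟨y⟩).obj e ◁ k ≫ _) (congrFun h y)
  · intro h
    funext y
    apply homEnd_ext (P.P.two ⟨y⟩) (src X ⋙ (power X V).obj A)
    intro e
    exact (P.diag_ev (f y) e).trans ((h y e).trans (laxMap_ev P.P (g y) e).symm)

/-- Evaluate the equation at the one-vertex word `(y, z)` and insert the unit of `y` at the root. On
the side of `f` this is the law `one_comp`; on the side of `g` it is the counit. -/
theorem Operad.comp_counit_app (h : f ≫ P.diag.app A = g ≫ (laxMap P.P).app A) :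
    g ≫ P.counit.app ((coanalytic P.P).obj A) = f := by
  funext y
  apply homEnd_ext (P.P.at ⟨y⟩) ((power X V).obj A)
  intro z
  have e := (P.diag_eq_laxMap_iff f g).1 h y (FreeSym.of (⟨y⟩, z))
  have e' := congrArg (fun k => (P.one ⟨y⟩ ⊗ₘ 𝟙 (P.P.obj (⟨y⟩, z))) ▷ Z y ≫ k) e
  have e1 := whiskerRight_twoStep (P.one ⟨y⟩) (𝟙 (P.P.obj (⟨y⟩, z)))
    (P.P.obj (⟨y⟩, FreeSym.of ⟨y⟩) ◁ g y ≫
      coanalyticEv P.P ((coanalytic P.P).obj A) (⟨y⟩, FreeSym.of ⟨y⟩))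
    (coanalyticEv P.P A (⟨y⟩, z))
  have e2 : 𝟙 (P.P.obj (⟨y⟩, z)) ▷ (coanalytic P.P).obj A y ≫ coanalyticEv P.P A (⟨y⟩, z) =
      coanalyticEv P.P A (⟨y⟩, z) :=
    (congrArg (fun k => k ≫ _) (id_whiskerRight _ _)).trans (Category.id_comp _)
  have e3 := (e'.trans e1).trans
    (congrArg₂ (fun k l => twoStep k l) (P.one_whiskerRight_ev (g y)) e2)
  have e4 := e3.trans (twoStep_leftUnitor (g y ≫ P.counit.app ((coanalytic P.P).obj A) y) _)
  refine (cancel_epi ((λ_ (P.P.obj (⟨y⟩, z))).hom ▷ Z y)).1 (e4.symm.trans ?_)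
  refine (Category.assoc _ _ _).symm.trans (congrArg (fun k => k ≫ _) ?_)
  refine (comp_whiskerRight _ _ _).symm.trans (congrArg (fun k => k ▷ Z y) ?_)
  refine Eq.trans ?_ (P.one_comp ⟨y⟩ z)
  exact congrArg (fun k => k ≫ _) (tensorHom_id _ _)

/-- Evaluate the equation at `units z` and insert units into all upper vertices. The side of `f`
simplifies by `comp_one`, and by `tensAct_units` the side of `g` becomes the tensor power of the
counit. -/
theorem Operad.comp_map_counit_app (h : f ≫ P.diag.app A = g ≫ (laxMap P.P).app A) :
    g ≫ (coanalytic P.P).map (P.counit.app A) = f := by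
  funext y
  apply homEnd_ext (P.P.at ⟨y⟩) ((power X V).obj A)
  intro z
  let φ := P.P.obj (⟨y⟩, z) ◁ g y ≫ coanalyticEv P.P ((coanalytic P.P).obj A) (⟨y⟩, z)
  have e := (P.diag_eq_laxMap_iff f g).1 h y (units z)
  have n1 : (P.P.at ⟨y⟩).map (tgtUnits z).inv ▷ Z y ≫ P.P.obj (⟨y⟩, (tgt X).obj (units z)) ◁ g y ≫
      coanalyticEv P.P ((coanalytic P.P).obj A) (⟨y⟩, (tgt X).obj (units z)) =
      φ ≫ ((power X V).obj ((coanalytic P.P).obj A)).map (tgtUnits z).inv := by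
    refine (Category.assoc _ _ _).symm.trans ?_
    refine (congrArg (fun k => k ≫ _) (whisker_exchange _ _)).symm.trans ?_
    refine (Category.assoc _ _ _).trans ?_
    refine Eq.trans ?_ (Category.assoc _ _ _).symm
    exact congrArg (fun k => P.P.obj (⟨y⟩, z) ◁ g y ≫ k) (homEndEv_naturality (P.P.at ⟨y⟩)
      ((power X V).obj ((coanalytic P.P).obj A)) (tgtUnits z).inv)
  have n2 : (P.P.obj (⟨y⟩, (src X).obj (units z)) ◁ f y ≫
      coanalyticEv P.P A (⟨y⟩, (src X).obj (units z))) ≫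
        ((power X V).obj A).map (srcUnits z).hom =
      (P.P.at ⟨y⟩).map (srcUnits z).hom ▷ Z y ≫ P.P.obj (⟨y⟩, z) ◁ f y ≫
        coanalyticEv P.P A (⟨y⟩, z) := by
    refine (Category.assoc _ _ _).trans ?_
    refine (congrArg (fun k => _ ≫ k) (homEndEv_naturality (P.P.at ⟨y⟩)
      ((power X V).obj A) (srcUnits z).hom)).symm.trans ?_
    refine (Category.assoc _ _ _).symm.trans ?_
    refine (congrArg (fun k => k ≫ _) (whisker_exchange _ _)).trans ?_
    exact Category.assoc _ _ _
  have n3 := tensAct_units P.P P.one (coanalyticEv P.P A) (P.counit.app A) (fun x => by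
    have := P.one_whiskerRight_ev (C := A) (y := x.as) (𝟙 _)
    refine Eq.trans ?_ (this.trans (congrArg (fun k => _ ≫ k) (Category.id_comp _)))
    refine congrArg (fun k => _ ≫ k) ?_
    exact ((congrArg (fun k => k ≫ _) (whiskerLeft_id _ _)).trans (Category.id_comp _)).symm) z
  have h1 := whiskerRight_comp_eq n2 (P.comp_one ⟨y⟩ z)
  have h2 := twoStep_comp_eq_rightUnitor n1 n3
  have h3 := (congrArg (fun k => ((P.P.at ⟨y⟩).map (tgtUnits z).inv ⊗ₘ
    P.P.unitsMap P.one z) ▷ Z y ≫ k ≫ ((power X V).obj A).map (srcUnits z).hom) e).symm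
  refine (cancel_epi ((ρ_ (P.P.obj (⟨y⟩, z))).hom ▷ Z y)).1
    (Eq.trans ?_ (h2.symm.trans (h3.trans h1)))
  refine congrArg (fun k => (ρ_ (P.P.obj (⟨y⟩, z))).hom ▷ Z y ≫ k) ?_
  refine (whiskerLeft_comp_assoc _ _ _ _).trans ?_
  refine (congrArg (fun k => _ ≫ k) (coanalyticEv_map P.P (P.counit.app A) (⟨y⟩, z))).trans ?_
  exact (Category.assoc _ _ _).symm

end Counits

/-! ### The first stage of the tower of an operad -/

section Lawful

variable {X : Type v} {V : Type u} [Category.{v} V] [MonoidalCategory V] [SymmetricCategory V]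
  [MonoidalClosed V] [HasLimits V]

theorem Operad.lawful_init {b : Prop} (hV : ∀ A : V, TowerGood b (tensorLeft A))
    (hF : b → FamilyHomTensorMono V) (P : Operad X V) :
    (Stage.init P.diag (laxMap P.P)).Lawful b P.counit :=
  Stage.lawful_init P.diag (laxMap P.P) (towerGood_coanalytic hV P.P)
    (towerGood_coanalytic₂ hV P.P) (fun hb C => mono_laxMap hb hV (hF hb) P.P C)
    (fun f g h => P.comp_counit_app f g h) (fun f g h => P.comp_map_counit_app f g h)

end Lawful

/-! ### Coactions as maps into `P^∧` -/

section Coactions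

variable {X : Type v} {V : Type u} [Category.{v} V] [MonoidalCategory V] [SymmetricCategory V]
  [MonoidalClosed V] [HasLimits V] (P : Operad X V)

theorem transpose_injective {P : Distributor X V} {C : X → V} {c c' : C ⟶ (coanalytic P).obj C}
    (h : transpose P c = transpose P c') : c = c' := by
  funext y
  apply homEnd_ext (P.at ⟨y⟩) ((power X V).obj C)
  intro z
  exact congrFun h (⟨y⟩, z)

theorem transpose_naturality {P : Distributor X V} {C : X → V} (c : C ⟶ (coanalytic P).obj C)
    (y : Discrete X) {z z' : SymSeq X} (σ : z ⟶ z') :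
    (P.at y).map σ ▷ C y.as ≫ transpose P c (y, z') =
      transpose P c (y, z) ≫ ((power X V).obj C).map σ := by
  refine (Category.assoc _ _ _).symm.trans ?_
  refine (congrArg (fun k => k ≫ _) (whisker_exchange _ _)).symm.trans ?_
  refine (Category.assoc _ _ _).trans ?_
  refine Eq.trans ?_ (Category.assoc _ _ _).symm
  exact congrArg (fun k => _ ≫ k) (homEndEv_naturality (P.at y) ((power X V).obj C) σ)

theorem exists_transpose_eq {P : Distributor X V} {C : X → V}
    (act : ∀ p : Vert X, P.obj p ⊗ C p.1.as ⟶ ((power X V).obj C).obj p.2)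
    (h : ∀ (y : Discrete X) {z z' : SymSeq X} (σ : z ⟶ z'),
      (P.at y).map σ ▷ C y.as ≫ act (y, z') = act (y, z) ≫ ((power X V).obj C).map σ) :
    ∃ c : C ⟶ (coanalytic P).obj C, transpose P c = act :=
  ⟨fun y => homEndLift (P.at ⟨y⟩) ((power X V).obj C) (A := C y) (fun z => act (⟨y⟩, z))
      (fun σ => h ⟨y⟩ σ),
    funext fun p => homEndLift_ev (P.at p.1) ((power X V).obj C) (A := C p.1.as)
      (fun z => act (p.1, z)) (fun σ => h p.1 σ) p.2⟩

/-- Maps compatible with two coactions. -/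
theorem transpose_comm_iff {P : Distributor X V} {C D : X → V} (c : C ⟶ (coanalytic P).obj C)
    (d : D ⟶ (coanalytic P).obj D) (f : C ⟶ D) :
    (∀ p : Vert X, transpose P c p ≫ ((power X V).map f).app p.2 =
      P.obj p ◁ f p.1.as ≫ transpose P d p) ↔ c ≫ (coanalytic P).map f = f ≫ d := by
  have h1 (p : Vert X) : transpose P c p ≫ ((power X V).map f).app p.2 =
      P.obj p ◁ (c ≫ (coanalytic P).map f) p.1.as ≫ coanalyticEv P D p := by
    refine (Category.assoc _ _ _).trans ?_
    refine (congrArg (fun k => _ ≫ k) (coanalyticEv_map P f p)).symm.trans ?_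
    exact (whiskerLeft_comp_assoc _ _ _ _).symm
  have h2 (p : Vert X) : P.obj p ◁ f p.1.as ≫ transpose P d p =
      P.obj p ◁ (f ≫ d) p.1.as ≫ coanalyticEv P D p :=
    (whiskerLeft_comp_assoc _ _ _ _).symm
  constructor
  · intro h
    funext y
    apply homEnd_ext (P.at ⟨y⟩) ((power X V).obj D)
    intro z
    exact (h1 (⟨y⟩, z)).symm.trans ((h (⟨y⟩, z)).trans (h2 (⟨y⟩, z)))
  · intro h p
    exact (h1 p).trans ((congrArg (fun k : C ⟶ (coanalytic P).obj D =>
      P.obj p ◁ k p.1.as ≫ coanalyticEv P D p) h).trans (h2 p).symm)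

/-- Equivariance is built into the end. The unit axiom transposes to the counit equation. The
coassociativity axiom transposes to the condition for `c` and `c ≫ (coanalytic P.P).map c` to define
a map into `Q_1`. -/
theorem Operad.isCoaction_transpose_iff {C : X → V} (c : C ⟶ (coanalytic P.P).obj C) :
    P.IsCoaction C (transpose P.P c) ↔ c ≫ P.counit.app C = 𝟙 C ∧
      c ≫ P.diag.app C = (c ≫ (coanalytic P.P).map c) ≫ (laxMap P.P).app C := by
  have hc (y : X) : P.one ⟨y⟩ ▷ C y ≫ transpose P.P c (⟨y⟩, FreeSym.of ⟨y⟩) =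
      (λ_ (C y)).hom ≫ (c ≫ P.counit.app C) y :=
    P.one_whiskerRight_ev (c y)
  have ht (y : X) (e : FreeSym (Vert X)) :
      twoStep ((P.P.at ⟨y⟩).obj ((tgt X).obj e) ◁ (c ≫ (coanalytic P.P).map c) y ≫
        coanalyticEv P.P ((coanalytic P.P).obj C) (⟨y⟩, (tgt X).obj e))
        (tensAct P.P (coanalyticEv P.P C) e) =
      twoAct P.P ⟨y⟩ (fun z => transpose P.P c (⟨y⟩, z)) (transpose P.P c) e := by
    have h1 : (P.P.at ⟨y⟩).obj ((tgt X).obj e) ◁ (c ≫ (coanalytic P.P).map c) y ≫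
        coanalyticEv P.P ((coanalytic P.P).obj C) (⟨y⟩, (tgt X).obj e) =
        transpose P.P c (⟨y⟩, (tgt X).obj e) ≫ ((power X V).map c).app ((tgt X).obj e) := by
      refine (whiskerLeft_comp_assoc _ _ _ _).trans ?_
      refine (congrArg (fun k => _ ≫ k) (coanalyticEv_map P.P c (⟨y⟩, (tgt X).obj e))).trans ?_
      exact (Category.assoc _ _ _).symm
    refine (congrArg (fun k => twoStep k _) h1).trans ?_
    refine (twoStep_comp _ _ _).trans ?_
    exact congrArg (fun k => twoStep _ k) (tensAct_comp_left P.P c (coanalyticEv P.P C) e)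
  rw [P.diag_eq_laxMap_iff]
  constructor
  · rintro ⟨_, h1, h2⟩
    refine ⟨?_, fun y e => (h2 ⟨y⟩ e).trans (ht y e).symm⟩
    funext y
    refine (cancel_epi (λ_ (C y)).hom).1 ((hc y).symm.trans ((h1 ⟨y⟩).trans ?_))
    exact (Category.comp_id _).symm
  · rintro ⟨h1, h2⟩
    refine ⟨transpose_naturality c, fun y => (hc y.as).trans ?_,
      fun y e => (h2 y.as e).trans (ht y.as e)⟩
    exact (congrArg (fun k : C ⟶ C => (λ_ (C y.as)).hom ≫ k y.as) h1).trans (Category.comp_id _)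

end Coactions

end CofreeCoalg

namespace CofreeCoalg

/-! ### Comparison of `Q_∞`-coalgebras with `P`-coalgebras -/

section Comparison

variable {X : Type v} {V : Type u} [Category.{v} V] [MonoidalCategory V] [SymmetricCategory V]
  [MonoidalClosed V] [HasLimits V] {P : Operad X V} {W : ComonadStructure P.Qinf}

namespace Operad

/-- A coalgebra over the comonad `Q_∞` is a `P`-coalgebra. -/
theorem isCoaction_of_coalgebra (hc : W.counit = P.proj ≫ P.counit)
    (hδ : ∀ k, W.comult ≫ (P.π k ◫ P.π k) = P.π (k + 1) ≫ P.δ k)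
    (A : W.toComonad.Coalgebra) :
    P.IsCoaction A.A (transpose P.P (A.a ≫ P.proj.app A.A)) := by
  refine (P.isCoaction_transpose_iff _).2 ⟨?_, ?_⟩
  · refine Eq.trans ?_ A.counit
    refine (Category.assoc _ _ _).trans (congrArg (fun k => A.a ≫ k) ?_)
    exact (congrArg (fun k => k.app A.A) hc).symm
  · have h := ComultTower.coacts_of_coalgebra
      (S := (Stage.init P.diag (laxMap P.P)).comultTower) (W := W) hδ A.a A.coassoc 0
    have hw := (Stage.isPullback_init P.diag (laxMap P.P) A.A).w
    refine (congrArg (fun k => k ≫ P.diag.app A.A) h.χ).symm.trans ?_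
    refine Eq.trans ?_ (congrArg (fun k => k ≫ (laxMap P.P).app A.A) h.δ)
    refine (Category.assoc _ _ _).trans (Eq.trans ?_ (Category.assoc _ _ _).symm)
    exact congrArg (fun k => _ ≫ k) hw

/-- The functor from coalgebras over the comonad `Q_∞` to `P`-coalgebras. -/
noncomputable def toCoalgebra (hc : W.counit = P.proj ≫ P.counit)
    (hδ : ∀ k, W.comult ≫ (P.π k ◫ P.π k) = P.π (k + 1) ≫ P.δ k) :
    W.toComonad.Coalgebra ⥤ P.Coalgebra where
  obj A := ⟨A.A, transpose P.P (A.a ≫ P.proj.app A.A), isCoaction_of_coalgebra hc hδ A⟩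
  map {A B} f := ⟨f.f, (transpose_comm_iff _ _ f.f).2 (by
    have h : A.a ≫ P.Qinf.map f.f = f.f ≫ B.a := f.h
    refine (Category.assoc _ _ _).trans ?_
    refine (congrArg (fun k => A.a ≫ k) (P.proj.naturality f.f)).symm.trans ?_
    refine (Category.assoc _ _ _).symm.trans ?_
    exact (congrArg (fun k => k ≫ P.proj.app B.A) h).trans (Category.assoc _ _ _))⟩

variable (hc : W.counit = P.proj ≫ P.counit)
  (hδ : ∀ k, W.comult ≫ (P.π k ◫ P.π k) = P.π (k + 1) ≫ P.δ k)

instance : (toCoalgebra hc hδ).Faithful where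
  map_injective {A B} f g h := by
    apply Comonad.Coalgebra.Hom.ext
    exact congrArg (fun k => Coalgebra.Hom.f k) h

theorem coalgebra_map_comm {b : Prop} (hP : (Stage.init P.diag (laxMap P.P)).Lawful b P.counit)
    (hδ : ∀ k, W.comult ≫ (P.π k ◫ P.π k) = P.π (k + 1) ≫ P.δ k)
    (A B : W.toComonad.Coalgebra) (f : A.A ⟶ B.A)
    (hf : (A.a ≫ P.proj.app A.A) ≫ (coanalytic P.P).map f = f ≫ B.a ≫ P.proj.app B.A) :
    A.a ≫ P.Qinf.map f = f ≫ B.a :=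
  ComultTower.JointlyMono.map_comm (S := (Stage.init P.diag (laxMap P.P)).comultTower)
    (W := W) hδ hP.comultTower_jointlyMono A.a A.coassoc B.a B.coassoc f hf

theorem toCoalgebra_full {b : Prop} (hP : (Stage.init P.diag (laxMap P.P)).Lawful b P.counit) :
    (toCoalgebra hc hδ).Full where
  map_surjective {A B} g :=
    ⟨⟨g.f, coalgebra_map_comm hP hδ A B g.f ((transpose_comm_iff _ _ g.f).1 g.comm)⟩, rfl⟩

/-- If two structures on `A` have the same projection to `P^∧`, then the identity respects these
projections, so by `coalgebra_map_comm` it is a map of `Q_∞`-coalgebras and the structures coincide.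
-/
theorem toCoalgebra_injective {b : Prop}
    (hP : (Stage.init P.diag (laxMap P.P)).Lawful b P.counit) :
    Function.Injective (toCoalgebra hc hδ).obj := by
  rintro ⟨A, a, h1, h2⟩ ⟨B, b, h3, h4⟩ h
  obtain rfl : A = B := congrArg Coalgebra.carrier h
  have ht : transpose P.P (a ≫ P.proj.app A) = transpose P.P (b ≫ P.proj.app A) :=
    eq_of_heq (Coalgebra.mk.inj h).2
  have hab := transpose_injective ht
  have key := coalgebra_map_comm hP hδ ⟨A, a, h1, h2⟩ ⟨A, b, h3, h4⟩ (𝟙 A) (by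
    rw [CategoryTheory.Functor.map_id, Category.comp_id, Category.id_comp]
    exact hab)
  obtain rfl : a = b := (Category.comp_id a).symm.trans
    ((congrArg (fun k => a ≫ k) (P.Qinf.map_id A)).symm.trans (key.trans (Category.id_comp b)))
  rfl

theorem toCoalgebra_surjective {b : Prop}
    (hP : (Stage.init P.diag (laxMap P.P)).Lawful b P.counit) :
    Function.Surjective (toCoalgebra hc hδ).obj := by
  rintro ⟨A, act, h⟩
  obtain ⟨c, rfl⟩ := exists_transpose_eq act h.equivariant
  obtain ⟨h1, h2⟩ := (P.isCoaction_transpose_iff c).1 h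
  -- The coassociativity equation `h2` provides the lift to `Q_1`, and the lifts to all higher
  -- levels follow from it.
  obtain ⟨f, hf, hf'⟩ := Stage.exists_coacts (Stage.init P.diag (laxMap P.P)) c
    (Stage.coacts_init P.diag (laxMap P.P) c h2)
  obtain ⟨a, ha, ha', ha''⟩ := ComultTower.Lawful.exists_coalgebra
    (S := (Stage.init P.diag (laxMap P.P)).comultTower) (W := W) hδ
    hP.comultTower hc f hf' (by rw [hf]; exact h1)
  refine ⟨⟨A, a, ha, ha'⟩, ?_⟩
  have e : a ≫ P.proj.app A = c := ha''.trans hf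
  subst e
  rfl

theorem toCoalgebra_isEquivalence {b : Prop}
    (hP : (Stage.init P.diag (laxMap P.P)).Lawful b P.counit) :
    (toCoalgebra hc hδ).IsEquivalence where
  full := toCoalgebra_full hc hδ hP
  essSurj := ⟨fun D => by
    obtain ⟨A, rfl⟩ := toCoalgebra_surjective hc hδ hP D
    exact ⟨A, ⟨Iso.refl _⟩⟩⟩

/-- Maps of `P`-coalgebras into `Q_∞(C)` correspond to maps into `C`. -/
theorem bijective_map_comp_counit {b : Prop}
    (hP : (Stage.init P.diag (laxMap P.P)).Lawful b P.counit) (D : P.Coalgebra) (C : X → V) :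
    Function.Bijective (fun g : D ⟶ (toCoalgebra hc hδ).obj (W.toComonad.cofree.obj C) =>
      (P.forget.map g ≫ W.counit.app C : D.carrier ⟶ C)) := by
  -- With `D` in the image, the map is the composite of full faithfulness and the cofree adjunction
  -- of the comonad.
  obtain ⟨A, rfl⟩ := toCoalgebra_surjective hc hδ hP D
  have := toCoalgebra_full hc hδ hP
  let F := Functor.FullyFaithful.ofFullyFaithful (toCoalgebra hc hδ)
  have h : (fun g : (toCoalgebra hc hδ).obj A ⟶
      (toCoalgebra hc hδ).obj (W.toComonad.cofree.obj C) =>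
      (P.forget.map g ≫ W.counit.app C : A.A ⟶ C)) =
      (W.toComonad.adj.homEquiv A C).symm ∘ F.homEquiv.symm := by
    funext g
    obtain ⟨k, rfl⟩ := F.homEquiv.surjective g
    refine Eq.trans ?_ (congrArg (W.toComonad.adj.homEquiv A C).symm
      (F.homEquiv.symm_apply_apply k)).symm
    have e : W.toComonad.adj.counit.app C = W.counit.app C := Category.id_comp (W.counit.app C)
    refine Eq.trans ?_ (W.toComonad.adj.homEquiv_counit A C k).symm
    exact (congrArg (fun l => k.f ≫ l) e).symm
  exact h ▸ (Equiv.bijective _).comp (Equiv.bijective _)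

/-- The adjunction between `P`-coalgebras and families of objects. -/
noncomputable def cofreeAdj {b : Prop}
    (hP : (Stage.init P.diag (laxMap P.P)).Lawful b P.counit) :
    P.forget ⊣ W.toComonad.cofree ⋙ toCoalgebra hc hδ :=
  Adjunction.mkOfHomEquiv
    { homEquiv := fun D C => (Equiv.ofBijective _ (bijective_map_comp_counit hc hδ hP D C)).symm
      homEquiv_naturality_left_symm := fun {D D' C} f g =>
        Category.assoc (P.forget.map f) (P.forget.map g) (W.counit.app C)
      homEquiv_naturality_right := fun {D C C'} f g => by
        refine (Equiv.symm_apply_eq _).2 ?_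
        obtain ⟨k, rfl⟩ := (bijective_map_comp_counit hc hδ hP D C).2 f
        have h : (Equiv.ofBijective _ (bijective_map_comp_counit hc hδ hP D C)).symm
          (P.forget.map k ≫ W.counit.app C) = k :=
          (Equiv.ofBijective _ (bijective_map_comp_counit hc hδ hP D C)).symm_apply_apply k
        refine Eq.trans ?_ (congrArg (fun l => P.forget.map
          (l ≫ (W.toComonad.cofree ⋙ toCoalgebra hc hδ).map g) ≫ W.counit.app C') h).symm
        refine (Category.assoc _ _ _).trans (Eq.trans ?_ (Category.assoc _ _ _).symm)
        exact congrArg (fun l => P.forget.map k ≫ l) (W.counit.naturality g).symm }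

theorem cofreeAdj_counit {b : Prop}
    (hP : (Stage.init P.diag (laxMap P.P)).Lawful b P.counit) (C : X → V) :
    (cofreeAdj hc hδ hP).counit.app C = W.counit.app C :=
  Category.id_comp (W.counit.app C)

/-- The unit is the only coalgebra map whose composite with the counit is the identity; by the
counit axiom the structure map has this property. -/
theorem cofreeAdj_unit {b : Prop}
    (hP : (Stage.init P.diag (laxMap P.P)).Lawful b P.counit) (A : W.toComonad.Coalgebra) :
    (cofreeAdj hc hδ hP).unit.app ((toCoalgebra hc hδ).obj A) =
      (toCoalgebra hc hδ).map (⟨A.a, A.coassoc.symm⟩ : A ⟶ W.toComonad.cofree.obj A.A) :=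
  (Equiv.symm_apply_eq _).2 A.counit.symm

/-- The comonad of `cofreeAdj` has underlying functor `Q_∞`. By `cofreeAdj_counit` and
`cofreeAdj_unit` its counit and comultiplication are those of `W`, so its coalgebras have the same
data and axioms as those of `W`, and these are the images of `P`-coalgebras. -/
theorem comparison_isEquivalence {b : Prop}
    (hP : (Stage.init P.diag (laxMap P.P)).Lawful b P.counit) :
    (Comonad.comparison (cofreeAdj hc hδ hP)).IsEquivalence := by
  have hu (A : W.toComonad.Coalgebra) :
      P.forget.map ((cofreeAdj hc hδ hP).unit.app ((toCoalgebra hc hδ).obj A)) = A.a :=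
    congrArg P.forget.map (cofreeAdj_unit hc hδ hP A)
  have : P.forget.Faithful := ⟨fun h => Coalgebra.Hom.ext h⟩
  refine { full := ⟨fun {D D'} f => ?_⟩, essSurj := ⟨fun B => ?_⟩ }
  · obtain ⟨A, rfl⟩ := toCoalgebra_surjective hc hδ hP D
    obtain ⟨A', rfl⟩ := toCoalgebra_surjective hc hδ hP D'
    have h : A.a ≫ P.Qinf.map f.f = f.f ≫ A'.a :=
      (congrArg (fun k => k ≫ P.Qinf.map f.f) (hu A)).symm.trans
        (f.h.trans (congrArg (fun k => f.f ≫ k) (hu A')))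
    exact ⟨(toCoalgebra hc hδ).map ⟨f.f, h⟩, Comonad.Coalgebra.Hom.ext rfl⟩
  · let A : W.toComonad.Coalgebra :=
      { A := B.A
        a := B.a
        counit := (congrArg (fun k => B.a ≫ k) (cofreeAdj_counit hc hδ hP B.A)).symm.trans
          B.counit
        coassoc := (congrArg (fun k => B.a ≫ k) (hu (W.toComonad.cofree.obj B.A))).symm.trans
          B.coassoc }
    refine ⟨(toCoalgebra hc hδ).obj A, ⟨Comonad.Coalgebra.isoMk (Iso.refl B.A) ?_⟩⟩
    refine (congrArg (fun k => k ≫ _) (hu A)).trans ?_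
    refine (congrArg (fun k => B.a ≫ k) (CategoryTheory.Functor.map_id _ _)).trans ?_
    exact (Category.comp_id _).trans (Category.id_comp _).symm

end Operad

end Comparison

end CofreeCoalg

theorem mainTheorem2 {X : Type v} {V : Type u} [Category.{v} V] [MonoidalCategory V]
    [SymmetricCategory V] [MonoidalClosed V] [HasLimits V]
    (hV : CofreeCoalg.BaseHypothesis V) (P : CofreeCoalg.Operad X V) :
    ∃ W : CofreeCoalg.ComonadStructure P.Qinf,
      -- the comonad structure of `Q_∞` is the one induced by the tower, and it is unique
      (W.counit = P.proj ≫ P.counit ∧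
        ∀ k, W.comult ≫ (P.π k ◫ P.π k) = P.π (k + 1) ≫ P.δ k) ∧
      (∀ W' : CofreeCoalg.ComonadStructure P.Qinf,
        (W'.counit = P.proj ≫ P.counit ∧
          ∀ k, W'.comult ≫ (P.π k ◫ P.π k) = P.π (k + 1) ≫ P.δ k) → W' = W) ∧
      -- coalgebras over the comonad are the same as `P`-coalgebras
      (∃ Φ : W.toComonad.Coalgebra ⥤ P.Coalgebra,
        Φ.IsEquivalence ∧ Function.Bijective Φ.obj ∧
        Φ ⋙ P.forget = Comonad.forget W.toComonad ∧
        ∀ A : W.toComonad.Coalgebra,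
          ∃ H : P.IsCoaction A.A (CofreeCoalg.transpose P.P (A.a ≫ P.proj.app A.A)),
            Φ.obj A = ⟨A.A, CofreeCoalg.transpose P.P (A.a ≫ P.proj.app A.A), H⟩) ∧
      -- `Q_∞(C)` is the cofree `P`-coalgebra on `C`
      (∀ C : X → V,
        ∃ H : P.IsCoaction (P.Qinf.obj C)
            (CofreeCoalg.transpose P.P (W.comult.app C ≫ P.proj.app (P.Qinf.obj C))),
          ∀ (D : P.Coalgebra) (f : D.carrier ⟶ C),
            ∃! g : D ⟶ (⟨P.Qinf.obj C,
                CofreeCoalg.transpose P.P (W.comult.app C ≫ P.proj.app (P.Qinf.obj C)), H⟩ :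
                  P.Coalgebra),
              P.forget.map g ≫ W.counit.app C = f) ∧
      -- the category of `P`-coalgebras is comonadic over `V^X`
      Nonempty (ComonadicLeftAdjoint P.forget) := by
  obtain ⟨b, hT, hF⟩ := hV.exists_towerGood
  have hP := P.lawful_init hT hF
  obtain ⟨W, hc, hδ⟩ := hP.comultTower.exists_comonadStructure
  -- The limit of `Stage.comultTower` and its projections unfold definitionally to `P.Qinf`, `P.π`
  -- and `P.proj`.
  change CofreeCoalg.ComonadStructure P.Qinf at W
  change W.counit = P.proj ≫ P.counit at hc
  change ∀ k, W.comult ≫ (P.π k ◫ P.π k) = P.π (k + 1) ≫ P.δ k at hδ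
  refine ⟨W, ⟨hc, hδ⟩, fun W' h => ?_, ⟨CofreeCoalg.Operad.toCoalgebra hc hδ,
    CofreeCoalg.Operad.toCoalgebra_isEquivalence hc hδ hP,
    ⟨CofreeCoalg.Operad.toCoalgebra_injective hc hδ hP,
      CofreeCoalg.Operad.toCoalgebra_surjective hc hδ hP⟩, rfl,
    fun A => ⟨CofreeCoalg.Operad.isCoaction_of_coalgebra hc hδ A, rfl⟩⟩,
    fun C => ⟨CofreeCoalg.Operad.isCoaction_of_coalgebra hc hδ (W.toComonad.cofree.obj C),
      fun D f => ?_⟩,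
    ⟨⟨_, CofreeCoalg.Operad.cofreeAdj hc hδ hP,
      CofreeCoalg.Operad.comparison_isEquivalence hc hδ hP⟩⟩⟩
  · exact hP.comultTower.comonadStructure_unique (h.1.trans hc.symm) h.2 hδ
  · exact (CofreeCoalg.Operad.bijective_map_comp_counit hc hδ hP D C).existsUnique f
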